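/- **Setting.** For $w\in\mathbb R^3$ let $\hat w$ be the skew matrix with $\hat w y=w\times y$, and let $^\vee$ be the inverse of $w\mapsto\hat w$. $\|\cdot\|$ is the Euclidean norm (operator norm for matrices), and $\lambda_{\min},\lambda_{\max}$ are the extreme eigenvalues of a symmetric matrix. Let $m_L>0$, $g\in\mathbb R$, $J_L\in\mathbb R^{3\times3}$ symmetric positive definite, $r_1,\dots,r_4\in\mathbb R^3$, $e_3=(0,0,1)^T$, and let $k_{x_L},k_{v_L},k_{R_L},k_{\Omega_L},k_q,k_\omega\in\mathbb R$ be gains. Assume that $$\mathcal P=\begin{bmatrix} I_3&\cdots& I_3\\ \hat r_1&\cdots&\hat r_4\end{bmatrix}\in\mathbb R^{6\times12}$$ has rank $6$. The desired motion consists of smooth $\tilde x_L(t)\in\mathbb R^3$, $\tilde R_L(t)\in SO(3)$, $\tilde\Omega_L(t)\in\mathbb R^3$ with $\dot{\tilde R}_L=\tilde R_L\hat{\tilde\Omega}_L$; put $\tilde v_L=\dot{\tilde x}_L$. Assume that $\ddot{\tilde x}_L,\dddot{\tilde x}_L,\tilde\Omega_L,\dot{\tilde\Omega}_L,\ddot{\tilde\Omega}_L$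 are bounded for $t\ge0$. For load states $(x_L,v_L,R_L,\Omega_L)$ with $R_L\in SO(3)$ put $e_{x_L}=x_L-\tilde x_L$, $e_{v_L}=v_L-\tilde v_L$, $e_{R_L}=\frac12(\tilde R_L^TR_L-R_L^T\tilde R_L)^\vee$, $e_{\Omega_L}=\Omega_L-w$ with $w=R_L^T\tilde R_L\tilde\Omega_L$, and $$\tilde F=m_L(-k_{x_L}e_{x_L}-k_{v_L}e_{v_L}+\dot{\tilde v}_L+ge_3),\qquad \tilde M=-k_{R_L}e_{R_L}-k_{\Omega_L}e_{\Omega_L}+\hat wJ_Lw+J_LR_L^T\tilde R_L\dot{\tilde\Omega}_L,$$ $$\begin{bmatrix}\tilde\mu_1\\ \vdots\\ \tilde\mu_4\end{bmatrix}=\operatorname{diag}(R_L,\dots,R_L)\,\mathcal P^T(\mathcal P\mathcal P^T)^{-1}\begin{bmatrix}R_L^T\tilde F\\ \tilde M\end{bmatrix},\qquad \tilde q_j=-\frac{\tilde\mu_j}{\|\tilde\mu_j\|}.$$ Assume that along the desired motion (that is, at $(\tilde x_L,\tilde v_L,\tilde R_L,\tilde\Omega_L)$) the norms $\|\tilde\mu_j\|$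 are bounded below by a positive constant for $t\ge 0$. For cable directions $q_j\in S^2$ with $\dot q_j=\omega_j\times q_j$, $\omega_j\perp q_j$, let $\tilde\omega_j\perp\tilde q_j$ be given by $\dot{\tilde q}_j=\tilde\omega_j\times\tilde q_j$, and put $e_{q_j}=\tilde q_j\times q_j$, $e_{\omega_j}=\omega_j+\hat q_j^2\tilde\omega_j$. The *error dynamics* consist of these kinematic relations, $\dot x_L=v_L$, $\dot R_L=R_L\hat\Omega_L$, and $$\dot e_{v_L}=-k_{v_L}e_{v_L}-k_{x_L}e_{x_L}-\tfrac1{m_L}\sum_{j=1}^4(\tilde q_j^T\tilde\mu_j)\hat q_je_{q_j},$$ $$J_L\dot e_{\Omega_L}=-k_{\Omega_L}e_{\Omega_L}-k_{R_L}e_{R_L}+\big[J_Le_{\Omega_L}+(2J_L-\operatorname{Tr}(J_L)I)w\big]^{\wedge}e_{\Omega_L}-\sum_{j=1}^4\hat r_jR_L^T(\tilde q_j^T\tilde\mu_j)\hat q_je_{q_j},$$ $$\dot e_{\omega_j}=(\dot q_j^T\tilde\omega_j)q_j-k_\omega e_{\omega_j}-k_qe_{q_j},\qquad j=1,\dots,4,$$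 considered as long as all $\tilde\mu_j\neq0$. Put $\Psi_{R_L}=\frac12\operatorname{Tr}(I-\tilde R_L^TR_L)$, $\Psi_{q_j}=1-\tilde q_j^Tq_j$, fix $e_{x_{\max}}>0$, $\psi_{R_L},\psi_{q_j}\in(0,1)$, and let $\mathcal D$ be the domain $\|e_{x_L}\|<e_{x_{\max}}$, $\Psi_{R_L}<\psi_{R_L}$, $\Psi_{q_j}<\psi_{q_j}$ $(j=1,\dots,4)$. **Matrices.** Let $c_x,c_R,c_q>0$ and let $B,C_{q_1},\dots,C_{q_4}\ge0$ be constants (any values, in particular the bounds obtained from the desired motion). Put $\alpha_j=\sqrt{\psi_{q_j}(2-\psi_{q_j})}$, $\alpha_L=\sqrt{\psi_{R_L}(2-\psi_{R_L})}$, $\gamma=\frac1{m_L\lambda_{\min}(\mathcal P\mathcal P^T)}$, $\beta=m_L\gamma$, $\delta_j=m_L\frac{\|\hat r_j\|}{\sqrt{\lambda_{\min}(\mathcal P\mathcal P^T)}}$, $\sigma_j=\frac{\delta_j}{m_L}$, and, writing $\lambda_M=\lambda_{\max}(J_L)$, $\lambda_m=\lambda_{\min}(J_L)$, $$\underline P_{x_L}=\tfrac12\begin{bmatrix}k_{x_L}&-c_x\\-c_x&1\end{bmatrix},\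 \bar P_{x_L}=\tfrac12\begin{bmatrix}k_{x_L}&c_x\\c_x&1\end{bmatrix},\ \underline P_{R_L}=\tfrac12\begin{bmatrix}2k_{R_L}&-c_R\lambda_M\\-c_R\lambda_M&\lambda_m\end{bmatrix},\ \bar P_{R_L}=\tfrac12\begin{bmatrix}\frac{2k_{R_L}}{2-\psi_{R_L}}&c_R\lambda_M\\c_R\lambda_M&\lambda_M\end{bmatrix},$$ $$\underline P_{q_j}=\tfrac12\begin{bmatrix}2k_q&-c_q\\-c_q&1\end{bmatrix},\quad \bar P_{q_j}=\tfrac12\begin{bmatrix}\frac{2k_q}{2-\psi_{q_j}}&c_q\\c_q&1\end{bmatrix},$$ $$W_{x_j}=\tfrac14\begin{bmatrix}c_xk_{x_L}(1-4\alpha_j\beta)&-\frac12c_xk_{v_L}(1+4\alpha_j\beta)\\-\frac12c_xk_{v_L}(1+4\alpha_j\beta)&k_{v_L}(1-4\alpha_j\beta)-c_x\end{bmatrix},$$ $$W_{R_j}=\tfrac14\begin{bmatrix}c_Rk_{R_L}(1-4\alpha_j\sigma_j)&-\frac{c_R}2(k_{\Omega_L}+B+4\alpha_j\sigma_j)\\-\frac{c_R}2(k_{\Omega_L}+B+4\alpha_j\sigma_j)&k_{\Omega_L}(1-4\alpha_j\sigma_j)-2c_R\lambda_M\end{bmatrix},$$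 $$W_{q_j}=\begin{bmatrix}c_qk_q&-\frac12c_q(k_\omega+C_{q_j})\\-\frac12c_q(k_\omega+C_{q_j})&k_\omega-c_q\end{bmatrix},\quad W_{xR_j}=\alpha_j\begin{bmatrix}\gamma c_xk_{R_L}+\delta_jc_Rk_{x_L}&\gamma c_xk_{\Omega_L}+\delta_jk_{x_L}\\\gamma k_{R_L}+\delta_jc_Rk_{v_L}&\gamma k_{\Omega_L}+\delta_jk_{v_L}\end{bmatrix},$$ $$W_{xq_j}=\begin{bmatrix}c_xB&0\\\beta k_{x_L}e_{x_{\max}}+B&0\end{bmatrix},\quad W_{Rq_j}=\begin{bmatrix}c_RB&0\\\alpha_L\sigma_jk_{R_L}+B&0\end{bmatrix},\quad W_j=\begin{bmatrix}W_{x_j}&-\frac12W_{xR_j}&-\frac12W_{xq_j}\\-\frac12W_{xR_j}&W_{R_j}&-\frac12W_{Rq_j}\\-\frac12W_{xq_j}&-\frac12W_{Rq_j}&W_{q_j}\end{bmatrix}.$$ **Lemma 1.** If $\bar P_{x_L},\underline P_{x_L},\bar P_{R_L},\underline P_{R_L},\bar P_{q_j},\underline P_{q_j}$ and $\frac12(W_j+W_j^T)$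 are positive definite for $j=1,\dots,4$, then the origin of the error dynamics is an exponentially stable equilibrium point. That is: from every $t_0\ge0$ there is a solution in $\mathcal D$ with identically vanishing error; and, with $e=(e_{x_L},e_{v_L},e_{R_L},e_{\Omega_L},e_{q_1},\dots,e_{q_4},e_{\omega_1},\dots,e_{\omega_4})$, there are $c,K,\lambda>0$ such that for all $t_0\ge0$ every initial error in $\mathcal D$ with $\|e(t_0)\|<c$ is the initial error of a solution on $[t_0,\infty)$, and every solution with such an initial error, on any interval $[t_0,T)$, stays in $\mathcal D$ and satisfies $\|e(t)\|\le K\|e(t_0)\|e^{-\lambda(t-t_0)}$ there. -/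

import Mathlib

open scoped Matrix ContDiff

noncomputable section

namespace CableLoad

/-! ### Vectors and matrices in three dimensions -/

/-- Column vectors of length three. -/
abbrev Vec3 := Fin 3 → ℝ

/-- Real three by three matrices. -/
abbrev Mat3 := Matrix (Fin 3) (Fin 3) ℝ

/-- The Euclidean norm. -/
def vnorm (x : Vec3) : ℝ := Real.sqrt (x ⬝ᵥ x)

/-- The third vector of the standard basis. -/
def e3 : Vec3 := ![0, 0, 1]

/-- The hat isomorphism onto skew-symmetric matrices: `hat w *ᵥ y = w ⨯₃ y`. -/
def hat (w : Vec3) : Mat3 :=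
  !![0, -w 2, w 1;
     w 2, 0, -w 0;
     -w 1, w 0, 0]

/-- The inverse of the hat map on skew-symmetric matrices. -/
def vee (A : Mat3) : Vec3 := ![A 2 1, A 0 2, A 1 0]

theorem hat_mulVec (w y : Vec3) : hat w *ᵥ y = crossProduct w y := by
  ext i
  fin_cases i <;> simp [hat, Matrix.mulVec, dotProduct, Fin.sum_univ_three, crossProduct] <;> ring

theorem vee_hat (w : Vec3) : vee (hat w) = w := by
  ext i
  fin_cases i <;> simp [hat, vee]

/-- Rotation matrices. -/
abbrev SO3 : Submonoid Mat3 := Matrix.specialOrthogonalGroup (Fin 3) ℝ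

/-- The operator norm of a matrix with respect to the Euclidean norm. -/
def opNorm (A : Mat3) : ℝ := ‖Matrix.toEuclideanCLM (n := Fin 3) (𝕜 := ℝ) A‖

/-- The smallest eigenvalue (used for symmetric matrices only). -/
def lamMin {n : Type*} [Fintype n] [DecidableEq n] (A : Matrix n n ℝ) : ℝ := sInf (spectrum ℝ A)

/-- The largest eigenvalue (used for symmetric matrices only). -/
def lamMax {n : Type*} [Fintype n] [DecidableEq n] (A : Matrix n n ℝ) : ℝ := sSup (spectrum ℝ A)

/-! ### The load, the gains and the desired trajectory -/

/-- Physical parameters of the load, the gravitational acceleration, the attachment points of the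
four cables (in the body frame of the load) and the control gains. -/
structure Params where
  /-- mass of the load -/
  mL : ℝ
  /-- inertia matrix of the load -/
  JL : Mat3
  /-- gravitational acceleration -/
  g : ℝ
  /-- attachment points -/
  r : Fin 4 → Vec3
  kx : ℝ
  kv : ℝ
  kR : ℝ
  kOm : ℝ
  kq : ℝ
  kom : ℝ

/-- A smooth desired motion of the load: position, attitude and body angular velocity. -/
structure DesiredTrajectory where
  x : ℝ → Vec3
  R : ℝ → Mat3
  Om : ℝ → Vec3
  x_smooth : ContDiff ℝ ∞ x
  Om_smooth : ContDiff ℝ ∞ Om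
  R_mem : ∀ t, R t ∈ SO3
  /-- the kinematic equation for the attitude, read entry by entry -/
  R_deriv : ∀ t i k, HasDerivAt (fun s => R s i k) ((R t * hat (Om t)) i k) t

/-- The desired acceleration, its derivative, the desired angular velocity and its first two
derivatives are bounded for nonnegative times. -/
def DesiredTrajectory.IsBounded (D : DesiredTrajectory) : Prop :=
  ∃ C : ℝ, ∀ t : ℝ, 0 ≤ t →
    vnorm (iteratedDeriv 2 D.x t) ≤ C ∧ vnorm (iteratedDeriv 3 D.x t) ≤ C ∧
    vnorm (D.Om t) ≤ C ∧ vnorm (deriv D.Om t) ≤ C ∧ vnorm (iteratedDeriv 2 D.Om t) ≤ C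

/-- Position, velocity, attitude and body angular velocity of the load. -/
structure LoadState where
  x : Vec3
  v : Vec3
  R : Mat3
  Om : Vec3

/-- State of the load together with the directions of the four cables. -/
structure State extends LoadState where
  q : Fin 4 → Vec3

/-- The desired state of the load at time `t`. -/
def DesiredTrajectory.load (D : DesiredTrajectory) (t : ℝ) : LoadState where
  x := D.x t
  v := deriv D.x t
  R := D.R t
  Om := D.Om t

/-! ### Tracking errors of the load -/

def errX (D : DesiredTrajectory) (t : ℝ) (X : LoadState) : Vec3 := X.x - D.x t

def errV (D : DesiredTrajectory) (t : ℝ) (X : LoadState) : Vec3 := X.v - deriv D.x t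

def errR (D : DesiredTrajectory) (t : ℝ) (X : LoadState) : Vec3 :=
  vee ((1 / 2 : ℝ) • ((D.R t)ᵀ * X.R - X.Rᵀ * D.R t))

/-- The desired angular velocity, transported to the body frame of the load. -/
def OmRel (D : DesiredTrajectory) (t : ℝ) (X : LoadState) : Vec3 :=
  (X.Rᵀ * D.R t) *ᵥ D.Om t

def errOm (D : DesiredTrajectory) (t : ℝ) (X : LoadState) : Vec3 := X.Om - OmRel D t X

/-- Configuration error of the attitude of the load. -/
def PsiR (D : DesiredTrajectory) (t : ℝ) (X : LoadState) : ℝ :=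
  (1 / 2) * (1 - (D.R t)ᵀ * X.R).trace

/-! ### The controller: desired cable forces and desired cable directions -/

/-- The desired resultant force on the load. -/
def forceD (p : Params) (D : DesiredTrajectory) (t : ℝ) (X : LoadState) : Vec3 :=
  p.mL • (-(p.kx • errX D t X) - p.kv • errV D t X + iteratedDeriv 2 D.x t + p.g • e3)

/-- The desired resultant moment on the load. -/
def momentD (p : Params) (D : DesiredTrajectory) (t : ℝ) (X : LoadState) : Vec3 :=
  -(p.kR • errR D t X) - p.kOm • errOm D t X
    + hat (OmRel D t X) *ᵥ (p.JL *ᵥ OmRel D t X)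
    + p.JL *ᵥ ((X.Rᵀ * D.R t) *ᵥ deriv D.Om t)

/-- The matrix with block rows `(I, I, I, I)` and `(hat r₁, hat r₂, hat r₃, hat r₄)`. -/
def Params.P (p : Params) : Matrix (Fin 3 ⊕ Fin 3) (Fin 4 × Fin 3) ℝ :=
  Matrix.of fun i jk =>
    match i with
    | Sum.inl a => (1 : Mat3) a jk.2
    | Sum.inr a => hat (p.r jk.1) a jk.2

/-- The desired cable forces, in the inertial frame: the distribution of minimal Euclidean norm
that produces the desired resultant force and moment,
`diag (R, R, R, R) * Pᵀ * (P * Pᵀ)⁻¹ * (Rᵀ F, M)`. -/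
def muD (p : Params) (D : DesiredTrajectory) (t : ℝ) (X : LoadState) (j : Fin 4) : Vec3 :=
  X.R *ᵥ fun k =>
    (p.Pᵀ *ᵥ ((p.P * p.Pᵀ)⁻¹ *ᵥ
      Sum.elim (X.Rᵀ *ᵥ forceD p D t X) (momentD p D t X))) (j, k)

/-- The desired cable directions, `-μ / ‖μ‖` for the desired cable force `μ`. -/
def qD (p : Params) (D : DesiredTrajectory) (t : ℝ) (X : LoadState) (j : Fin 4) : Vec3 :=
  -((vnorm (muD p D t X j))⁻¹ • muD p D t X j)

/-! ### Tracking errors of the cables -/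

def errq (p : Params) (D : DesiredTrajectory) (t : ℝ) (X : State) (j : Fin 4) : Vec3 :=
  crossProduct (qD p D t X.toLoadState j) (X.q j)

/-- Error of the angular velocity `om` of a cable with direction `q`, where `omD` is the desired
angular velocity. -/
def errom (q om omD : Vec3) : Vec3 := om + (hat q * hat q) *ᵥ omD

/-- Configuration error of the direction of cable `j`. -/
def Psiq (p : Params) (D : DesiredTrajectory) (t : ℝ) (X : State) (j : Fin 4) : ℝ :=
  1 - qD p D t X.toLoadState j ⬝ᵥ X.q j

/-- The Euclidean norm of the total tracking error
`(e_x, e_v, e_R, e_Ω, e_{q_1}, …, e_{q_4}, e_{ω_1}, …, e_{ω_4})`; the last four are passed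
as `eom`. -/
def errNorm (p : Params) (D : DesiredTrajectory) (t : ℝ) (X : State) (eom : Fin 4 → Vec3) : ℝ :=
  Real.sqrt (vnorm (errX D t X.toLoadState) ^ 2 + vnorm (errV D t X.toLoadState) ^ 2
    + vnorm (errR D t X.toLoadState) ^ 2 + vnorm (errOm D t X.toLoadState) ^ 2
    + ∑ j, (vnorm (errq p D t X j) ^ 2 + vnorm (eom j) ^ 2))

/-- The constants that delimit the domain on which the error dynamics are considered. -/
structure DomainConsts where
  /-- bound for the position error -/
  exMax : ℝ
  /-- bound for the attitude configuration error -/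
  psiR : ℝ
  /-- bounds for the cable configuration errors -/
  psiq : Fin 4 → ℝ
  exMax_pos : 0 < exMax
  psiR_pos : 0 < psiR
  psiR_lt : psiR < 1
  psiq_pos : ∀ j, 0 < psiq j
  psiq_lt : ∀ j, psiq j < 1

/-- The errors of the state `X` at time `t` lie in the domain. -/
def InDomain (p : Params) (D : DesiredTrajectory) (d : DomainConsts) (t : ℝ) (X : State) : Prop :=
  vnorm (errX D t X.toLoadState) < d.exMax ∧ PsiR D t X.toLoadState < d.psiR ∧
    ∀ j, Psiq p D t X j < d.psiq j

/-! ### The error dynamics -/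

/-- The coupling force `(q̃ᵀ μ̃) (hat q) e_q` of cable `j`. -/
def coupling (p : Params) (D : DesiredTrajectory) (t : ℝ) (X : State) (j : Fin 4) : Vec3 :=
  (qD p D t X.toLoadState j ⬝ᵥ muD p D t X.toLoadState j) •
    (hat (X.q j) *ᵥ errq p D t X j)

/-- `X` (load and cable directions), `om` (angular velocities of the cables) and `omD` (desired
angular velocities of the cables) form a solution of the error dynamics on the time set `I`. -/
structure IsSolution (p : Params) (D : DesiredTrajectory) (I : Set ℝ)
    (X : ℝ → State) (om omD : ℝ → Fin 4 → Vec3) : Prop where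
  /-- the state is a point of the tangent bundle of the configuration space -/
  R_mem : ∀ t ∈ I, (X t).R ∈ SO3
  q_unit : ∀ t ∈ I, ∀ j, (X t).q j ⬝ᵥ (X t).q j = 1
  om_tangent : ∀ t ∈ I, ∀ j, (X t).q j ⬝ᵥ om t j = 0
  /-- the desired cable directions are defined -/
  mu_ne : ∀ t ∈ I, ∀ j, muD p D t (X t).toLoadState j ≠ 0
  /-- kinematics -/
  x_deriv : ∀ t ∈ I, HasDerivWithinAt (fun s => (X s).x) (X t).v I t
  R_deriv : ∀ t ∈ I, ∀ i k,
    HasDerivWithinAt (fun s => (X s).R i k) (((X t).R * hat (X t).Om) i k) I t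
  q_deriv : ∀ t ∈ I, ∀ j,
    HasDerivWithinAt (fun s => (X s).q j) (crossProduct (om t j) ((X t).q j)) I t
  /-- kinematics of the desired cable directions, which determine `omD` -/
  qD_deriv : ∀ t ∈ I, ∀ j,
    HasDerivWithinAt (fun s => qD p D s (X s).toLoadState j)
      (crossProduct (omD t j) (qD p D t (X t).toLoadState j)) I t
  omD_tangent : ∀ t ∈ I, ∀ j, qD p D t (X t).toLoadState j ⬝ᵥ omD t j = 0
  /-- translational error dynamics of the load -/
  errV_deriv : ∀ t ∈ I,
    HasDerivWithinAt (fun s => errV D s (X s).toLoadState)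
      (-(p.kv • errV D t (X t).toLoadState) - p.kx • errX D t (X t).toLoadState
        - (1 / p.mL) • ∑ j, coupling p D t (X t) j) I t
  /-- rotational error dynamics of the load -/
  errOm_deriv : ∀ t ∈ I,
    HasDerivWithinAt (fun s => p.JL *ᵥ errOm D s (X s).toLoadState)
      (-(p.kOm • errOm D t (X t).toLoadState) - p.kR • errR D t (X t).toLoadState
        + hat (p.JL *ᵥ errOm D t (X t).toLoadState
            + ((2 : ℝ) • p.JL - p.JL.trace • (1 : Mat3)) *ᵥ OmRel D t (X t).toLoadState)
          *ᵥ errOm D t (X t).toLoadState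
        - ∑ j, (hat (p.r j) * (X t).Rᵀ) *ᵥ coupling p D t (X t) j) I t
  /-- error dynamics of the cables -/
  errom_deriv : ∀ t ∈ I, ∀ j,
    HasDerivWithinAt (fun s => errom ((X s).q j) (om s j) (omD s j))
      ((crossProduct (om t j) ((X t).q j) ⬝ᵥ omD t j) • (X t).q j
        - p.kom • errom ((X t).q j) (om t j) (omD t j)
        - p.kq • errq p D t (X t) j) I t

/-- The total tracking error along a solution. -/
def errAlong (p : Params) (D : DesiredTrajectory)
    (X : ℝ → State) (om omD : ℝ → Fin 4 → Vec3) (t : ℝ) : ℝ :=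
  errNorm p D t (X t) fun j => errom ((X t).q j) (om t j) (omD t j)

/-- The origin is an equilibrium of the error dynamics: from every initial time there is a
solution in the domain whose tracking error vanishes identically. -/
def OriginIsEquilibrium (p : Params) (D : DesiredTrajectory) (d : DomainConsts) : Prop :=
  ∀ t0 : ℝ, 0 ≤ t0 → ∃ X om omD, IsSolution p D (Set.Ici t0) X om omD ∧
    ∀ t, t0 ≤ t → InDomain p D d t (X t) ∧ errAlong p D X om omD t = 0

/-- The origin is exponentially stable for the error dynamics, uniformly in the initial time.
Every initial error in the domain of size less than `c` is the initial error of a solution on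
`[t0, ∞)`, and every solution with such an initial error, on whatever interval `[t0, T)` it is
given, stays in the domain and its error obeys the exponential estimate there. -/
def OriginIsExponentiallyStable (p : Params) (D : DesiredTrajectory) (d : DomainConsts) : Prop :=
  ∃ c > 0, ∃ K > 0, ∃ lam > 0, ∀ t0 : ℝ, 0 ≤ t0 →
    (∀ (X0 : State) (eom0 : Fin 4 → Vec3),
      X0.R ∈ SO3 → (∀ j, X0.q j ⬝ᵥ X0.q j = 1) → (∀ j, X0.q j ⬝ᵥ eom0 j = 0) →
      InDomain p D d t0 X0 → errNorm p D t0 X0 eom0 < c →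
      ∃ X om omD, IsSolution p D (Set.Ici t0) X om omD ∧ X t0 = X0 ∧
        ∀ j, errom ((X t0).q j) (om t0 j) (omD t0 j) = eom0 j) ∧
    (∀ (T : ℝ) (X : ℝ → State) (om omD : ℝ → Fin 4 → Vec3), t0 < T →
      IsSolution p D (Set.Ico t0 T) X om omD →
      InDomain p D d t0 (X t0) → errAlong p D X om omD t0 < c →
      ∀ t ∈ Set.Ico t0 T, InDomain p D d t (X t) ∧
        errAlong p D X om omD t
          ≤ K * errAlong p D X om omD t0 * Real.exp (-lam * (t - t0)))

/-! ### The matrices -/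

/-- The remaining constants: the coefficients of the cross terms of the Lyapunov function and the
nonnegative constants `B` and `C_{q_j}`, which are meant to be bounds computed from the desired
motion. They enter the matrices `W_j` only; no value of them is excluded. -/
structure LyapConsts where
  cx : ℝ
  cR : ℝ
  cq : ℝ
  B : ℝ
  Cq : Fin 4 → ℝ
  cx_pos : 0 < cx
  cR_pos : 0 < cR
  cq_pos : 0 < cq
  B_nonneg : 0 ≤ B
  Cq_nonneg : ∀ j, 0 ≤ Cq j

section Matrices

variable (p : Params) (d : DomainConsts) (l : LyapConsts) (j : Fin 4)

def alpha : ℝ := Real.sqrt (d.psiq j * (2 - d.psiq j))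

def alphaL : ℝ := Real.sqrt (d.psiR * (2 - d.psiR))

def gam : ℝ := 1 / (p.mL * lamMin (p.P * p.Pᵀ))

def bet : ℝ := p.mL * gam p

def del : ℝ := p.mL * (opNorm (hat (p.r j)) / Real.sqrt (lamMin (p.P * p.Pᵀ)))

def sig : ℝ := del p j / p.mL

def PxLower : Matrix (Fin 2) (Fin 2) ℝ :=
  (1 / 2 : ℝ) • !![p.kx, -l.cx; -l.cx, 1]

def PxUpper : Matrix (Fin 2) (Fin 2) ℝ :=
  (1 / 2 : ℝ) • !![p.kx, l.cx; l.cx, 1]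

def PRLower : Matrix (Fin 2) (Fin 2) ℝ :=
  (1 / 2 : ℝ) • !![2 * p.kR, -(l.cR * lamMax p.JL); -(l.cR * lamMax p.JL), lamMin p.JL]

def PRUpper : Matrix (Fin 2) (Fin 2) ℝ :=
  (1 / 2 : ℝ) • !![2 * p.kR / (2 - d.psiR), l.cR * lamMax p.JL; l.cR * lamMax p.JL, lamMax p.JL]

def PqLower : Matrix (Fin 2) (Fin 2) ℝ :=
  (1 / 2 : ℝ) • !![2 * p.kq, -l.cq; -l.cq, 1]

def PqUpper : Matrix (Fin 2) (Fin 2) ℝ :=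
  (1 / 2 : ℝ) • !![2 * p.kq / (2 - d.psiq j), l.cq; l.cq, 1]

def Wx : Matrix (Fin 2) (Fin 2) ℝ :=
  (1 / 4 : ℝ) •
    !![l.cx * p.kx * (1 - 4 * alpha d j * bet p),
        -(1 / 2) * l.cx * p.kv * (1 + 4 * alpha d j * bet p);
      -(1 / 2) * l.cx * p.kv * (1 + 4 * alpha d j * bet p),
        p.kv * (1 - 4 * alpha d j * bet p) - l.cx]

def WR : Matrix (Fin 2) (Fin 2) ℝ :=
  (1 / 4 : ℝ) •
    !![l.cR * p.kR * (1 - 4 * alpha d j * sig p j),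
        -(l.cR / 2) * (p.kOm + l.B + 4 * alpha d j * sig p j);
      -(l.cR / 2) * (p.kOm + l.B + 4 * alpha d j * sig p j),
        p.kOm * (1 - 4 * alpha d j * sig p j) - 2 * l.cR * lamMax p.JL]

def Wq : Matrix (Fin 2) (Fin 2) ℝ :=
  !![l.cq * p.kq, -(1 / 2) * l.cq * (p.kom + l.Cq j);
    -(1 / 2) * l.cq * (p.kom + l.Cq j), p.kom - l.cq]

def WxR : Matrix (Fin 2) (Fin 2) ℝ :=
  alpha d j •
    !![gam p * l.cx * p.kR + del p j * l.cR * p.kx, gam p * l.cx * p.kOm + del p j * p.kx;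
      gam p * p.kR + del p j * l.cR * p.kv, gam p * p.kOm + del p j * p.kv]

def Wxq : Matrix (Fin 2) (Fin 2) ℝ :=
  !![l.cx * l.B, 0; bet p * p.kx * d.exMax + l.B, 0]

def WRq : Matrix (Fin 2) (Fin 2) ℝ :=
  !![l.cR * l.B, 0; alphaL d * sig p j * p.kR + l.B, 0]

/-- The six by six matrix `W_j`, written in blocks. -/
def W : Matrix (Fin 3 × Fin 2) (Fin 3 × Fin 2) ℝ :=
  Matrix.comp (Fin 3) (Fin 3) (Fin 2) (Fin 2) ℝ
    !![Wx p d l j, -(1 / 2 : ℝ) • WxR p d l j, -(1 / 2 : ℝ) • Wxq p d l;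
      -(1 / 2 : ℝ) • WxR p d l j, WR p d l j, -(1 / 2 : ℝ) • WRq p d l j;
      -(1 / 2 : ℝ) • Wxq p d l, -(1 / 2 : ℝ) • WRq p d l j, Wq p l j]

/-- All the matrices of the stability criterion are positive definite. -/
structure MatricesPosDef : Prop where
  Px_upper : (PxUpper p l).PosDef
  Px_lower : (PxLower p l).PosDef
  PR_upper : (PRUpper p d l).PosDef
  PR_lower : (PRLower p l).PosDef
  Pq_upper : ∀ j, (PqUpper p d l j).PosDef
  Pq_lower : (PqLower p l).PosDef
  W_symm : ∀ j, ((1 / 2 : ℝ) • (W p d l j + (W p d l j)ᵀ)).PosDef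

end Matrices

end CableLoad

end

noncomputable section

namespace CableLoad

/-! The matrix conditions are used through diagonal entries, which force all six gains to be
positive (`gains_pos`). Once the gains are positive, the statement is a local one about a cascade.
Each cable error obeys a damped second-order equation on the sphere, into which the load enters only
through the desired angular velocity ω̃_j. The load errors obey damped second-order equations with a
forcing that is at most linear in the direction errors e_q.

For each subsystem the natural energy (½|e_v|² + ½k_x|e_x|², k_RΨ_R + ½e_Ω·Je_Ω, k_qΨ_q + ½|e_ω|²)
dissipates the velocity error alone. A small multiple of the product of position and velocity errors
(weighted by the inertia for rotations) makes the dissipation definite. The coefficients of these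
products are chosen anew, as small as needed, and are independent of c_x, c_R, c_q. With S =
∑|e_{q_j}|, `translational_estimate` and `rotational_estimate` hold up to a multiple of S², and
`cable_estimate` has no such remainder. Hence the sum of the load energies and N times the cable
energies is a strict Lyapunov function for N large (`exists_lyapunov`), and a comparison argument
gives `exists_decay`.

The constants are uniform in time because the data of the desired motion stay in a compact set: near
it the forces μ̃_j stay away from zero (`exists_region`), and μ̃_j and ω̃_j are bounded
(`exists_mu_omD_bound`). Sizes are measured with Ψ instead of |e|². Since |e|² = Ψ(2 - Ψ), the two
are equivalent for Ψ ≤ 1, while only Ψ detects the antipodal configurations.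

For existence, the dynamics are written as an ordinary differential equation in error coordinates.
This is not circular: the load rate depends on the cables through q only, so the rate of μ̃_j, and
with it ω̃_j = μ̃_j × μ̃_j' / |μ̃_j|², is an explicit smooth function where μ̃_j ≠ 0. Cutting the
field off gives a global solution that preserves the constraints R ∈ SO(3), |q| = 1, e_ω ⊥ q. The
decay estimate keeps it where the cutoff equals one (`exists_solution`). The equilibrium is the
solution with zero initial error. -/

/-! ### Euclidean vector algebra -/

theorem dot3 (x y : Vec3) : x ⬝ᵥ y = x 0 * y 0 + x 1 * y 1 + x 2 * y 2 := by
  simp [dotProduct, Fin.sum_univ_three]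

theorem dot_self_nonneg (x : Vec3) : 0 ≤ x ⬝ᵥ x := by
  rw [dot3]; nlinarith [mul_self_nonneg (x 0), mul_self_nonneg (x 1), mul_self_nonneg (x 2)]

theorem vnorm_nonneg (x : Vec3) : 0 ≤ vnorm x := Real.sqrt_nonneg _

theorem vnorm_sq (x : Vec3) : vnorm x ^ 2 = x ⬝ᵥ x := Real.sq_sqrt (dot_self_nonneg x)

theorem lagrange_identity (x y : Vec3) :
    crossProduct x y ⬝ᵥ crossProduct x y = (x ⬝ᵥ x) * (y ⬝ᵥ y) - (x ⬝ᵥ y) ^ 2 := by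
  rw [cross_dot_cross, dotProduct_comm y x]; ring

theorem abs_dot_le (x y : Vec3) : |x ⬝ᵥ y| ≤ vnorm x * vnorm y := by
  refine abs_le_of_sq_le_sq ?_ (mul_nonneg (vnorm_nonneg _) (vnorm_nonneg _))
  rw [mul_pow, vnorm_sq, vnorm_sq]
  linarith [lagrange_identity x y, dot_self_nonneg (crossProduct x y)]

theorem dot_le (x y : Vec3) : x ⬝ᵥ y ≤ vnorm x * vnorm y := (le_abs_self _).trans (abs_dot_le x y)

theorem vnorm_le_of_sq_le {x : Vec3} {c : ℝ} (hc : 0 ≤ c) (h : x ⬝ᵥ x ≤ c ^ 2) : vnorm x ≤ c :=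
  Real.sqrt_le_iff.2 ⟨hc, h⟩

theorem vnorm_cross_le (x y : Vec3) : vnorm (crossProduct x y) ≤ vnorm x * vnorm y := by
  apply vnorm_le_of_sq_le (mul_nonneg (vnorm_nonneg _) (vnorm_nonneg _))
  rw [mul_pow, vnorm_sq, vnorm_sq, lagrange_identity]
  linarith [sq_nonneg (x ⬝ᵥ y)]

theorem vnorm_add_le (x y : Vec3) : vnorm (x + y) ≤ vnorm x + vnorm y := by
  apply vnorm_le_of_sq_le (add_nonneg (vnorm_nonneg _) (vnorm_nonneg _))
  have := dot_le x y
  rw [add_dotProduct, dotProduct_add, dotProduct_add, dotProduct_comm y x, ← vnorm_sq, ← vnorm_sq]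
  nlinarith

@[simp] theorem vnorm_zero : vnorm 0 = 0 := by simp [vnorm]

theorem vnorm_smul (c : ℝ) (x : Vec3) : vnorm (c • x) = |c| * vnorm x := by
  rw [vnorm, smul_dotProduct, dotProduct_smul, smul_smul, smul_eq_mul, ← sq,
    Real.sqrt_mul (sq_nonneg c), Real.sqrt_sq_eq_abs, vnorm]

theorem vnorm_sum_le {ι : Type*} (s : Finset ι) (f : ι → Vec3) :
    vnorm (∑ i ∈ s, f i) ≤ ∑ i ∈ s, vnorm (f i) := by
  classical
  induction s using Finset.induction_on with
  | empty => simp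
  | insert a s ha ih =>
    rw [Finset.sum_insert ha, Finset.sum_insert ha]
    exact (vnorm_add_le _ _).trans (by gcongr)

theorem abs_apply_le_vnorm (x : Vec3) (i : Fin 3) : |x i| ≤ vnorm x := by
  apply Real.abs_le_sqrt
  rw [dot3]
  fin_cases i <;> simp <;>
    nlinarith [mul_self_nonneg (x 0), mul_self_nonneg (x 1), mul_self_nonneg (x 2)]

/-- `‖x‖` is the supremum norm of the function type. Compactness and differentiability are phrased
with it, all estimates with `vnorm`. -/
theorem norm_le_vnorm (x : Vec3) : ‖x‖ ≤ vnorm x :=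
  (pi_norm_le_iff_of_nonneg (vnorm_nonneg x)).2 fun i => abs_apply_le_vnorm x i

theorem vnorm_le_of_abs_le {x : Vec3} {c : ℝ} (h : ∀ i, |x i| ≤ c) : vnorm x ≤ 2 * c := by
  have hc : 0 ≤ c := (abs_nonneg _).trans (h 0)
  -- The factor 2 replaces the sharp √3.
  apply vnorm_le_of_sq_le (by linarith)
  have h' : ∀ i, x i * x i ≤ c ^ 2 := fun i => by
    have := sq_le_sq' (by linarith [neg_abs_le (x i), h i]) ((le_abs_self _).trans (h i))
    nlinarith
  rw [dot3]; nlinarith [h' 0, h' 1, h' 2]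

theorem vnorm_le_two_mul_norm (x : Vec3) : vnorm x ≤ 2 * ‖x‖ :=
  vnorm_le_of_abs_le fun i => norm_le_pi_norm x i

theorem vnorm_eq_zero {x : Vec3} (h : vnorm x = 0) : x = 0 := by
  ext i; simpa [h] using abs_apply_le_vnorm x i

theorem vnorm_pos {x : Vec3} (h : x ≠ 0) : 0 < vnorm x :=
  (vnorm_nonneg x).lt_of_ne fun h' => h (vnorm_eq_zero h'.symm)

theorem exists_vnorm_mulVec_le (A : Mat3) : ∃ C, 0 ≤ C ∧ ∀ x, vnorm (A *ᵥ x) ≤ C * vnorm x := by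
  refine ⟨2 * ∑ i, ∑ k, |A i k|, by positivity, fun x => ?_⟩
  rw [mul_assoc]
  apply vnorm_le_of_abs_le
  intro i
  calc |(A *ᵥ x) i| ≤ ∑ k, |A i k * x k| :=
        Finset.abs_sum_le_sum_abs (fun k => A i k * x k) Finset.univ
    _ ≤ ∑ k, |A i k| * vnorm x := by
        refine Finset.sum_le_sum fun k _ => ?_
        rw [abs_mul]
        exact mul_le_mul_of_nonneg_left (abs_apply_le_vnorm x k) (abs_nonneg _)
    _ = (∑ k, |A i k|) * vnorm x := by rw [Finset.sum_mul]
    _ ≤ _ := by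
        refine mul_le_mul_of_nonneg_right ?_ (vnorm_nonneg x)
        exact Finset.single_le_sum (f := fun i => ∑ k, |A i k|)
          (fun _ _ => Finset.sum_nonneg fun _ _ => abs_nonneg _) (Finset.mem_univ i)

theorem vnorm_hat_mulVec_le (w y : Vec3) : vnorm (hat w *ᵥ y) ≤ vnorm w * vnorm y := by
  rw [hat_mulVec]; exact vnorm_cross_le w y

theorem dot_hat_mulVec_self (w y : Vec3) : y ⬝ᵥ (hat w *ᵥ y) = 0 := by
  rw [hat_mulVec, dot_cross_self]

/-! ### Rotations -/

theorem SO3_transpose_mul_self {R : Mat3} (hR : R ∈ SO3) : Rᵀ * R = 1 := by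
  have := (Matrix.mem_specialOrthogonalGroup_iff.1 hR).1
  exact (Matrix.mem_orthogonalGroup_iff' (Fin 3) ℝ).1 this

theorem SO3_mul_transpose_self {R : Mat3} (hR : R ∈ SO3) : R * Rᵀ = 1 := by
  have := (Matrix.mem_specialOrthogonalGroup_iff.1 hR).1
  exact (Matrix.mem_orthogonalGroup_iff (Fin 3) ℝ).1 this

theorem mem_SO3_of {R : Mat3} (h : R * Rᵀ = 1) (hd : R.det = 1) : R ∈ SO3 :=
  Matrix.mem_specialOrthogonalGroup_iff.2 ⟨(Matrix.mem_orthogonalGroup_iff (Fin 3) ℝ).2 h, hd⟩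

theorem SO3_transpose_mem {R : Mat3} (hR : R ∈ SO3) : Rᵀ ∈ SO3 := by
  refine mem_SO3_of ?_ ?_
  · rw [Matrix.transpose_transpose, SO3_transpose_mul_self hR]
  · rw [Matrix.det_transpose]; exact (Matrix.mem_specialOrthogonalGroup_iff.1 hR).2

/-- For determinant one the inverse is the adjugate. Each entry thus equals its cofactor, which
turns identities for rotations into polynomial identities. -/
theorem SO3_transpose_eq_adjugate {R : Mat3} (hR : R ∈ SO3) : Rᵀ = R.adjugate := by
  have hd := (Matrix.mem_specialOrthogonalGroup_iff.1 hR).2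
  calc Rᵀ = Rᵀ * (R * R.adjugate) := by rw [Matrix.mul_adjugate, hd, one_smul, mul_one]
    _ = R.adjugate := by rw [← mul_assoc, SO3_transpose_mul_self hR, one_mul]

theorem vnorm_SO3_mulVec {R : Mat3} (hR : R ∈ SO3) (x : Vec3) : vnorm (R *ᵥ x) = vnorm x := by
  rw [vnorm, vnorm, Matrix.dotProduct_mulVec, Matrix.vecMul_mulVec, SO3_transpose_mul_self hR,
    Matrix.vecMul_one]

theorem SO3_abs_apply_le {R : Mat3} (hR : R ∈ SO3) (i k : Fin 3) : |R i k| ≤ 1 := by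
  have h := vnorm_SO3_mulVec hR (Pi.single k 1)
  have h1 : vnorm (Pi.single k 1 : Vec3) = 1 := by simp [vnorm]
  have := abs_apply_le_vnorm (R *ᵥ Pi.single k 1) i
  rw [h, h1] at this
  simpa using this

/-- Conjugation of the hat map by a rotation. -/
theorem SO3_mul_hat {Q : Mat3} (hQ : Q ∈ SO3) (v : Vec3) : Q * hat (Qᵀ *ᵥ v) = hat v * Q := by
  have hadj := SO3_transpose_eq_adjugate hQ
  have key : ∀ i k, Q k i = Q.adjugate i k := fun i k => by rw [← hadj]; rfl
  have h := fun i k => key i k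
  simp only [Matrix.adjugate_fin_three] at h
  have h00 := h 0 0
  have h01 := h 0 1
  have h02 := h 0 2
  have h10 := h 1 0
  have h11 := h 1 1
  have h12 := h 1 2
  have h20 := h 2 0
  have h21 := h 2 1
  have h22 := h 2 2
  simp at h00 h01 h02 h10 h11 h12 h20 h21 h22
  ext i k
  fin_cases i <;> fin_cases k <;>
    simp [hat, Matrix.mul_apply, Fin.sum_univ_three, Matrix.mulVec, dotProduct]
  · linear_combination -v 1 * h02 + v 2 * h01
  · linear_combination -v 1 * h12 + v 2 * h11
  · linear_combination -v 1 * h22 + v 2 * h21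
  · linear_combination v 0 * h02 - v 2 * h00
  · linear_combination v 0 * h12 - v 2 * h10
  · linear_combination v 0 * h22 - v 2 * h20
  · linear_combination -v 0 * h01 + v 1 * h00
  · linear_combination -v 0 * h11 + v 1 * h10
  · linear_combination -v 0 * h21 + v 1 * h20

/-- The square of the attitude error in terms of the attitude configuration error. -/
theorem attitude_error_sq {Q : Mat3} (hQ : Q ∈ SO3) :
    vee ((1 / 2 : ℝ) • (Q - Qᵀ)) ⬝ᵥ vee ((1 / 2 : ℝ) • (Q - Qᵀ)) =
      (1 / 2 * (1 - Q).trace) * (2 - 1 / 2 * (1 - Q).trace) := by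
  have hadj := SO3_transpose_eq_adjugate hQ
  have h := fun i => congrFun (congrFun hadj i) i
  have hr := fun i => congrFun (congrFun (SO3_mul_transpose_self hQ) i) i
  simp only [Matrix.adjugate_fin_three] at h
  have h0 := h 0
  have h1 := h 1
  have h2 := h 2
  have r0 := hr 0
  have r1 := hr 1
  have r2 := hr 2
  simp [Matrix.mul_apply, Fin.sum_univ_three] at h0 h1 h2 r0 r1 r2
  rw [dot3]
  simp [vee, Matrix.trace, Fin.sum_univ_three]
  -- The unit rows eliminate the squares off the diagonal, and the diagonal cofactors sum to the
  -- trace of `Q`.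
  linear_combination (1 / 4) * (r0 + r1 + r2) - (1 / 2) * (h0 + h1 + h2)

/-- The squared Frobenius distance of two rotations. -/
theorem sum_sq_sub_SO3 {R S : Mat3} (hR : R ∈ SO3) (hS : S ∈ SO3) :
    ∑ i, ∑ k, (R i k - S i k) ^ 2 = 4 * (1 / 2 * (1 - Sᵀ * R).trace) := by
  have hr := fun i => congrFun (congrFun (SO3_mul_transpose_self hR) i) i
  have hs := fun i => congrFun (congrFun (SO3_mul_transpose_self hS) i) i
  have r0 := hr 0
  have r1 := hr 1
  have r2 := hr 2
  have s0 := hs 0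
  have s1 := hs 1
  have s2 := hs 2
  simp [Matrix.mul_apply, Fin.sum_univ_three] at r0 r1 r2 s0 s1 s2
  simp [Matrix.trace, Matrix.mul_apply, Fin.sum_univ_three]
  linear_combination r0 + r1 + r2 + s0 + s1 + s2

/-! ### Derivatives of vector and matrix expressions -/

section Calculus

variable {I : Set ℝ} {t : ℝ}

theorem hasDerivWithinAt_dot {x y : ℝ → Vec3} {x' y' : Vec3}
    (hx : HasDerivWithinAt x x' I t) (hy : HasDerivWithinAt y y' I t) :
    HasDerivWithinAt (fun s => x s ⬝ᵥ y s) (x' ⬝ᵥ y t + x t ⬝ᵥ y') I t := by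
  have hx := hasDerivWithinAt_pi.1 hx
  have hy := hasDerivWithinAt_pi.1 hy
  simp only [dot3]
  exact ((((hx 0).mul (hy 0)).add ((hx 1).mul (hy 1))).add
    ((hx 2).mul (hy 2))).congr_deriv (by ring)

theorem hasDerivWithinAt_dot_self {x : ℝ → Vec3} {x' : Vec3} (hx : HasDerivWithinAt x x' I t) :
    HasDerivWithinAt (fun s => x s ⬝ᵥ x s) (2 * (x t ⬝ᵥ x')) I t :=
  (hasDerivWithinAt_dot hx hx).congr_deriv (by rw [dotProduct_comm x']; ring)

theorem hasDerivWithinAt_cross {x y : ℝ → Vec3} {x' y' : Vec3}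
    (hx : HasDerivWithinAt x x' I t) (hy : HasDerivWithinAt y y' I t) :
    HasDerivWithinAt (fun s => crossProduct (x s) (y s))
      (crossProduct x' (y t) + crossProduct (x t) y') I t := by
  have hx := hasDerivWithinAt_pi.1 hx
  have hy := hasDerivWithinAt_pi.1 hy
  refine hasDerivWithinAt_pi.2 fun i => ?_
  fin_cases i
  · refine HasDerivWithinAt.congr_deriv (((hx 1).mul (hy 2)).sub ((hx 2).mul (hy 1))) ?_
    simp [cross_apply]; ring
  · refine HasDerivWithinAt.congr_deriv (((hx 2).mul (hy 0)).sub ((hx 0).mul (hy 2))) ?_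
    simp [cross_apply]; ring
  · refine HasDerivWithinAt.congr_deriv (((hx 0).mul (hy 1)).sub ((hx 1).mul (hy 0))) ?_
    simp [cross_apply]; ring

/-- Entrywise differentiability of a family of matrices. -/
def MatDeriv {m n : Type*} (A : ℝ → Matrix m n ℝ) (A' : Matrix m n ℝ) (I : Set ℝ) (t : ℝ) : Prop :=
  ∀ i k, HasDerivWithinAt (fun s => A s i k) (A' i k) I t

theorem MatDeriv.mul {l m n : Type*} [Fintype m] {A : ℝ → Matrix l m ℝ} {B : ℝ → Matrix m n ℝ}
    {A' : Matrix l m ℝ} {B' : Matrix m n ℝ} (hA : MatDeriv A A' I t) (hB : MatDeriv B B' I t) :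
    MatDeriv (fun s => A s * B s) (A' * B t + A t * B') I t := by
  intro i k
  simp only [Matrix.add_apply, Matrix.mul_apply, ← Finset.sum_add_distrib]
  exact HasDerivWithinAt.fun_sum fun j _ => (hA i j).mul (hB j k)

theorem MatDeriv.transpose {m n : Type*} {A : ℝ → Matrix m n ℝ} {A' : Matrix m n ℝ}
    (hA : MatDeriv A A' I t) : MatDeriv (fun s => (A s)ᵀ) A'ᵀ I t := fun i k => hA k i

theorem MatDeriv.mulVec {m n : Type*} [Finite m] [Fintype n] {A : ℝ → Matrix m n ℝ}
    {A' : Matrix m n ℝ} {x : ℝ → n → ℝ} {x' : n → ℝ} (hA : MatDeriv A A' I t)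
    (hx : HasDerivWithinAt x x' I t) :
    HasDerivWithinAt (fun s => A s *ᵥ x s) (A' *ᵥ x t + A t *ᵥ x') I t := by
  have := Fintype.ofFinite m
  refine hasDerivWithinAt_pi.2 fun i => ?_
  simp only [Pi.add_apply, Matrix.mulVec, dotProduct, ← Finset.sum_add_distrib]
  exact HasDerivWithinAt.fun_sum fun j _ => (hA i j).mul (hasDerivWithinAt_pi.1 hx j)

theorem matDeriv_const {m n : Type*} (A : Matrix m n ℝ) : MatDeriv (fun _ => A) 0 I t :=
  fun _ _ => hasDerivWithinAt_const _ _ _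

theorem hasDerivWithinAt_const_mulVec {m n : Type*} [Finite m] [Fintype n] (A : Matrix m n ℝ)
    {x : ℝ → n → ℝ} {x' : n → ℝ} (hx : HasDerivWithinAt x x' I t) :
    HasDerivWithinAt (fun s => A *ᵥ x s) (A *ᵥ x') I t := by
  simpa using (matDeriv_const A).mulVec hx

/-- The angular velocity of the direction `-μ / ‖μ‖`. -/
theorem hasDerivWithinAt_direction {μ : ℝ → Vec3} {μ' : Vec3} (h : HasDerivWithinAt μ μ' I t)
    (h0 : μ t ≠ 0) :
    HasDerivWithinAt (fun s => -((vnorm (μ s))⁻¹ • μ s))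
      (crossProduct ((μ t ⬝ᵥ μ t)⁻¹ • crossProduct (μ t) μ') (-((vnorm (μ t))⁻¹ • μ t))) I t := by
  have hpos := vnorm_pos h0
  have hsq := vnorm_sq (μ t)
  have hne : μ t ⬝ᵥ μ t ≠ 0 := by rw [← hsq]; positivity
  have h1 := ((hasDerivWithinAt_dot h h).sqrt hne).inv (by exact hpos.ne')
  have h2 := (h1.smul h).neg
  refine h2.congr_deriv ?_
  change -((vnorm (μ t))⁻¹ • μ' + (-((μ' ⬝ᵥ μ t + μ t ⬝ᵥ μ') / (2 * vnorm (μ t))) / vnorm (μ t) ^ 2)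
    • μ t) = _
  rw [← hsq, dotProduct_comm μ']
  set v := vnorm (μ t)
  have e : crossProduct ((v ^ 2)⁻¹ • crossProduct (μ t) μ') (-(v⁻¹ • μ t)) =
      -((v ^ 3)⁻¹ • ((μ t ⬝ᵥ μ t) • μ' - (μ t ⬝ᵥ μ') • μ t)) := by
    ext i
    fin_cases i <;> simp [cross_apply, dot3] <;> field_simp <;> ring
  rw [e, ← hsq]
  ext i
  simp
  field_simp
  ring

end Calculus

/-! ### A differential inequality -/

/-- A nonnegative function that decays exponentially as long as it is small and that is small
initially decays exponentially forever. -/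
theorem le_exp_of_deriv_le {V V' : ℝ → ℝ} {t0 T lam v : ℝ} (hlam : 0 < lam)
    (h0 : 0 ≤ V t0) (hv : V t0 < v)
    (hV : ∀ t ∈ Set.Ico t0 T, HasDerivWithinAt V (V' t) (Set.Ico t0 T) t)
    (hle : ∀ t ∈ Set.Ico t0 T, V t < v → V' t ≤ -(2 * lam) * V t) :
    ∀ t ∈ Set.Ico t0 T, V t ≤ V t0 * Real.exp (-lam * (t - t0)) := by
  intro t1 ht1
  have hsub : Set.Icc t0 t1 ⊆ Set.Ico t0 T := fun s hs => ⟨hs.1, hs.2.trans_lt ht1.2⟩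
  -- The barrier decays at rate `lam`, half the rate granted to `V`, so at a contact `V` falls
  -- strictly faster than the barrier. The slack `η` keeps the barrier positive even if `V t0 = 0`;
  -- it tends to zero at the end.
  have main : ∀ η : ℝ, 0 < η → V t0 + η < v →
      V t1 ≤ (V t0 + η) * Real.exp (-lam * (t1 - t0)) := by
    intro η hη hηv
    set B : ℝ → ℝ := fun s => (V t0 + η) * Real.exp (-lam * (s - t0)) with hBdef
    have hB : ∀ s, HasDerivAt B (-lam * B s) s := by
      intro s
      have := (((hasDerivAt_id s).sub_const t0).const_mul (-lam)).exp.const_mul (V t0 + η)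
      refine this.congr_deriv ?_
      simp [hBdef]; ring
    have hBpos : ∀ s, 0 < B s := fun s => by positivity
    refine image_le_of_deriv_right_lt_deriv_boundary (f := V) (f' := V') (B := B)
      (a := t0) (b := t1) ?_ ?_ ?_ hB ?_ ⟨ht1.1, le_rfl⟩
    · exact fun s hs => ((hV s (hsub hs)).continuousWithinAt).mono hsub
    · intro s hs
      have hs' : s ∈ Set.Ico t0 T := hsub ⟨hs.1, hs.2.le⟩
      refine (hV s hs').mono_of_mem_nhdsWithin ?_
      exact Filter.mem_of_superset (Ico_mem_nhdsGE hs'.2) (Set.Ico_subset_Ico_left hs.1)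
    · simp [hBdef, hη.le]
    · intro s hs hsB
      have hs' : s ∈ Set.Ico t0 T := hsub ⟨hs.1, hs.2.le⟩
      have hBle : B s ≤ V t0 + η := by
        have : Real.exp (-lam * (s - t0)) ≤ 1 :=
          Real.exp_le_one_iff.2 (by nlinarith [hs.1])
        simp only [hBdef]; nlinarith
      have := hle s hs' (by rw [hsB]; linarith)
      rw [hsB] at this
      nlinarith [hBpos s]
  refine le_of_forall_pos_le_add fun ε hε => ?_
  set η := min ε ((v - V t0) / 2)
  have hη : 0 < η := lt_min hε (by linarith)
  have h1 := main η hη (by linarith [min_le_right ε ((v - V t0) / 2)])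
  have h2 : Real.exp (-lam * (t1 - t0)) ≤ 1 := Real.exp_le_one_iff.2 (by nlinarith [ht1.1])
  have h3 : η ≤ ε := min_le_left _ _
  have : η * Real.exp (-lam * (t1 - t0)) ≤ η * 1 := by gcongr
  nlinarith

/-! ### Choice of the cross terms -/

/-- Small cross terms preserve dissipation. -/
theorem exists_cross_term {k1 k2 C : ℝ} (h1 : 0 < k1) (h2 : 0 < k2) (hC : 0 ≤ C) :
    ∃ ε0 > 0, ∀ ε, 0 < ε → ε ≤ ε0 → ∀ a b : ℝ,
      -k1 * b ^ 2 - ε * k2 * a ^ 2 + ε * C * b ^ 2 + ε * C * (a * b) ≤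
        -(k1 / 2) * b ^ 2 - ε * (k2 / 2) * a ^ 2 := by
  -- Young's inequality turns the mixed term into `k2 / 2 * a ^ 2 + C ^ 2 / (2 * k2) * b ^ 2`; the
  -- bound on `ε` makes all resulting `b ^ 2` terms at most `k1 / 2 * b ^ 2`. The `+ 1` only keeps
  -- the denominator positive.
  refine ⟨k1 / (2 * (C + C ^ 2 / (2 * k2) + 1)), by positivity, fun ε hε hle a b => ?_⟩
  rw [le_div_iff₀ (by positivity)] at hle
  have h3 : C * (a * b) ≤ k2 / 2 * a ^ 2 + C ^ 2 / (2 * k2) * b ^ 2 := by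
    have : 0 ≤ (k2 * a - C * b) ^ 2 / (2 * k2) := by positivity
    have e : (k2 * a - C * b) ^ 2 / (2 * k2) =
        k2 / 2 * a ^ 2 + C ^ 2 / (2 * k2) * b ^ 2 - C * (a * b) := by field_simp; ring
    linarith
  have h4 := mul_le_mul_of_nonneg_left h3 hε.le
  have h5 := mul_le_mul_of_nonneg_right hle (sq_nonneg b)
  nlinarith [mul_nonneg hε.le (sq_nonneg b)]

/-- Young's inequality for the disturbance terms. -/
theorem exists_disturbance_bound {a : ℝ} (ha : 0 < a) (c : ℝ) :
    ∃ C, 0 ≤ C ∧ ∀ x y s : ℝ, c * ((x + y) * s) ≤ a * (x ^ 2 + y ^ 2) + C * s ^ 2 := by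
  -- Each of `x` and `y` costs `c ^ 2 / (4 * a)` when its square is completed.
  refine ⟨c ^ 2 / (2 * a), by positivity, fun x y s => ?_⟩
  have h1 : 0 ≤ (2 * a * x - c * s) ^ 2 / (4 * a) := by positivity
  have h2 : 0 ≤ (2 * a * y - c * s) ^ 2 / (4 * a) := by positivity
  have e : (2 * a * x - c * s) ^ 2 / (4 * a) + (2 * a * y - c * s) ^ 2 / (4 * a) =
    a * (x ^ 2 + y ^ 2) + c ^ 2 / (2 * a) * s ^ 2 - c * ((x + y) * s) := by field_simp; ring
  linarith

/-! ### Smoothness of vector and matrix expressions -/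

section Smooth

variable {E : Type*} [NormedAddCommGroup E] [NormedSpace ℝ E] {n : WithTop ℕ∞} {w : E}

theorem contDiffAt_dot {f g : E → Vec3} (hf : ContDiffAt ℝ n f w) (hg : ContDiffAt ℝ n g w) :
    ContDiffAt ℝ n (fun y => f y ⬝ᵥ g y) w := by
  have hf := contDiffAt_pi.1 hf
  have hg := contDiffAt_pi.1 hg
  exact ContDiffAt.sum fun i _ => (hf i).mul (hg i)

theorem contDiffAt_csmul (c : ℝ) {f : E → Vec3} (hf : ContDiffAt ℝ n f w) :
    ContDiffAt ℝ n (fun y => c • f y) w := hf.const_smul c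

theorem contDiffAt_cross {f g : E → Vec3} (hf : ContDiffAt ℝ n f w) (hg : ContDiffAt ℝ n g w) :
    ContDiffAt ℝ n (fun y => crossProduct (f y) (g y)) w := by
  have hf := contDiffAt_pi.1 hf
  have hg := contDiffAt_pi.1 hg
  refine contDiffAt_pi.2 fun i => ?_
  fin_cases i
  · exact ((hf 1).mul (hg 2)).sub ((hf 2).mul (hg 1))
  · exact ((hf 2).mul (hg 0)).sub ((hf 0).mul (hg 2))
  · exact ((hf 0).mul (hg 1)).sub ((hf 1).mul (hg 0))

/-- Entrywise smoothness of a family of matrices. -/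
def MatSmooth {l m : Type*} (n : WithTop ℕ∞) (A : E → Matrix l m ℝ) (w : E) : Prop :=
  ∀ i k, ContDiffAt ℝ n (fun y => A y i k) w

theorem MatSmooth.mul {l m o : Type*} [Fintype m] {A : E → Matrix l m ℝ} {B : E → Matrix m o ℝ}
    (hA : MatSmooth n A w) (hB : MatSmooth n B w) : MatSmooth n (fun y => A y * B y) w := by
  intro i k
  simp only [Matrix.mul_apply]
  exact ContDiffAt.sum fun j _ => (hA i j).mul (hB j k)

theorem MatSmooth.transpose {l m : Type*} {A : E → Matrix l m ℝ} (hA : MatSmooth n A w) :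
    MatSmooth n (fun y => (A y)ᵀ) w := fun i k => hA k i

theorem MatSmooth.mulVec {l m : Type*} [Fintype l] [Fintype m] {A : E → Matrix l m ℝ}
    {f : E → m → ℝ} (hA : MatSmooth n A w) (hf : ContDiffAt ℝ n f w) :
    ContDiffAt ℝ n (fun y => A y *ᵥ f y) w := by
  have hf := contDiffAt_pi.1 hf
  refine contDiffAt_pi.2 fun i => ?_
  exact ContDiffAt.sum fun j _ => (hA i j).mul (hf j)

theorem matSmooth_const {l m : Type*} (A : Matrix l m ℝ) : MatSmooth n (fun _ : E => A) w :=
  fun _ _ => contDiffAt_const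

theorem matSmooth_hat {f : E → Vec3} (hf : ContDiffAt ℝ n f w) :
    MatSmooth n (fun y => hat (f y)) w := by
  have hf := contDiffAt_pi.1 hf
  intro i k
  fin_cases i <;> fin_cases k <;>
    first
    | exact contDiffAt_const
    | exact hf _
    | exact (hf _).neg

/-- The attitude sits in the state space as a function of two indices, which is a normed space,
whereas the algebra is done in `Mat3`. This lemma and the next one pass between the two views. -/
theorem matSmooth_of_contDiffAt {f : E → Fin 3 → Fin 3 → ℝ} (hf : ContDiffAt ℝ n f w) :
    MatSmooth n (fun y => (f y : Mat3)) w :=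
  fun i k => contDiffAt_pi.1 (contDiffAt_pi.1 hf i) k

theorem MatSmooth.contDiffAt {f : E → Mat3} (hf : MatSmooth n f w) :
    ContDiffAt (F := Fin 3 → Fin 3 → ℝ) ℝ n f w :=
  contDiffAt_pi.2 fun i => contDiffAt_pi.2 fun k => hf i k

theorem contDiffAt_vnorm {f : E → Vec3} (hf : ContDiffAt ℝ n f w) (h0 : f w ≠ 0) :
    ContDiffAt ℝ n (fun y => vnorm (f y)) w := by
  refine (contDiffAt_dot hf hf).sqrt ?_
  rw [← vnorm_sq]
  have := vnorm_pos h0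
  positivity

end Smooth

theorem continuous_vnorm : Continuous vnorm := by
  unfold vnorm; simp only [dot3]; fun_prop

/-! ### The error dynamics in error coordinates -/

/-- Attitude, acceleration, angular velocity and angular acceleration of the desired motion. -/
abbrev RefData := (Fin 3 → Fin 3 → ℝ) × Vec3 × Vec3 × Vec3

/-- Position error, velocity error, attitude and angular velocity error of the load. -/
abbrev LoadErr := Vec3 × Vec3 × (Fin 3 → Fin 3 → ℝ) × Vec3

/-- All the data on which the desired cable forces depend. -/
abbrev Stage := RefData × LoadErr

/-- Third derivative of the desired position and second derivative of the desired angular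
velocity. -/
abbrev RefRates := Vec3 × Vec3

/-- The directions of the cables. -/
abbrev Dirs := Fin 4 → Vec3

/-- The desired attitude. -/
def Stage.Rd (ζ : Stage) : Mat3 := ζ.1.1

/-- The attitude of the load. -/
def Stage.R (ζ : Stage) : Mat3 := ζ.2.2.2.1

/-- The desired angular velocity in the body frame of the load. -/
def Stage.w (ζ : Stage) : Vec3 := ((Stage.R ζ)ᵀ * Stage.Rd ζ) *ᵥ ζ.1.2.2.1

/-- The attitude error. -/
def Stage.eR (ζ : Stage) : Vec3 :=
  vee ((1 / 2 : ℝ) • ((Stage.Rd ζ)ᵀ * Stage.R ζ - (Stage.R ζ)ᵀ * Stage.Rd ζ))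

section Model

variable (p : Params)

/-- The desired force on the load. -/
def stageForce (ζ : Stage) : Vec3 :=
  p.mL • (-(p.kx • ζ.2.1) - p.kv • ζ.2.2.1 + ζ.1.2.1 + p.g • e3)

/-- The desired moment on the load. -/
def stageMoment (ζ : Stage) : Vec3 :=
  -(p.kR • Stage.eR ζ) - p.kOm • ζ.2.2.2.2 + hat (Stage.w ζ) *ᵥ (p.JL *ᵥ Stage.w ζ)
    + p.JL *ᵥ (((Stage.R ζ)ᵀ * Stage.Rd ζ) *ᵥ ζ.1.2.2.2)

/-- The desired cable forces. -/
def stageMu (ζ : Stage) (j : Fin 4) : Vec3 :=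
  Stage.R ζ *ᵥ fun k =>
    (p.Pᵀ *ᵥ ((p.P * p.Pᵀ)⁻¹ *ᵥ
      Sum.elim ((Stage.R ζ)ᵀ *ᵥ stageForce p ζ) (stageMoment p ζ))) (j, k)

/-- The coupling force of a cable with direction `q`. -/
def stageCoupling (ζ : Stage) (q : Dirs) (j : Fin 4) : Vec3 :=
  crossProduct (q j) (crossProduct (stageMu p ζ j) (q j))

/-- The rate of the load errors. -/
def loadRate (ζ : Stage) (q : Dirs) : LoadErr :=
  (ζ.2.2.1,
   -(p.kv • ζ.2.2.1) - p.kx • ζ.2.1 - (1 / p.mL) • ∑ j, stageCoupling p ζ q j,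
   fun i k => (Stage.R ζ * hat (ζ.2.2.2.2 + Stage.w ζ)) i k,
   p.JL⁻¹ *ᵥ (-(p.kOm • ζ.2.2.2.2) - p.kR • Stage.eR ζ
        + hat (p.JL *ᵥ ζ.2.2.2.2 + ((2 : ℝ) • p.JL - p.JL.trace • (1 : Mat3)) *ᵥ Stage.w ζ)
          *ᵥ ζ.2.2.2.2
        - ∑ j, (hat (p.r j) * (Stage.R ζ)ᵀ) *ᵥ stageCoupling p ζ q j))

/-- The rate of the desired motion. -/
def refRate (ζ : Stage) (c : RefRates) : RefData :=
  (fun i k => (Stage.Rd ζ * hat ζ.1.2.2.1) i k, c.1, ζ.1.2.2.2, c.2)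

/-- The rate of the desired cable forces. -/
def muRate (ζ : Stage) (c : RefRates) (q : Dirs) (j : Fin 4) : Vec3 :=
  fderiv ℝ (fun y => stageMu p y j) ζ (refRate ζ c, loadRate p ζ q)

/-- The desired angular velocity of a cable. -/
def stageOmD (ζ : Stage) (c : RefRates) (q : Dirs) (j : Fin 4) : Vec3 :=
  (stageMu p ζ j ⬝ᵥ stageMu p ζ j)⁻¹ • crossProduct (stageMu p ζ j) (muRate p ζ c q j)

/-- The desired direction of a cable. -/
def stageDir (ζ : Stage) (j : Fin 4) : Vec3 := -((vnorm (stageMu p ζ j))⁻¹ • stageMu p ζ j)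

/-! ### Smooth dependence of the model on its data -/

section Smooth

variable {E : Type*} [NormedAddCommGroup E] [NormedSpace ℝ E] {n : WithTop ℕ∞} {w : E}
  {ζ : E → Stage} {c : E → RefRates} {q : E → Dirs}

theorem matSmooth_Rd (h : ContDiffAt ℝ n ζ w) : MatSmooth n (fun y => Stage.Rd (ζ y)) w :=
  matSmooth_of_contDiffAt h.fst.fst

theorem matSmooth_R (h : ContDiffAt ℝ n ζ w) : MatSmooth n (fun y => Stage.R (ζ y)) w :=
  matSmooth_of_contDiffAt h.snd.snd.snd.fst

theorem contDiffAt_w (h : ContDiffAt ℝ n ζ w) : ContDiffAt ℝ n (fun y => Stage.w (ζ y)) w :=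
  ((matSmooth_R h).transpose.mul (matSmooth_Rd h)).mulVec h.fst.snd.snd.fst

theorem contDiffAt_eR (h : ContDiffAt ℝ n ζ w) : ContDiffAt ℝ n (fun y => Stage.eR (ζ y)) w := by
  have h1 := (matSmooth_Rd h).transpose.mul (matSmooth_R h)
  have h2 := (matSmooth_R h).transpose.mul (matSmooth_Rd h)
  have h3 : ∀ i k, ContDiffAt ℝ n (fun y => ((1 / 2 : ℝ) • ((Stage.Rd (ζ y))ᵀ * Stage.R (ζ y)
      - (Stage.R (ζ y))ᵀ * Stage.Rd (ζ y)) : Mat3) i k) w := fun i k =>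
    contDiffAt_const.mul ((h1 i k).sub (h2 i k))
  refine contDiffAt_pi.2 fun i => ?_
  fin_cases i
  · exact h3 2 1
  · exact h3 0 2
  · exact h3 1 0

theorem contDiffAt_stageForce (h : ContDiffAt ℝ n ζ w) :
    ContDiffAt ℝ n (fun y => stageForce p (ζ y)) w :=
  contDiffAt_csmul _ ((((contDiffAt_csmul _ h.snd.fst).neg.sub
    (contDiffAt_csmul _ h.snd.snd.fst)).add h.fst.snd.fst).add contDiffAt_const)

theorem contDiffAt_stageMoment (h : ContDiffAt ℝ n ζ w) :
    ContDiffAt ℝ n (fun y => stageMoment p (ζ y)) w :=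
  ((((contDiffAt_csmul _ (contDiffAt_eR h)).neg.sub
    (contDiffAt_csmul _ h.snd.snd.snd.snd)).add
    ((matSmooth_hat (contDiffAt_w h)).mulVec ((matSmooth_const _).mulVec (contDiffAt_w h)))).add
    ((matSmooth_const _).mulVec
      (((matSmooth_R h).transpose.mul (matSmooth_Rd h)).mulVec h.fst.snd.snd.snd)))

theorem contDiffAt_stageMu (h : ContDiffAt ℝ n ζ w) (j : Fin 4) :
    ContDiffAt ℝ n (fun y => stageMu p (ζ y) j) w := by
  refine (matSmooth_R h).mulVec (contDiffAt_pi.2 fun k => ?_)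
  have h1 := contDiffAt_pi.1 ((matSmooth_R h).transpose.mulVec (contDiffAt_stageForce p h))
  have h2 := contDiffAt_pi.1 (contDiffAt_stageMoment p h)
  have h3 : ContDiffAt ℝ n (fun y => Sum.elim ((Stage.R (ζ y))ᵀ *ᵥ stageForce p (ζ y))
      (stageMoment p (ζ y))) w := by
    refine contDiffAt_pi.2 fun i => ?_
    rcases i with i | i
    · exact h1 i
    · exact h2 i
  exact contDiffAt_pi.1 ((matSmooth_const _).mulVec ((matSmooth_const _).mulVec h3)) (j, k)

theorem contDiffAt_stageCoupling (h : ContDiffAt ℝ n ζ w) (hq : ContDiffAt ℝ n q w) (j : Fin 4) :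
    ContDiffAt ℝ n (fun y => stageCoupling p (ζ y) (q y) j) w :=
  contDiffAt_cross (contDiffAt_pi.1 hq j)
    (contDiffAt_cross (contDiffAt_stageMu p h j) (contDiffAt_pi.1 hq j))

theorem contDiffAt_loadRate (h : ContDiffAt ℝ n ζ w) (hq : ContDiffAt ℝ n q w) :
    ContDiffAt ℝ n (fun y => loadRate p (ζ y) (q y)) w := by
  have hΩ : ContDiffAt ℝ n (fun y => (ζ y).2.2.2.2) w := h.snd.snd.snd.snd
  have hv : ContDiffAt ℝ n (fun y => (ζ y).2.2.1) w := h.snd.snd.fst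
  have hc := fun j => contDiffAt_stageCoupling p h hq j
  have h1 : ContDiffAt ℝ n (fun y => ∑ j, stageCoupling p (ζ y) (q y) j) w :=
    ContDiffAt.sum fun j _ => hc j
  have h2 : ContDiffAt ℝ n (fun y => ∑ j, (hat (p.r j) * (Stage.R (ζ y))ᵀ) *ᵥ
      stageCoupling p (ζ y) (q y) j) w :=
    ContDiffAt.sum fun j _ => ((matSmooth_const _).mul (matSmooth_R h).transpose).mulVec (hc j)
  have h3 : ContDiffAt ℝ n (fun y => hat (p.JL *ᵥ (ζ y).2.2.2.2
      + ((2 : ℝ) • p.JL - p.JL.trace • (1 : Mat3)) *ᵥ Stage.w (ζ y)) *ᵥ (ζ y).2.2.2.2) w :=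
    (matSmooth_hat (((matSmooth_const _).mulVec hΩ).add
        ((matSmooth_const _).mulVec (contDiffAt_w h)))).mulVec hΩ
  have h4 : ContDiffAt ℝ n (fun y => -(p.kOm • (ζ y).2.2.2.2) - p.kR • Stage.eR (ζ y)) w :=
    (contDiffAt_csmul _ hΩ).neg.sub (contDiffAt_csmul _ (contDiffAt_eR h))
  have h5 : ContDiffAt ℝ n (fun y => -(p.kv • (ζ y).2.2.1) - p.kx • (ζ y).2.1) w :=
    (contDiffAt_csmul _ hv).neg.sub (contDiffAt_csmul _ h.snd.fst)
  have h6 : MatSmooth n (fun y => Stage.R (ζ y) * hat ((ζ y).2.2.2.2 + Stage.w (ζ y))) w :=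
    (matSmooth_R h).mul (matSmooth_hat (hΩ.add (contDiffAt_w h)))
  exact hv.prodMk ((h5.sub (contDiffAt_csmul _ h1)).prodMk (h6.contDiffAt.prodMk
    ((matSmooth_const _).mulVec ((h4.add h3).sub h2))))

theorem contDiffAt_refRate (h : ContDiffAt ℝ n ζ w) (hc : ContDiffAt ℝ n c w) :
    ContDiffAt ℝ n (fun y => refRate (ζ y) (c y)) w :=
  ((matSmooth_Rd h).mul (matSmooth_hat h.fst.snd.snd.fst)).contDiffAt.prodMk
    (hc.fst.prodMk (h.fst.snd.snd.snd.prodMk hc.snd))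

theorem contDiff_stageMu (j : Fin 4) : ContDiff ℝ n (fun ζ => stageMu p ζ j) :=
  contDiff_iff_contDiffAt.2 fun _ => contDiffAt_stageMu p contDiffAt_id j

/-- The desired force is polynomial in the stage, so its differential is smooth everywhere; a
nonzero force is needed only when it is normalised. -/
theorem contDiffAt_muRate (h : ContDiffAt ℝ ∞ ζ w) (hc : ContDiffAt ℝ ∞ c w)
    (hq : ContDiffAt ℝ ∞ q w) (j : Fin 4) :
    ContDiffAt ℝ ∞ (fun y => muRate p (ζ y) (c y) (q y) j) w := by
  have h1 : ContDiff ℝ ∞ (fderiv ℝ fun ζ => stageMu p ζ j) :=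
    (contDiff_stageMu p j).fderiv_right (m := ∞) le_rfl
  exact (h1.contDiffAt.comp w h).clm_apply
    ((contDiffAt_refRate h hc).prodMk (contDiffAt_loadRate p h hq))

theorem contDiffAt_stageOmD (h : ContDiffAt ℝ ∞ ζ w) (hc : ContDiffAt ℝ ∞ c w)
    (hq : ContDiffAt ℝ ∞ q w) (j : Fin 4) (h0 : stageMu p (ζ w) j ≠ 0) :
    ContDiffAt ℝ ∞ (fun y => stageOmD p (ζ y) (c y) (q y) j) w := by
  have h1 := contDiffAt_stageMu p h j
  refine ((contDiffAt_dot h1 h1).inv ?_).smul (contDiffAt_cross h1 (contDiffAt_muRate p h hc hq j))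
  rw [← vnorm_sq]
  have := vnorm_pos h0
  positivity

theorem contDiffAt_stageDir (h : ContDiffAt ℝ n ζ w) (j : Fin 4) (h0 : stageMu p (ζ w) j ≠ 0) :
    ContDiffAt ℝ n (fun y => stageDir p (ζ y) j) w := by
  have h1 := contDiffAt_stageMu p h j
  exact (((contDiffAt_vnorm h1 h0).inv (vnorm_pos h0).ne').smul h1).neg

end Smooth

end Model

/-! ### The error coordinates of a state -/

/-- The desired motion at time `t`. -/
def DesiredTrajectory.refData (D : DesiredTrajectory) (t : ℝ) : RefData :=
  (fun i k => D.R t i k, iteratedDeriv 2 D.x t, D.Om t, deriv D.Om t)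

/-- The highest derivatives of the desired motion at time `t`. -/
def DesiredTrajectory.refRates (D : DesiredTrajectory) (t : ℝ) : RefRates :=
  (iteratedDeriv 3 D.x t, iteratedDeriv 2 D.Om t)

/-- The load errors of a state. -/
def loadErr (D : DesiredTrajectory) (t : ℝ) (X : LoadState) : LoadErr :=
  (errX D t X, errV D t X, fun i k => X.R i k, errOm D t X)

/-- The data of a state on which the desired cable forces depend. -/
def stage (D : DesiredTrajectory) (t : ℝ) (X : LoadState) : Stage := (D.refData t, loadErr D t X)

theorem stageMu_stage (p : Params) (D : DesiredTrajectory) (t : ℝ) (X : LoadState) (j : Fin 4) :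
    stageMu p (stage D t X) j = muD p D t X j := rfl

theorem stageDir_stage (p : Params) (D : DesiredTrajectory) (t : ℝ) (X : LoadState) (j : Fin 4) :
    stageDir p (stage D t X) j = qD p D t X j := rfl

theorem hasDerivAt_refData (D : DesiredTrajectory) (t : ℝ) (y : LoadErr) :
    HasDerivAt D.refData (refRate (D.refData t, y) (D.refRates t)) t := by
  have h1 : HasDerivAt (fun s i k => D.R s i k)
      (fun i k => (D.R t * hat (D.Om t)) i k) t :=
    hasDerivAt_pi.2 fun i => hasDerivAt_pi.2 fun k => D.R_deriv t i k
  have h2 : HasDerivAt (iteratedDeriv 2 D.x) (iteratedDeriv 3 D.x t) t := by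
    rw [iteratedDeriv_succ (n := 2)]
    exact ((D.x_smooth.differentiable_iteratedDeriv 2 (WithTop.coe_lt_coe.2 (ENat.natCast_lt_top 2))) t).hasDerivAt
  have h3 : HasDerivAt D.Om (deriv D.Om t) t :=
    ((D.Om_smooth.differentiable (by simp)) t).hasDerivAt
  have h4 : HasDerivAt (deriv D.Om) (iteratedDeriv 2 D.Om t) t := by
    rw [iteratedDeriv_succ (n := 1), iteratedDeriv_one, ← iteratedDeriv_one]
    exact ((D.Om_smooth.differentiable_iteratedDeriv 1 (WithTop.coe_lt_coe.2 (ENat.natCast_lt_top 1))) t).hasDerivAt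
  exact h1.prodMk (h2.prodMk (h3.prodMk h4))

theorem continuous_refRates (D : DesiredTrajectory) : Continuous D.refRates :=
  (D.x_smooth.continuous_iteratedDeriv 3 (WithTop.coe_le_coe.2 le_top)).prodMk
    (D.Om_smooth.continuous_iteratedDeriv 2 (WithTop.coe_le_coe.2 le_top))

theorem continuous_refData (D : DesiredTrajectory) : Continuous D.refData :=
  continuous_iff_continuousAt.2 fun t => (hasDerivAt_refData D t 0).continuousAt

/-! ### Uniform bounds near the desired motion -/

/-- The size of the load errors. -/
def loadSize (D : DesiredTrajectory) (t : ℝ) (X : LoadState) : ℝ :=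
  vnorm (errX D t X) ^ 2 + vnorm (errV D t X) ^ 2 + PsiR D t X + vnorm (errOm D t X) ^ 2

theorem abs_apply_sub_sq_le_PsiR (D : DesiredTrajectory) (t : ℝ) {X : LoadState}
    (hR : X.R ∈ SO3) (i k : Fin 3) : (X.R i k - D.R t i k) ^ 2 ≤ 4 * PsiR D t X := by
  rw [PsiR, ← sum_sq_sub_SO3 hR (D.R_mem t)]
  exact (Finset.single_le_sum (f := fun k => (X.R i k - D.R t i k) ^ 2)
      (fun _ _ => sq_nonneg _) (Finset.mem_univ k)).trans
    (Finset.single_le_sum (f := fun i => ∑ k, (X.R i k - D.R t i k) ^ 2)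
      (fun _ _ => Finset.sum_nonneg fun _ _ => sq_nonneg _) (Finset.mem_univ i))

theorem PsiR_nonneg (D : DesiredTrajectory) (t : ℝ) {X : LoadState} (hR : X.R ∈ SO3) :
    0 ≤ PsiR D t X := by
  have := abs_apply_sub_sq_le_PsiR D t hR 0 0
  nlinarith [sq_nonneg (X.R 0 0 - D.R t 0 0)]

theorem rel_mem_SO3 (D : DesiredTrajectory) (t : ℝ) {X : LoadState} (hR : X.R ∈ SO3) :
    (D.R t)ᵀ * X.R ∈ SO3 := mul_mem (SO3_transpose_mem (D.R_mem t)) hR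

theorem errR_eq (D : DesiredTrajectory) (t : ℝ) (X : LoadState) :
    errR D t X = vee ((1 / 2 : ℝ) • ((D.R t)ᵀ * X.R - ((D.R t)ᵀ * X.R)ᵀ)) := by
  rw [errR, Matrix.transpose_mul, Matrix.transpose_transpose]

theorem vnorm_errR_sq (D : DesiredTrajectory) (t : ℝ) {X : LoadState} (hR : X.R ∈ SO3) :
    vnorm (errR D t X) ^ 2 = PsiR D t X * (2 - PsiR D t X) := by
  rw [vnorm_sq, errR_eq, attitude_error_sq (rel_mem_SO3 D t hR), PsiR]

theorem vnorm_OmRel (D : DesiredTrajectory) (t : ℝ) {X : LoadState} (hR : X.R ∈ SO3) :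
    vnorm (OmRel D t X) = vnorm (D.Om t) :=
  vnorm_SO3_mulVec (mul_mem (SO3_transpose_mem hR) (D.R_mem t)) _

theorem OmRel_eq (D : DesiredTrajectory) (t : ℝ) (X : LoadState) :
    OmRel D t X = ((D.R t)ᵀ * X.R)ᵀ *ᵥ D.Om t := by
  rw [OmRel, Matrix.transpose_mul, Matrix.transpose_transpose]

theorem loadErr_load (D : DesiredTrajectory) (t : ℝ) :
    loadErr D t (D.load t) = (0, 0, fun i k => D.R t i k, 0) := by
  have h : errOm D t (D.load t) = 0 := by
    simp [errOm, OmRel, DesiredTrajectory.load, SO3_transpose_mul_self (D.R_mem t)]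
  rw [loadErr, h]
  simp [errX, errV, DesiredTrajectory.load]

theorem norm_le_of_abs_apply_le {A : Fin 3 → Fin 3 → ℝ} {c : ℝ} (hc : 0 ≤ c)
    (h : ∀ i k, |A i k| ≤ c) : ‖A‖ ≤ c :=
  (pi_norm_le_iff_of_nonneg hc).2 fun i => (pi_norm_le_iff_of_nonneg hc).2 fun k => h i k

/-- The squared Frobenius distance of the two attitudes is 4Ψ_R, which is where the factor 2 comes
from. -/
theorem norm_stage_sub_le (D : DesiredTrajectory) (t : ℝ) {X : LoadState} (hR : X.R ∈ SO3) {δ : ℝ}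
    (hδ : 0 ≤ δ) (h : loadSize D t X ≤ δ ^ 2) :
    ‖stage D t X - stage D t (D.load t)‖ ≤ 2 * δ := by
  have h1 := PsiR_nonneg D t hR
  have h2 := sq_nonneg (vnorm (errX D t X))
  have h3 := sq_nonneg (vnorm (errV D t X))
  have h4 := sq_nonneg (vnorm (errOm D t X))
  unfold loadSize at h
  have key : ∀ x : Vec3, vnorm x ^ 2 ≤ δ ^ 2 → ‖x‖ ≤ 2 * δ := fun x hx =>
    (norm_le_vnorm x).trans (by linarith [abs_le_of_sq_le_sq hx hδ, le_abs_self (vnorm x)])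
  have e : stage D t X - stage D t (D.load t) =
      (0, (errX D t X, errV D t X, fun i k => X.R i k - D.R t i k, errOm D t X)) := by
    simp only [stage, loadErr_load]
    rw [loadErr]
    simp only [Prod.mk_sub_mk, sub_self, sub_zero]
    rfl
  rw [e]
  refine norm_prod_le_iff.2 ⟨by simpa using hδ, norm_prod_le_iff.2 ⟨key _ (by linarith),
    norm_prod_le_iff.2 ⟨key _ (by linarith), norm_prod_le_iff.2 ⟨?_, key _ (by linarith)⟩⟩⟩⟩
  refine norm_le_of_abs_apply_le (by linarith) fun i k => ?_
  have := abs_apply_sub_sq_le_PsiR D t hR i k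
  exact abs_le_of_sq_le_sq (by nlinarith) (by linarith)

/-- A stage contains position and velocity errors but neither the desired position nor the desired
velocity, so these two need no bound. -/
theorem exists_norm_ref_le {D : DesiredTrajectory} (hD : D.IsBounded) :
    ∃ C, 0 ≤ C ∧ ∀ t, 0 ≤ t → ‖stage D t (D.load t)‖ ≤ C ∧ ‖D.refRates t‖ ≤ C := by
  obtain ⟨C, hC⟩ := hD
  have hC0 : 0 ≤ C := (vnorm_nonneg _).trans (hC 0 le_rfl).1
  -- The extra 1 covers the entries of rotation matrices.
  refine ⟨C + 1, by linarith, fun t ht => ?_⟩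
  obtain ⟨h1, h2, h3, h4, h5⟩ := hC t ht
  have key : ∀ x : Vec3, vnorm x ≤ C → ‖x‖ ≤ C + 1 := fun x hx =>
    (norm_le_vnorm x).trans (by linarith)
  have hR : ‖(fun i k => D.R t i k : Fin 3 → Fin 3 → ℝ)‖ ≤ C + 1 :=
    norm_le_of_abs_apply_le (by linarith) fun i k =>
      (SO3_abs_apply_le (D.R_mem t) i k).trans (by linarith)
  have h0 : ‖(0 : Vec3)‖ ≤ C + 1 := by simpa using by linarith
  rw [stage, loadErr_load]
  exact ⟨norm_prod_le_iff.2 ⟨norm_prod_le_iff.2 ⟨hR, norm_prod_le_iff.2 ⟨key _ h1,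
    norm_prod_le_iff.2 ⟨key _ h3, key _ h4⟩⟩⟩, norm_prod_le_iff.2 ⟨h0, norm_prod_le_iff.2 ⟨h0,
    norm_prod_le_iff.2 ⟨hR, h0⟩⟩⟩⟩, norm_prod_le_iff.2 ⟨key _ h2, key _ h5⟩⟩

theorem continuous_stageMu (p : Params) (j : Fin 4) : Continuous fun ζ => stageMu p ζ j :=
  (contDiff_stageMu (n := 0) p j).continuous

/-- Near the desired motion the desired cable forces are bounded away from zero and their
arguments stay in a bounded set. -/
theorem exists_region {p : Params} {D : DesiredTrajectory} (hD : D.IsBounded)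
    (hmu : ∃ ν > 0, ∀ t : ℝ, 0 ≤ t → ∀ j, ν ≤ vnorm (muD p D t (D.load t) j)) :
    ∃ ρ > 0, ∃ ν > 0, ∃ C > 0, ρ ≤ 1 ∧ ∀ t, 0 ≤ t → ‖D.refRates t‖ ≤ C ∧
      ∀ X : LoadState, X.R ∈ SO3 → loadSize D t X ≤ ρ →
        ‖stage D t X‖ ≤ C ∧ ∀ j, ν ≤ vnorm (muD p D t X j) := by
  obtain ⟨ν, hν, hmu⟩ := hmu
  obtain ⟨C, hC0, hC⟩ := exists_norm_ref_le hD
  have hf : Continuous fun ζ : Stage => fun j => vnorm (stageMu p ζ j) :=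
    continuous_pi fun j => continuous_vnorm.comp (continuous_stageMu p j)
  -- The desired stages have norm at most `C`, and the perturbations allowed below have norm at most
  -- `2 * η ≤ 2`. Uniform continuity on this ball is what makes the radius independent of time.
  have hu := (isCompact_closedBall (0 : Stage) (C + 2)).uniformContinuousOn_of_continuous
    hf.continuousOn
  obtain ⟨δ, hδ, hu⟩ := Metric.uniformContinuousOn_iff.1 hu (ν / 2) (by linarith)
  set η := min (δ / 4) 1
  have hη : 0 < η := lt_min (by linarith) one_pos
  have hη1 : η ≤ 1 := min_le_right _ _
  have hη2 : η ≤ δ / 4 := min_le_left _ _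
  refine ⟨η ^ 2, by positivity, ν / 2, by linarith, C + 2, by linarith, by nlinarith,
    fun t ht => ⟨by linarith [(hC t ht).2], fun X hR hX => ?_⟩⟩
  have h1 := norm_stage_sub_le D t hR hη.le hX
  have h2 := (hC t ht).1
  have h3 : ‖stage D t X‖ ≤ C + 2 := by
    have := norm_add_le (stage D t X - stage D t (D.load t)) (stage D t (D.load t))
    rw [sub_add_cancel] at this
    linarith
  refine ⟨h3, fun j => ?_⟩
  have h4 := hu (stage D t X) (by simpa using h3) (stage D t (D.load t))
    (by rw [mem_closedBall_zero_iff]; linarith) (by rw [dist_eq_norm]; linarith)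
  have h5 := (dist_le_pi_dist _ _ j).trans_lt h4
  simp only [stageMu_stage, Real.dist_eq] at h5
  linarith [hmu t ht j, (abs_lt.1 h5).1]

/-- The desired cable forces and angular velocities are bounded near the desired motion. -/
theorem exists_mu_omD_bound (p : Params) (C : ℝ) {ν : ℝ} (hν : 0 < ν) :
    ∃ B, 0 ≤ B ∧ ∀ (ζ : Stage) (c : RefRates) (q : Dirs), ‖ζ‖ ≤ C → ‖c‖ ≤ C → ‖q‖ ≤ C → ∀ j,
      vnorm (stageMu p ζ j) ≤ B ∧
      (ν ≤ vnorm (stageMu p ζ j) → vnorm (stageOmD p ζ c q j) ≤ B) := by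
  have hf : Continuous fun y : Stage × RefRates × Dirs => fun j =>
      vnorm (stageMu p y.1 j) + vnorm (muRate p y.1 y.2.1 y.2.2 j) := by
    refine continuous_pi fun j => ?_
    have h1 := (continuous_stageMu p j).comp (continuous_fst (X := Stage) (Y := RefRates × Dirs))
    have h2 : Continuous fun y : Stage × RefRates × Dirs => muRate p y.1 y.2.1 y.2.2 j :=
      continuous_iff_continuousAt.2 fun y => (contDiffAt_muRate p contDiffAt_fst
        contDiffAt_snd.fst contDiffAt_snd.snd j).continuousAt
    exact (continuous_vnorm.comp h1).add (continuous_vnorm.comp h2)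
  obtain ⟨A, hA⟩ := (isCompact_closedBall (0 : Stage × RefRates × Dirs) C).exists_bound_of_continuousOn
    hf.continuousOn
  have hA' : ∀ (ζ : Stage) (c : RefRates) (q : Dirs), ‖ζ‖ ≤ C → ‖c‖ ≤ C → ‖q‖ ≤ C → ∀ j,
      vnorm (stageMu p ζ j) + vnorm (muRate p ζ c q j) ≤ |A| := by
    intro ζ c q h1 h2 h3 j
    have := hA (ζ, c, q) (mem_closedBall_zero_iff.2
      (norm_prod_le_iff.2 ⟨h1, norm_prod_le_iff.2 ⟨h2, h3⟩⟩))
    exact (le_abs_self _).trans ((norm_le_pi_norm _ j).trans (this.trans (le_abs_self _)))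
  -- `|A|` bounds both the force and its rate, hence `|A| * |A| / ν ^ 2` bounds |μ × μ'| / |μ|².
  refine ⟨|A| + |A| * |A| / ν ^ 2, by positivity, fun ζ c q h1 h2 h3 j => ?_⟩
  have h4 := hA' ζ c q h1 h2 h3 j
  have h5 := vnorm_nonneg (stageMu p ζ j)
  have h6 := vnorm_nonneg (muRate p ζ c q j)
  have h7 : 0 ≤ |A| * |A| / ν ^ 2 := by positivity
  refine ⟨by linarith, fun h8 => ?_⟩
  rw [stageOmD, vnorm_smul, ← vnorm_sq, abs_inv, abs_of_nonneg (sq_nonneg _), inv_mul_eq_div]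
  have h9 : vnorm (crossProduct (stageMu p ζ j) (muRate p ζ c q j)) ≤ |A| * |A| :=
    (vnorm_cross_le _ _).trans (mul_le_mul (by linarith) (by linarith) h6 (abs_nonneg _))
  have h10 : vnorm (crossProduct (stageMu p ζ j) (muRate p ζ c q j)) / vnorm (stageMu p ζ j) ^ 2
      ≤ |A| * |A| / ν ^ 2 := by gcongr
  linarith [abs_nonneg A]

/-! ### Lyapunov estimates for the three kinds of subsystems -/

/-- Used to keep the energies definite, and comparable with the squared errors, after the cross term
is added. -/
theorem exists_small_cross {k1 k2 c : ℝ} (h1 : 0 < k1) (h2 : 0 < k2) (hc : 0 ≤ c) :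
    ∃ ε0 > 0, ∀ ε, 0 < ε → ε ≤ ε0 → ∀ a b : ℝ, 0 ≤ a → 0 ≤ b →
      ε * (c * (a * b)) ≤ k1 / 2 * a ^ 2 + k2 / 2 * b ^ 2 := by
  have hm : 0 < min k1 k2 := lt_min h1 h2
  refine ⟨min k1 k2 / (c + 1), by positivity, fun ε hε hle a b ha hb => ?_⟩
  rw [le_div_iff₀ (by positivity)] at hle
  have h3 : ε * c ≤ min k1 k2 := by nlinarith
  have h4 : ε * c * (a * b) ≤ min k1 k2 * (a * b) :=
    mul_le_mul_of_nonneg_right h3 (mul_nonneg ha hb)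
  have h5 : a * b ≤ (a ^ 2 + b ^ 2) / 2 := by nlinarith [sq_nonneg (a - b)]
  have h6 := mul_le_mul_of_nonneg_left h5 hm.le
  have h7 := mul_le_mul_of_nonneg_right (min_le_left k1 k2) (sq_nonneg a)
  have h8 := mul_le_mul_of_nonneg_right (min_le_right k1 k2) (sq_nonneg b)
  nlinarith

/-- The restoring terms cancel in the derivative of the energy, leaving `-kv * |v|²`;
differentiating `ε * (x ⬝ᵥ v)` supplies the missing `-ε * kx * |x|²`. Here `d` is the force of the
cables and `S` the sum of the direction errors. -/
theorem translational_estimate {kx kv c : ℝ} (hx : 0 < kx) (hv : 0 < kv) (hc : 0 ≤ c) :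
    ∃ ε a l u C : ℝ, 0 < a ∧ 0 < l ∧ 0 < u ∧ 0 ≤ C ∧
      (∀ x v : Vec3,
        l * (vnorm x ^ 2 + vnorm v ^ 2) ≤ 1 / 2 * (v ⬝ᵥ v) + kx / 2 * (x ⬝ᵥ x) + ε * (x ⬝ᵥ v) ∧
        1 / 2 * (v ⬝ᵥ v) + kx / 2 * (x ⬝ᵥ x) + ε * (x ⬝ᵥ v) ≤ u * (vnorm x ^ 2 + vnorm v ^ 2)) ∧
      ∀ (x v d : Vec3) (S : ℝ), 0 ≤ S → vnorm d ≤ c * S →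
        v ⬝ᵥ (-(kv • v) - kx • x - d) + kx * (x ⬝ᵥ v)
          + ε * (v ⬝ᵥ v + x ⬝ᵥ (-(kv • v) - kx • x - d)) ≤
        -a * (vnorm x ^ 2 + vnorm v ^ 2) + C * S ^ 2 := by
  obtain ⟨ε1, hε1, h1⟩ := exists_cross_term hv hx (show 0 ≤ 1 + kv by linarith)
  obtain ⟨ε2, hε2, h2⟩ := exists_small_cross (c := 1) (show 0 < kx / 2 by linarith)
    (show (0 : ℝ) < 1 / 2 by norm_num) zero_le_one
  set ε := min ε1 ε2
  have hε : 0 < ε := lt_min hε1 hε2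
  have h1 := h1 ε hε (min_le_left _ _)
  have h2 := h2 ε hε (min_le_right _ _)
  -- `exists_cross_term` leaves half of each dissipation rate. Half of that remains in the end; the
  -- other half pays for the disturbance.
  set a := min (kv / 4) (ε * kx / 4)
  have ha : 0 < a := lt_min (by linarith) (by positivity)
  have ha1 : a ≤ kv / 4 := min_le_left _ _
  have ha2 : a ≤ ε * kx / 4 := min_le_right _ _
  obtain ⟨C, hC, h3⟩ := exists_disturbance_bound ha (c * (1 + ε))
  set l := min (kx / 4) (1 / 4)
  have hl1 : l ≤ kx / 4 := min_le_left _ _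
  have hl2 : l ≤ 1 / 4 := min_le_right _ _
  refine ⟨ε, a, l, kx + 1, C, ha, lt_min (by linarith) (by norm_num), by linarith, hC,
    fun x v => ?_, fun x v d S hS hd => ?_⟩
  · have h4 := h2 _ _ (vnorm_nonneg x) (vnorm_nonneg v)
    have h5 := abs_le.1 (abs_dot_le x v)
    have h6 := mul_le_mul_of_nonneg_left h5.1 hε.le
    have h7 := mul_le_mul_of_nonneg_left h5.2 hε.le
    have h8 := mul_le_mul_of_nonneg_right hl1 (sq_nonneg (vnorm x))
    have h9 := mul_le_mul_of_nonneg_right hl2 (sq_nonneg (vnorm v))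
    rw [← vnorm_sq, ← vnorm_sq]
    constructor <;> nlinarith [sq_nonneg (vnorm x), sq_nonneg (vnorm v)]
  · have hdv := (abs_le.1 (abs_dot_le v d)).1
    have hdx := (abs_le.1 (abs_dot_le x d)).1
    have hxv := (abs_le.1 (abs_dot_le x v)).1
    have hx0 := vnorm_nonneg x
    have hv0 := vnorm_nonneg v
    have h4 := h1 (vnorm x) (vnorm v)
    have h5 := h3 (vnorm x) (vnorm v) S
    have h6 := mul_le_mul_of_nonneg_left hd hv0
    have h7 := mul_le_mul_of_nonneg_left (mul_le_mul_of_nonneg_left hd hx0) hε.le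
    have h8 := mul_le_mul_of_nonneg_left hdx hε.le
    have h9 := mul_le_mul_of_nonneg_left hxv (mul_nonneg hε.le hv.le)
    have h10 := mul_le_mul_of_nonneg_right ha1 (sq_nonneg (vnorm v))
    have h11 := mul_le_mul_of_nonneg_right ha2 (sq_nonneg (vnorm x))
    have h12 : 0 ≤ c * S * vnorm x := by positivity
    have h13 : 0 ≤ ε * (c * S * vnorm v) := by positivity
    have h14 : 0 ≤ ε * (vnorm x * vnorm v) := by positivity
    have h15 : 0 ≤ a * vnorm x ^ 2 := by positivity
    have h16 : 0 ≤ a * vnorm v ^ 2 := by positivity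
    have h17 : 0 ≤ ε * kv * vnorm v ^ 2 := by positivity
    simp only [dotProduct_sub, dotProduct_neg, dotProduct_smul, smul_eq_mul, ← vnorm_sq]
    rw [dotProduct_comm v x]
    linarith

/-- Minimum of the quadratic form over the unit sphere of the supremum norm, extended by
homogeneity; the factor 4 returns to the Euclidean norm. -/
theorem exists_lower_bound_of_posDef {J : Mat3} (hJ : J.PosDef) :
    ∃ jm > 0, ∀ o : Vec3, jm * vnorm o ^ 2 ≤ o ⬝ᵥ J *ᵥ o := by
  have hpos : ∀ x : Vec3, x ≠ 0 → 0 < x ⬝ᵥ J *ᵥ x := fun x hx => by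
    simpa using hJ.dotProduct_mulVec_pos hx
  have hcont : Continuous fun x : Vec3 => x ⬝ᵥ J *ᵥ x := by
    simp only [dot3, Matrix.mulVec]; fun_prop
  obtain ⟨y, hy, hmin⟩ := (isCompact_sphere (0 : Vec3) 1).exists_isMinOn
    (NormedSpace.sphere_nonempty.2 zero_le_one) hcont.continuousOn
  have hy0 : y ≠ 0 := by rintro rfl; simp at hy
  refine ⟨(y ⬝ᵥ J *ᵥ y) / 4, div_pos (hpos y hy0) (by norm_num), fun o => ?_⟩
  rcases eq_or_ne o 0 with rfl | ho
  · simp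
  have hn : ‖o‖ ≠ 0 := norm_ne_zero_iff.2 ho
  have h1 : y ⬝ᵥ J *ᵥ y ≤ (‖o‖⁻¹ • o) ⬝ᵥ J *ᵥ (‖o‖⁻¹ • o) :=
    hmin (by rw [mem_sphere_zero_iff_norm, norm_smul, norm_inv, norm_norm, inv_mul_cancel₀ hn])
  rw [Matrix.mulVec_smul, smul_dotProduct, dotProduct_smul, smul_eq_mul, smul_eq_mul] at h1
  have h2 : (y ⬝ᵥ J *ᵥ y) * ‖o‖ ^ 2 ≤ o ⬝ᵥ J *ᵥ o := by
    have := mul_le_mul_of_nonneg_right h1 (sq_nonneg ‖o‖)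
    have e : ‖o‖⁻¹ * (‖o‖⁻¹ * (o ⬝ᵥ J *ᵥ o)) * ‖o‖ ^ 2 = o ⬝ᵥ J *ᵥ o := by field_simp
    linarith
  have h3 : vnorm o ^ 2 ≤ 4 * ‖o‖ ^ 2 := by
    nlinarith [vnorm_le_two_mul_norm o, vnorm_nonneg o, norm_nonneg o]
  have h4 := mul_le_mul_of_nonneg_left h3 (hpos y hy0).le
  linarith

/-- Same mechanism as for translations, with Ψ as potential, whose derivative is `r ⬝ᵥ o`. The
gyroscopic term is orthogonal to `o` and does no work. It survives in the cross term alone, where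
`vnorm r ≤ 1` turns its part of second order in `o` into a multiple of `ε * |o|²`, absorbed by the
damping. -/
theorem rotational_estimate {kR kOm c b1 b2 : ℝ} {J : Mat3} (G : Mat3) (hR : 0 < kR)
    (hOm : 0 < kOm) (hc : 0 ≤ c) (hb1 : 0 ≤ b1) (hb2 : 0 ≤ b2) (hJ : J.PosDef) :
    ∃ ε a l u C : ℝ, 0 < a ∧ 0 < l ∧ 0 < u ∧ 0 ≤ C ∧
      (∀ (Ψ : ℝ) (r o : Vec3), vnorm r ^ 2 ≤ 2 * Ψ →
        l * (Ψ + vnorm o ^ 2) ≤ kR * Ψ + 1 / 2 * (o ⬝ᵥ J *ᵥ o) + ε * (r ⬝ᵥ J *ᵥ o) ∧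
        kR * Ψ + 1 / 2 * (o ⬝ᵥ J *ᵥ o) + ε * (r ⬝ᵥ J *ᵥ o) ≤ u * (Ψ + vnorm o ^ 2)) ∧
      ∀ (r r' o w d : Vec3) (S : ℝ), 0 ≤ S → vnorm d ≤ c * S → vnorm r ≤ 1 →
        vnorm r' ≤ b1 * vnorm o → vnorm w ≤ b2 →
        kR * (r ⬝ᵥ o) + o ⬝ᵥ (-(kOm • o) - kR • r + hat (J *ᵥ o + G *ᵥ w) *ᵥ o - d)
          + ε * (r' ⬝ᵥ J *ᵥ o
            + r ⬝ᵥ (-(kOm • o) - kR • r + hat (J *ᵥ o + G *ᵥ w) *ᵥ o - d)) ≤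
        -a * (vnorm r ^ 2 + vnorm o ^ 2) + C * S ^ 2 := by
  obtain ⟨jM, hjM, hJM⟩ := exists_vnorm_mulVec_le J
  obtain ⟨g, hg, hG⟩ := exists_vnorm_mulVec_le G
  obtain ⟨jm, hjm, hJm⟩ := exists_lower_bound_of_posDef hJ
  -- The summands bound, in order, the contributions of `r'`, of the damping, and of the two halves
  -- of the gyroscopic term.
  obtain ⟨ε1, hε1, h1⟩ := exists_cross_term hOm hR
    (show 0 ≤ b1 * jM + kOm + jM + g * b2 by positivity)
  obtain ⟨ε2, hε2, h2⟩ := exists_small_cross (c := jM) (show 0 < kR / 2 by linarith)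
    (show 0 < jm / 2 by linarith) hjM
  set ε := min ε1 ε2
  have hε : 0 < ε := lt_min hε1 hε2
  have h1 := h1 ε hε (min_le_left _ _)
  have h2 := h2 ε hε (min_le_right _ _)
  set a := min (kOm / 4) (ε * kR / 4)
  have ha : 0 < a := lt_min (by linarith) (by positivity)
  have ha1 : a ≤ kOm / 4 := min_le_left _ _
  have ha2 : a ≤ ε * kR / 4 := min_le_right _ _
  obtain ⟨C, hC, h3⟩ := exists_disturbance_bound ha (c * (1 + ε))
  set l := min (kR / 2) (jm / 4)
  have hl1 : l ≤ kR / 2 := min_le_left _ _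
  have hl2 : l ≤ jm / 4 := min_le_right _ _
  refine ⟨ε, a, l, 2 * kR + jM + jm, C, ha, lt_min (by linarith) (by linarith), by linarith, hC,
    fun Ψ r o hΨ => ?_, fun r r' o w d S hS hd hr hr' hw => ?_⟩
  · have hΨ0 : 0 ≤ Ψ := by nlinarith [sq_nonneg (vnorm r)]
    have h4 := h2 _ _ (vnorm_nonneg r) (vnorm_nonneg o)
    have h5 := abs_le.1 (abs_dot_le r (J *ᵥ o))
    have h5' := mul_le_mul_of_nonneg_left (hJM o) (vnorm_nonneg r)
    have h6 := mul_le_mul_of_nonneg_left h5.1 hε.le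
    have h7 := mul_le_mul_of_nonneg_left h5.2 hε.le
    have h7' := mul_le_mul_of_nonneg_left h5' hε.le
    have h8 := mul_le_mul_of_nonneg_right hl1 hΨ0
    have h9 := mul_le_mul_of_nonneg_right hl2 (sq_nonneg (vnorm o))
    have h10 := hJm o
    have h11 := (dot_le o (J *ᵥ o)).trans (mul_le_mul_of_nonneg_left (hJM o) (vnorm_nonneg o))
    have h12 := mul_le_mul_of_nonneg_left hΨ hR.le
    have h13 := mul_nonneg hjm.le (sq_nonneg (vnorm o))
    have h14 := mul_nonneg hjM (sq_nonneg (vnorm o))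
    have h15 := mul_nonneg hjM hΨ0
    have h16 := mul_nonneg hjm.le hΨ0
    have h17 := mul_nonneg hR.le (sq_nonneg (vnorm o))
    have h18 := mul_nonneg hR.le hΨ0
    constructor <;> linarith
  · have hr0 := vnorm_nonneg r
    have ho0 := vnorm_nonneg o
    have e1 := dot_hat_mulVec_self (J *ᵥ o + G *ᵥ w) o
    have hdo := (abs_le.1 (abs_dot_le o d)).1
    have hdr := mul_le_mul_of_nonneg_left (abs_le.1 (abs_dot_le r d)).1 hε.le
    have hro := mul_le_mul_of_nonneg_left (abs_le.1 (abs_dot_le r o)).1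
      (mul_nonneg hε.le hOm.le)
    have hr'o : r' ⬝ᵥ J *ᵥ o ≤ b1 * jM * vnorm o ^ 2 := by
      calc r' ⬝ᵥ J *ᵥ o ≤ vnorm r' * vnorm (J *ᵥ o) := dot_le _ _
        _ ≤ (b1 * vnorm o) * (jM * vnorm o) :=
          mul_le_mul hr' (hJM o) (vnorm_nonneg _) (by positivity)
        _ = _ := by ring
    have hgy : r ⬝ᵥ hat (J *ᵥ o + G *ᵥ w) *ᵥ o ≤
        jM * vnorm o ^ 2 + g * b2 * (vnorm r * vnorm o) := by
      have i1 : vnorm (J *ᵥ o + G *ᵥ w) ≤ jM * vnorm o + g * b2 :=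
        (vnorm_add_le _ _).trans (add_le_add (hJM o)
          ((hG w).trans (mul_le_mul_of_nonneg_left hw hg)))
      calc r ⬝ᵥ hat (J *ᵥ o + G *ᵥ w) *ᵥ o
          ≤ vnorm r * (vnorm (J *ᵥ o + G *ᵥ w) * vnorm o) :=
            (dot_le _ _).trans (mul_le_mul_of_nonneg_left (vnorm_hat_mulVec_le _ _) hr0)
        _ ≤ vnorm r * ((jM * vnorm o + g * b2) * vnorm o) := by gcongr
        _ = vnorm r * (jM * vnorm o ^ 2) + g * b2 * (vnorm r * vnorm o) := by ring
        _ ≤ 1 * (jM * vnorm o ^ 2) + g * b2 * (vnorm r * vnorm o) := by gcongr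
        _ = _ := by ring
    have hr'o' := mul_le_mul_of_nonneg_left hr'o hε.le
    have hgy' := mul_le_mul_of_nonneg_left hgy hε.le
    have h4 := h1 (vnorm r) (vnorm o)
    have h5 := h3 (vnorm r) (vnorm o) S
    have h6 := mul_le_mul_of_nonneg_left hd ho0
    have h7 := mul_le_mul_of_nonneg_left (mul_le_mul_of_nonneg_left hd hr0) hε.le
    have h10 := mul_le_mul_of_nonneg_right ha1 (sq_nonneg (vnorm o))
    have h11 := mul_le_mul_of_nonneg_right ha2 (sq_nonneg (vnorm r))
    have h12 : 0 ≤ c * S * vnorm r := by positivity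
    have h13 : 0 ≤ ε * (c * S * vnorm o) := by positivity
    have h14 : 0 ≤ ε * (b1 * jM + jM) * (vnorm r * vnorm o) := by positivity
    have h15 : 0 ≤ a * vnorm r ^ 2 := by positivity
    have h16 : 0 ≤ a * vnorm o ^ 2 := by positivity
    have h17 : 0 ≤ ε * (kOm + g * b2) * vnorm o ^ 2 := by positivity
    simp only [dotProduct_sub, dotProduct_add, dotProduct_neg, dotProduct_smul, smul_eq_mul,
      ← vnorm_sq, e1]
    rw [dotProduct_comm o r]
    linarith

/-- The term `s • q` is normal to the sphere, hence orthogonal to `e` and `z`, and drops out. The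
constant `c` stands for a bound on the desired angular velocity, the only trace of the load here. -/
theorem cable_estimate {kq kom c : ℝ} (hq : 0 < kq) (hom : 0 < kom) (hc : 0 ≤ c) :
    ∃ ε a l u : ℝ, 0 < a ∧ 0 < l ∧ 0 < u ∧
      (∀ (Ψ : ℝ) (e z : Vec3), vnorm e ^ 2 ≤ 2 * Ψ →
        l * (Ψ + vnorm z ^ 2) ≤ kq * Ψ + 1 / 2 * (z ⬝ᵥ z) + ε * (e ⬝ᵥ z) ∧
        kq * Ψ + 1 / 2 * (z ⬝ᵥ z) + ε * (e ⬝ᵥ z) ≤ u * (Ψ + vnorm z ^ 2)) ∧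
      ∀ (e e' z q : Vec3) (s : ℝ), e ⬝ᵥ q = 0 → z ⬝ᵥ q = 0 →
        vnorm e' ≤ c * vnorm e + vnorm z →
        kq * (e ⬝ᵥ z) + z ⬝ᵥ (s • q - kom • z - kq • e)
          + ε * (e' ⬝ᵥ z + e ⬝ᵥ (s • q - kom • z - kq • e)) ≤
        -a * (vnorm e ^ 2 + vnorm z ^ 2) := by
  obtain ⟨ε1, hε1, h1⟩ := exists_cross_term hom hq (show 0 ≤ 1 + c + kom by linarith)
  obtain ⟨ε2, hε2, h2⟩ := exists_small_cross (c := 1) (show 0 < kq / 2 by linarith)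
    (show (0 : ℝ) < 1 / 2 by norm_num) zero_le_one
  set ε := min ε1 ε2
  have hε : 0 < ε := lt_min hε1 hε2
  have h1 := h1 ε hε (min_le_left _ _)
  have h2 := h2 ε hε (min_le_right _ _)
  set a := min (kom / 2) (ε * (kq / 2))
  have ha1 : a ≤ kom / 2 := min_le_left _ _
  have ha2 : a ≤ ε * (kq / 2) := min_le_right _ _
  set l := min (kq / 2) (1 / 4)
  have hl1 : l ≤ kq / 2 := min_le_left _ _
  have hl2 : l ≤ 1 / 4 := min_le_right _ _
  refine ⟨ε, a, l, 2 * kq + 1, lt_min (by linarith) (by positivity),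
    lt_min (by linarith) (by norm_num), by linarith,
    fun Ψ e z hΨ => ?_, fun e e' z q s heq hzq he' => ?_⟩
  · have hΨ0 : 0 ≤ Ψ := by nlinarith [sq_nonneg (vnorm e)]
    have h4 := h2 _ _ (vnorm_nonneg e) (vnorm_nonneg z)
    have h5 := abs_le.1 (abs_dot_le e z)
    have h6 := mul_le_mul_of_nonneg_left h5.1 hε.le
    have h7 := mul_le_mul_of_nonneg_left h5.2 hε.le
    have h8 := mul_le_mul_of_nonneg_right hl1 hΨ0
    have h9 := mul_le_mul_of_nonneg_right hl2 (sq_nonneg (vnorm z))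
    have h12 := mul_le_mul_of_nonneg_left hΨ hq.le
    have h17 := mul_nonneg hq.le (sq_nonneg (vnorm z))
    have h18 := mul_nonneg hq.le hΨ0
    have h19 := sq_nonneg (vnorm z)
    rw [← vnorm_sq]
    constructor <;> linarith
  · have he0 := vnorm_nonneg e
    have hz0 := vnorm_nonneg z
    have hez := mul_le_mul_of_nonneg_left (abs_le.1 (abs_dot_le e z)).1
      (mul_nonneg hε.le hom.le)
    have h3 : e' ⬝ᵥ z ≤ (c * vnorm e + vnorm z) * vnorm z :=
      (dot_le _ _).trans (mul_le_mul_of_nonneg_right he' hz0)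
    have h4 := mul_le_mul_of_nonneg_left h3 hε.le
    have h5 := h1 (vnorm e) (vnorm z)
    have h10 := mul_le_mul_of_nonneg_right ha1 (sq_nonneg (vnorm z))
    have h11 := mul_le_mul_of_nonneg_right ha2 (sq_nonneg (vnorm e))
    have h14 : 0 ≤ ε * (vnorm e * vnorm z) := by positivity
    have h17 : 0 ≤ ε * (c + kom) * vnorm z ^ 2 := by positivity
    simp only [dotProduct_sub, dotProduct_smul, smul_eq_mul, ← vnorm_sq, heq, hzq]
    rw [dotProduct_comm z e]
    linarith

/-! ### Kinematics of the errors along a solution -/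

theorem hat_add (x y : Vec3) : hat (x + y) = hat x + hat y := by
  ext i k; fin_cases i <;> fin_cases k <;> simp [hat] <;> ring

theorem hat_transpose (x : Vec3) : (hat x)ᵀ = -hat x := by
  ext i k; fin_cases i <;> fin_cases k <;> simp [hat]

theorem abs_hat_apply_le (x : Vec3) (i k : Fin 3) : |hat x i k| ≤ vnorm x := by
  have := abs_apply_le_vnorm x
  fin_cases i <;> fin_cases k <;> simp [hat, vnorm_nonneg, this]

theorem hat_sq_mulVec (q x : Vec3) :
    (hat q * hat q) *ᵥ x = (q ⬝ᵥ x) • q - (q ⬝ᵥ q) • x := by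
  rw [← Matrix.mulVec_mulVec, hat_mulVec, hat_mulVec]
  ext i; fin_cases i <;> simp [cross_apply, dot3] <;> ring

/-- On unit vectors `-(hat q * hat q)` is the orthogonal projection onto the tangent plane at `q`.
-/
theorem errom_eq {q om omD : Vec3} (hq : q ⬝ᵥ q = 1) :
    errom q om omD = om + (q ⬝ᵥ omD) • q - omD := by
  rw [errom, hat_sq_mulVec, hq, one_smul, add_sub_assoc]

theorem errom_dot {q om omD : Vec3} (hq : q ⬝ᵥ q = 1) (h : q ⬝ᵥ om = 0) :
    errom q om omD ⬝ᵥ q = 0 := by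
  rw [errom_eq hq, sub_dotProduct, add_dotProduct, smul_dotProduct, hq, dotProduct_comm om, h,
    dotProduct_comm omD]
  simp

/-- The change of the angle is governed by the relative angular velocity, and the multiple of `q`
separating it from `errom` is orthogonal to n × q. -/
theorem cable_config_rate {q n om omD : Vec3} (hq : q ⬝ᵥ q = 1) :
    -(crossProduct omD n ⬝ᵥ q + n ⬝ᵥ crossProduct om q) =
      crossProduct n q ⬝ᵥ errom q om omD := by
  rw [errom_eq hq]
  simp only [dot3]
  simp [cross_apply]
  ring

/-- By the Jacobi identity n × q is carried along by `omD`, up to the effect of the relative angular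
velocity, whose component along `q` does not move `q`. -/
theorem cable_error_rate {q n om omD : Vec3} (hq : q ⬝ᵥ q = 1) :
    crossProduct (crossProduct omD n) q + crossProduct n (crossProduct om q) =
      crossProduct omD (crossProduct n q) + crossProduct n (crossProduct (errom q om omD) q) := by
  rw [errom_eq hq]
  ext i
  fin_cases i <;> simp [cross_apply, dot3] <;> ring

/-! ### Kinematics of the attitude error -/

section Attitude

variable {I : Set ℝ} {t : ℝ} {D : DesiredTrajectory} {X : ℝ → LoadState}

/-- The relative attitude Q = R̃ᵀR satisfies Q' = Q ê_Ω: moving the desired angular velocity across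
Q by conjugation turns it into `OmRel`. -/
theorem matDeriv_rel (hR : (X t).R ∈ SO3)
    (h : MatDeriv (fun s => (X s).R) ((X t).R * hat (X t).Om) I t) :
    MatDeriv (fun s => (D.R s)ᵀ * (X s).R) ((D.R t)ᵀ * (X t).R * hat (errOm D t (X t))) I t := by
  have h1 : MatDeriv D.R (D.R t * hat (D.Om t)) I t :=
    fun i k => (D.R_deriv t i k).hasDerivWithinAt
  have h2 := h1.transpose.mul h
  have e : (D.R t * hat (D.Om t))ᵀ * (X t).R + (D.R t)ᵀ * ((X t).R * hat (X t).Om) =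
      (D.R t)ᵀ * (X t).R * hat (errOm D t (X t)) := by
    have e1 : (X t).Om = errOm D t (X t) + OmRel D t (X t) := by simp [errOm]
    have e2 := SO3_mul_hat (rel_mem_SO3 D t hR) (D.Om t)
    rw [← OmRel_eq] at e2
    rw [e1, hat_add, mul_add, mul_add, ← mul_assoc, ← mul_assoc, e2, Matrix.transpose_mul,
      hat_transpose]
    simp only [neg_mul, mul_assoc]
    abel
  rwa [e] at h2

/-- The derivative is -½ tr(Q ê_Ω), and pairing with a skew matrix sees only the skew part of Q,
which is the attitude error. -/
theorem hasDerivWithinAt_PsiR (hR : (X t).R ∈ SO3)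
    (h : MatDeriv (fun s => (X s).R) ((X t).R * hat (X t).Om) I t) :
    HasDerivWithinAt (fun s => PsiR D s (X s)) (errR D t (X t) ⬝ᵥ errOm D t (X t)) I t := by
  have hQ := matDeriv_rel (D := D) hR h
  have h1 := ((((hQ 0 0).const_sub 1).add ((hQ 1 1).const_sub 1)).add
    ((hQ 2 2).const_sub 1)).const_mul (1 / 2 : ℝ)
  have e : (fun s => PsiR D s (X s)) = fun s => (1 / 2 : ℝ) * ((1 - ((D.R s)ᵀ * (X s).R) 0 0)
      + (1 - ((D.R s)ᵀ * (X s).R) 1 1) + (1 - ((D.R s)ᵀ * (X s).R) 2 2)) := by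
    ext s
    rw [PsiR, Matrix.trace]
    simp only [Fin.sum_univ_three, Matrix.diag_apply, Matrix.sub_apply, Matrix.one_apply_eq]
  rw [e, errR_eq]
  refine h1.congr_deriv ?_
  generalize (D.R t)ᵀ * (X t).R = Q
  generalize errOm D t (X t) = o
  rw [dot3]
  simp [Matrix.mul_apply, Fin.sum_univ_three, hat, vee]
  ring

/-- A crude constant suffices: entries of Q ê_Ω are sums of three terms, each at most |e_Ω|, and
passing from entries to the Euclidean norm costs 2. -/
theorem exists_hasDerivWithinAt_errR (hR : (X t).R ∈ SO3)
    (h : MatDeriv (fun s => (X s).R) ((X t).R * hat (X t).Om) I t) :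
    ∃ r', vnorm r' ≤ 6 * vnorm (errOm D t (X t)) ∧
      HasDerivWithinAt (fun s => errR D s (X s)) r' I t := by
  have hQ := matDeriv_rel (D := D) hR h
  set A := (D.R t)ᵀ * (X t).R * hat (errOm D t (X t))
  have hA : ∀ i k, |A i k| ≤ 3 * vnorm (errOm D t (X t)) := by
    intro i k
    have h1 : ∀ l, |((D.R t)ᵀ * (X t).R) i l * hat (errOm D t (X t)) l k| ≤
        1 * vnorm (errOm D t (X t)) := fun l => by
      rw [abs_mul]
      exact mul_le_mul (SO3_abs_apply_le (rel_mem_SO3 D t hR) i l) (abs_hat_apply_le _ l k)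
        (abs_nonneg _) zero_le_one
    calc |A i k| ≤ ∑ l, |((D.R t)ᵀ * (X t).R) i l * hat (errOm D t (X t)) l k| :=
        Finset.abs_sum_le_sum_abs
          (fun l => ((D.R t)ᵀ * (X t).R) i l * hat (errOm D t (X t)) l k) Finset.univ
      _ ≤ ∑ _l : Fin 3, 1 * vnorm (errOm D t (X t)) := Finset.sum_le_sum fun l _ => h1 l
      _ = _ := by simp
  have hd : ∀ i k, HasDerivWithinAt (fun s => ((1 / 2 : ℝ) • ((D.R s)ᵀ * (X s).R
      - ((D.R s)ᵀ * (X s).R)ᵀ)) i k) ((1 / 2 : ℝ) * (A i k - A k i)) I t :=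
    fun i k => ((hQ i k).sub (hQ k i)).const_mul (1 / 2 : ℝ)
  have hb : ∀ i k, |(1 / 2 : ℝ) * (A i k - A k i)| ≤ 3 * vnorm (errOm D t (X t)) := fun i k => by
    have := abs_le.1 (hA i k)
    have := abs_le.1 (hA k i)
    exact abs_le.2 ⟨by linarith, by linarith⟩
  refine ⟨vee (Matrix.of fun i k => (1 / 2 : ℝ) * (A i k - A k i)), ?_, ?_⟩
  · refine (vnorm_le_of_abs_le (c := 3 * vnorm (errOm D t (X t))) fun i => ?_).trans (by linarith)
    fin_cases i
    · exact hb 2 1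
    · exact hb 0 2
    · exact hb 1 0
  · simp only [errR_eq]
    refine hasDerivWithinAt_pi.2 fun i => ?_
    fin_cases i
    · exact hd 2 1
    · exact hd 0 2
    · exact hd 1 0

end Attitude

/-- Since q̃ = -μ̃/|μ̃|, one has (q̃ᵀμ̃)q̃ = μ̃. The coupling is therefore q × (μ̃ × q), polynomial
in the data and free of the normalisation. -/
theorem coupling_eq {p : Params} {D : DesiredTrajectory} {t : ℝ} {X : State} {j : Fin 4}
    (h : muD p D t X.toLoadState j ≠ 0) :
    coupling p D t X j = stageCoupling p (stage D t X.toLoadState) X.q j := by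
  have hpos := vnorm_pos h
  have hsq := vnorm_sq (muD p D t X.toLoadState j)
  rw [coupling, stageCoupling, stageMu_stage, errq, hat_mulVec, qD, neg_dotProduct,
    smul_dotProduct, ← hsq, map_neg, LinearMap.neg_apply, map_smul, LinearMap.smul_apply, map_neg,
    map_smul, smul_neg, neg_smul, neg_neg, smul_smul]
  have e : (vnorm (muD p D t X.toLoadState j))⁻¹ • vnorm (muD p D t X.toLoadState j) ^ 2 *
      (vnorm (muD p D t X.toLoadState j))⁻¹ = 1 := by
    rw [smul_eq_mul]; field_simp
  rw [e, one_smul]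

theorem qD_unit {p : Params} {D : DesiredTrajectory} {t : ℝ} {X : LoadState} {j : Fin 4}
    (h : muD p D t X j ≠ 0) : qD p D t X j ⬝ᵥ qD p D t X j = 1 := by
  have hpos := vnorm_pos h
  rw [qD, neg_dotProduct_neg, smul_dotProduct, dotProduct_smul, ← vnorm_sq, smul_eq_mul,
    smul_eq_mul]
  field_simp

theorem qD_dot_stageOmD (p : Params) (D : DesiredTrajectory) (t : ℝ) (X : LoadState)
    (c : RefRates) (q : Dirs) (j : Fin 4) : qD p D t X j ⬝ᵥ stageOmD p (stage D t X) c q j = 0 := by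
  rw [stageOmD, stageMu_stage, qD, neg_dotProduct, smul_dotProduct, dotProduct_smul, dot_self_cross]
  simp

/-- The kinematics of the desired cable directions. -/
theorem hasDerivWithinAt_qD {p : Params} {D : DesiredTrajectory} {I : Set ℝ} {t : ℝ}
    {X : ℝ → LoadState} {q : Dirs} {j : Fin 4}
    (h : HasDerivWithinAt (fun s => loadErr D s (X s)) (loadRate p (stage D t (X t)) q) I t)
    (h0 : muD p D t (X t) j ≠ 0) :
    HasDerivWithinAt (fun s => qD p D s (X s) j)
      (crossProduct (stageOmD p (stage D t (X t)) (D.refRates t) q j) (qD p D t (X t) j)) I t := by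
  have h1 : HasDerivWithinAt (fun s => stage D s (X s))
      (refRate (stage D t (X t)) (D.refRates t), loadRate p (stage D t (X t)) q) I t :=
    (hasDerivAt_refData D t (loadErr D t (X t))).hasDerivWithinAt.prodMk h
  have h2 : HasFDerivAt (fun y => stageMu p y j) (fderiv ℝ (fun y => stageMu p y j)
      (stage D t (X t))) (stage D t (X t)) :=
    ((contDiff_stageMu (n := 1) p j).differentiable one_ne_zero _).hasFDerivAt
  have h3 := HasFDerivAt.comp_hasDerivWithinAt (f := fun s => stage D s (X s)) t h2 h1
  exact hasDerivWithinAt_direction h3 h0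

namespace IsSolution

variable {p : Params} {D : DesiredTrajectory} {I : Set ℝ} {X : ℝ → State}
  {om omD : ℝ → Fin 4 → Vec3} {t : ℝ}

theorem mono {J : Set ℝ} (h : IsSolution p D I X om omD) (hJ : J ⊆ I) :
    IsSolution p D J X om omD where
  R_mem t ht := h.R_mem t (hJ ht)
  q_unit t ht := h.q_unit t (hJ ht)
  om_tangent t ht := h.om_tangent t (hJ ht)
  mu_ne t ht := h.mu_ne t (hJ ht)
  x_deriv t ht := (h.x_deriv t (hJ ht)).mono hJ
  R_deriv t ht i k := (h.R_deriv t (hJ ht) i k).mono hJ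
  q_deriv t ht j := (h.q_deriv t (hJ ht) j).mono hJ
  qD_deriv t ht j := (h.qD_deriv t (hJ ht) j).mono hJ
  omD_tangent t ht := h.omD_tangent t (hJ ht)
  errV_deriv t ht := (h.errV_deriv t (hJ ht)).mono hJ
  errOm_deriv t ht := (h.errOm_deriv t (hJ ht)).mono hJ
  errom_deriv t ht j := (h.errom_deriv t (hJ ht) j).mono hJ

theorem hasDerivWithinAt_errX (h : IsSolution p D I X om omD) (ht : t ∈ I) :
    HasDerivWithinAt (fun s => errX D s (X s).toLoadState) (errV D t (X t).toLoadState) I t :=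
  (h.x_deriv t ht).sub (((D.x_smooth.differentiable (by simp)) t).hasDerivAt.hasDerivWithinAt)

theorem hasDerivWithinAt_errOm (h : IsSolution p D I X om omD) (hJ : p.JL.PosDef) (ht : t ∈ I) :
    HasDerivWithinAt (fun s => errOm D s (X s).toLoadState)
      (loadRate p (stage D t (X t).toLoadState) (X t).q).2.2.2 I t := by
  have hu : IsUnit p.JL.det := hJ.det_pos.ne'.isUnit
  have h1 := hasDerivWithinAt_const_mulVec p.JL⁻¹ (h.errOm_deriv t ht)
  simp only [Matrix.mulVec_mulVec, Matrix.nonsing_inv_mul _ hu, Matrix.one_mulVec] at h1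
  simp only [← Matrix.mulVec_mulVec] at h1
  refine h1.congr_deriv ?_
  simp only [coupling_eq (h.mu_ne t ht _), Matrix.mulVec_mulVec]
  rfl

theorem hasDerivWithinAt_loadErr (h : IsSolution p D I X om omD) (hJ : p.JL.PosDef) (ht : t ∈ I) :
    HasDerivWithinAt (fun s => loadErr D s (X s).toLoadState)
      (loadRate p (stage D t (X t).toLoadState) (X t).q) I t := by
  refine (h.hasDerivWithinAt_errX ht).prodMk (HasDerivWithinAt.prodMk ?_
    (HasDerivWithinAt.prodMk ?_ (h.hasDerivWithinAt_errOm hJ ht)))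
  · refine (h.errV_deriv t ht).congr_deriv ?_
    simp only [coupling_eq (h.mu_ne t ht _)]
    rfl
  · refine hasDerivWithinAt_pi.2 fun i => hasDerivWithinAt_pi.2 fun k => ?_
    refine (h.R_deriv t ht i k).congr_deriv ?_
    have : (X t).Om = errOm D t (X t).toLoadState + OmRel D t (X t).toLoadState := by simp [errOm]
    rw [this]
    rfl

/-- The desired angular velocities of the cables are determined by the state. -/
theorem omD_eq (h : IsSolution p D I X om omD) (hJ : p.JL.PosDef) (ht : t ∈ I)
    (hI : UniqueDiffWithinAt ℝ I t) (j : Fin 4) :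
    omD t j = stageOmD p (stage D t (X t).toLoadState) (D.refRates t) (X t).q j := by
  have h0 := h.mu_ne t ht j
  have e := hI.eq_deriv I (h.qD_deriv t ht j)
    (hasDerivWithinAt_qD (h.hasDerivWithinAt_loadErr hJ ht) h0)
  have hu := qD_unit h0
  have ht' := h.omD_tangent t ht j
  set n := qD p D t (X t).toLoadState j
  set v := stageOmD p (stage D t (X t).toLoadState) (D.refRates t) (X t).q j
  have hn : n ⬝ᵥ v = 0 := qD_dot_stageOmD _ _ _ _ _ _ _
  -- An angular velocity orthogonal to the unit vector `n` is recovered from the velocity x × n it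
  -- induces.
  have key : ∀ x : Vec3, n ⬝ᵥ x = 0 → crossProduct n (crossProduct x n) = x := by
    intro x hx
    have : crossProduct n (crossProduct x n) = (n ⬝ᵥ n) • x - (n ⬝ᵥ x) • n := by
      ext i; fin_cases i <;> simp [cross_apply, dot3] <;> ring
    rw [this, hu, hx]; simp
  rw [← key _ ht', e, key _ hn]

end IsSolution

/-! ### Exponential decay along solutions -/

/-- The size of the total error, with configuration errors in place of direction errors. -/
def errSize (p : Params) (D : DesiredTrajectory) (t : ℝ) (X : State) (z : Fin 4 → Vec3) : ℝ :=
  loadSize D t X.toLoadState + ∑ j, (Psiq p D t X j + vnorm (z j) ^ 2)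

/-- The state lies on the configuration manifold and the desired cable directions are defined. -/
structure Admissible (p : Params) (D : DesiredTrajectory) (t : ℝ) (X : State) : Prop where
  R_mem : X.R ∈ SO3
  q_unit : ∀ j, X.q j ⬝ᵥ X.q j = 1
  mu_ne : ∀ j, muD p D t X.toLoadState j ≠ 0

theorem IsSolution.admissible {p : Params} {D : DesiredTrajectory} {I : Set ℝ} {X : ℝ → State}
    {om omD : ℝ → Fin 4 → Vec3} {t : ℝ} (h : IsSolution p D I X om omD) (ht : t ∈ I) :
    Admissible p D t (X t) := ⟨h.R_mem t ht, h.q_unit t ht, h.mu_ne t ht⟩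

/-- With |e|² = Ψ(2 - Ψ), these three inequalities compare |e|² with Ψ; only Ψ ≤ |e|² requires Ψ ≤
1. -/
theorem le_mul_two_sub {x : ℝ} (h0 : 0 ≤ x) (h1 : x ≤ 1) : x ≤ x * (2 - x) := by nlinarith

theorem mul_two_sub_le_one (x : ℝ) : x * (2 - x) ≤ 1 ^ 2 := by nlinarith [sq_nonneg (x - 1)]

theorem mul_two_sub_le (x : ℝ) : x * (2 - x) ≤ 2 * x := by nlinarith [sq_nonneg x]

theorem norm_Om_le_norm_stage (D : DesiredTrajectory) (t : ℝ) (X : LoadState) :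
    ‖D.Om t‖ ≤ ‖stage D t X‖ := by
  have h1 := norm_fst_le (stage D t X)
  have h2 := norm_snd_le (D.refData t)
  have h3 := norm_snd_le (D.refData t).2
  have h4 := norm_fst_le (D.refData t).2.2
  exact h4.trans (h3.trans (h2.trans h1))

namespace Admissible

variable {p : Params} {D : DesiredTrajectory} {t : ℝ} {X : State}

theorem vnorm_errq_sq (h : Admissible p D t X) (j : Fin 4) :
    vnorm (errq p D t X j) ^ 2 = Psiq p D t X j * (2 - Psiq p D t X j) := by
  rw [vnorm_sq, errq, lagrange_identity, h.q_unit j, qD_unit (h.mu_ne j), Psiq]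
  ring

/-- Ψ(2 - Ψ) is a square, which is impossible for negative Ψ. -/
theorem Psiq_nonneg (h : Admissible p D t X) (j : Fin 4) : 0 ≤ Psiq p D t X j := by
  have h1 := h.vnorm_errq_sq j
  have h2 := sq_nonneg (vnorm (errq p D t X j))
  by_contra! h3
  nlinarith

theorem loadSize_nonneg (h : Admissible p D t X) : 0 ≤ loadSize D t X.toLoadState := by
  have := PsiR_nonneg D t h.R_mem
  unfold loadSize
  positivity

theorem cableSize_nonneg (h : Admissible p D t X) (z : Fin 4 → Vec3) (j : Fin 4) :
    0 ≤ Psiq p D t X j + vnorm (z j) ^ 2 := by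
  have := h.Psiq_nonneg j
  positivity

theorem loadSize_le (h : Admissible p D t X) (z : Fin 4 → Vec3) :
    loadSize D t X.toLoadState ≤ errSize p D t X z :=
  le_add_of_nonneg_right (Finset.sum_nonneg fun j _ => h.cableSize_nonneg z j)

theorem cableSize_le (h : Admissible p D t X) (z : Fin 4 → Vec3) (j : Fin 4) :
    Psiq p D t X j + vnorm (z j) ^ 2 ≤ errSize p D t X z :=
  (Finset.single_le_sum (f := fun j => Psiq p D t X j + vnorm (z j) ^ 2)
    (fun j _ => h.cableSize_nonneg z j) (Finset.mem_univ j)).trans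
    (le_add_of_nonneg_left h.loadSize_nonneg)

theorem Psiq_le (h : Admissible p D t X) (z : Fin 4 → Vec3) (j : Fin 4) :
    Psiq p D t X j ≤ errSize p D t X z := by
  linarith [h.cableSize_le z j, sq_nonneg (vnorm (z j))]

theorem PsiR_le (h : Admissible p D t X) (z : Fin 4 → Vec3) :
    PsiR D t X.toLoadState ≤ errSize p D t X z := by
  have := h.loadSize_le z
  unfold loadSize at this
  linarith [sq_nonneg (vnorm (errX D t X.toLoadState)),
    sq_nonneg (vnorm (errV D t X.toLoadState)), sq_nonneg (vnorm (errOm D t X.toLoadState))]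

theorem vnorm_errX_sq_le (h : Admissible p D t X) (z : Fin 4 → Vec3) :
    vnorm (errX D t X.toLoadState) ^ 2 ≤ errSize p D t X z := by
  have := h.loadSize_le z
  unfold loadSize at this
  linarith [PsiR_nonneg D t h.R_mem,
    sq_nonneg (vnorm (errV D t X.toLoadState)), sq_nonneg (vnorm (errOm D t X.toLoadState))]

theorem vnorm_coupling_le (h : Admissible p D t X) {B : ℝ} {j : Fin 4}
    (hB : vnorm (muD p D t X.toLoadState j) ≤ B) :
    vnorm (coupling p D t X j) ≤ B * vnorm (errq p D t X j) := by
  have h1 : vnorm (X.q j) = 1 := by rw [vnorm, h.q_unit, Real.sqrt_one]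
  have h2 : vnorm (qD p D t X.toLoadState j) = 1 := by
    rw [vnorm, qD_unit (h.mu_ne j), Real.sqrt_one]
  rw [coupling, vnorm_smul]
  refine mul_le_mul ((abs_dot_le _ _).trans (by rwa [h2, one_mul])) ?_ (vnorm_nonneg _)
    ((vnorm_nonneg _).trans hB)
  simpa [h1] using vnorm_hat_mulVec_le (X.q j) (errq p D t X j)

end Admissible

section Decay

variable {p : Params} {D : DesiredTrajectory}

namespace IsSolution

variable {I : Set ℝ} {X : ℝ → State} {om omD : ℝ → Fin 4 → Vec3} {t : ℝ}

theorem hasDerivWithinAt_Psiq (h : IsSolution p D I X om omD) (ht : t ∈ I) (j : Fin 4) :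
    HasDerivWithinAt (fun s => Psiq p D s (X s) j)
      (errq p D t (X t) j ⬝ᵥ errom ((X t).q j) (om t j) (omD t j)) I t := by
  refine ((hasDerivWithinAt_dot (h.qD_deriv t ht j) (h.q_deriv t ht j)).const_sub 1).congr_deriv ?_
  rw [cable_config_rate (h.q_unit t ht j), errq]

theorem hasDerivWithinAt_errq (h : IsSolution p D I X om omD) (ht : t ∈ I) (j : Fin 4) :
    ∃ e', vnorm e' ≤ vnorm (omD t j) * vnorm (errq p D t (X t) j)
        + vnorm (errom ((X t).q j) (om t j) (omD t j)) ∧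
      HasDerivWithinAt (fun s => errq p D s (X s) j) e' I t := by
  refine ⟨_, ?_, hasDerivWithinAt_cross (h.qD_deriv t ht j) (h.q_deriv t ht j)⟩
  rw [cable_error_rate (h.q_unit t ht j) (omD := omD t j)]
  have h1 : vnorm ((X t).q j) = 1 := by rw [vnorm, h.q_unit t ht, Real.sqrt_one]
  have h2 : vnorm (qD p D t (X t).toLoadState j) = 1 := by
    rw [vnorm, qD_unit (h.mu_ne t ht j), Real.sqrt_one]
  refine (vnorm_add_le _ _).trans (add_le_add (vnorm_cross_le _ _) ?_)
  refine (vnorm_cross_le _ _).trans ?_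
  rw [h2, one_mul]
  simpa [h1] using vnorm_cross_le (errom ((X t).q j) (om t j) (omD t j)) ((X t).q j)

theorem matDeriv_R (h : IsSolution p D I X om omD) (ht : t ∈ I) :
    MatDeriv (fun s => (X s).R) ((X t).R * hat (X t).Om) I t := fun i k => h.R_deriv t ht i k

end IsSolution

/-- The total energy with cross terms. -/
def lyap (p : Params) (D : DesiredTrajectory) (ε1 ε2 ε3 N t : ℝ) (X : State)
    (z : Fin 4 → Vec3) : ℝ :=
  (1 / 2 * (errV D t X.toLoadState ⬝ᵥ errV D t X.toLoadState)
    + p.kx / 2 * (errX D t X.toLoadState ⬝ᵥ errX D t X.toLoadState)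
    + ε1 * (errX D t X.toLoadState ⬝ᵥ errV D t X.toLoadState))
  + (p.kR * PsiR D t X.toLoadState
    + 1 / 2 * (errOm D t X.toLoadState ⬝ᵥ p.JL *ᵥ errOm D t X.toLoadState)
    + ε2 * (errR D t X.toLoadState ⬝ᵥ p.JL *ᵥ errOm D t X.toLoadState))
  + N * ∑ j, (p.kq * Psiq p D t X j + 1 / 2 * (z j ⬝ᵥ z j) + ε3 * (errq p D t X j ⬝ᵥ z j))

set_option maxHeartbeats 1600000 in
/-- A Lyapunov function for the error dynamics. -/
theorem exists_lyapunov (hkx : 0 < p.kx) (hkv : 0 < p.kv) (hkR : 0 < p.kR) (hkOm : 0 < p.kOm)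
    (hkq : 0 < p.kq) (hkom : 0 < p.kom) (hJ : p.JL.PosDef) {ρ ν C : ℝ} (hρ : ρ ≤ 1)
    (hν : 0 < ν)
    (hreg : ∀ t, 0 ≤ t → ‖D.refRates t‖ ≤ C ∧
      ∀ X : LoadState, X.R ∈ SO3 → loadSize D t X ≤ ρ →
        ‖stage D t X‖ ≤ C ∧ ∀ j, ν ≤ vnorm (muD p D t X j)) :
    ∃ l > 0, ∃ u > 0, ∃ lam > 0, ∃ V : ℝ → State → (Fin 4 → Vec3) → ℝ,
      (∀ t X z, Admissible p D t X →
        l * errSize p D t X z ≤ V t X z ∧ V t X z ≤ u * errSize p D t X z) ∧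
      ∀ I X om omD, IsSolution p D I X om omD → ∀ t ∈ I, 0 ≤ t → UniqueDiffWithinAt ℝ I t →
        ∃ V', HasDerivWithinAt
            (fun s => V s (X s) fun j => errom ((X s).q j) (om s j) (omD s j)) V' I t ∧
          (errSize p D t (X t) (fun j => errom ((X t).q j) (om t j) (omD t j)) ≤ ρ →
            V' ≤ -(2 * lam) * V t (X t) fun j => errom ((X t).q j) (om t j) (omD t j)) := by
  -- The maximum with 1 admits the unit cable directions into the ball.
  obtain ⟨B, hB0, hB⟩ := exists_mu_omD_bound p (max C 1) hν
  set r0 := ∑ j, vnorm (p.r j)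
  have hr0 : 0 ≤ r0 := Finset.sum_nonneg fun j _ => vnorm_nonneg _
  obtain ⟨ε1, a1, l1, u1, C1, ha1, hl1, hu1, hC1, hs1, hd1⟩ :=
    translational_estimate hkx hkv (show 0 ≤ |1 / p.mL| * B by positivity)
  obtain ⟨ε2, a2, l2, u2, C2, ha2, hl2, hu2, hC2, hs2, hd2⟩ :=
    rotational_estimate ((2 : ℝ) • p.JL - p.JL.trace • (1 : Mat3)) hkR hkOm
      (show 0 ≤ r0 * B by positivity) (show (0 : ℝ) ≤ 6 by norm_num)
      (show 0 ≤ 2 * max C 1 by positivity) hJ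
  obtain ⟨ε3, a3, l3, u3, ha3, hl3, hu3, hs3, hd3⟩ := cable_estimate hkq hkom hB0
  -- By Cauchy–Schwarz over four cables, S² ≤ 4∑|e_q|². This weight gives `N * a3 = 4 * (C1 + C2) +
  -- a3`, so the cables pay for the disturbance of the load and keep the rate `a3`.
  set N := 4 * (C1 + C2) / a3 + 1 with hN
  have hN0 : 0 < N := by positivity
  set l := min (min l1 l2) (N * l3)
  set u := max (max u1 u2) (N * u3)
  set a := min (min a1 a2) a3
  have hl : 0 < l := lt_min (lt_min hl1 hl2) (by positivity)
  have hu : 0 < u := lt_max_of_lt_left (lt_max_of_lt_left hu1)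
  have ha : 0 < a := lt_min (lt_min ha1 ha2) ha3
  have hsand : ∀ t X z, Admissible p D t X → l * errSize p D t X z ≤ lyap p D ε1 ε2 ε3 N t X z ∧
      lyap p D ε1 ε2 ε3 N t X z ≤ u * errSize p D t X z := by
    intro t X z h
    have b1 := hs1 (errX D t X.toLoadState) (errV D t X.toLoadState)
    have b2 := hs2 (PsiR D t X.toLoadState) (errR D t X.toLoadState) (errOm D t X.toLoadState)
      (by rw [vnorm_errR_sq D t h.R_mem]; exact mul_two_sub_le _)
    have b3 := fun j => hs3 (Psiq p D t X j) (errq p D t X j) (z j)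
      (by rw [h.vnorm_errq_sq j]; exact mul_two_sub_le _)
    have b4 := Finset.sum_le_sum fun j (_ : j ∈ Finset.univ) => (b3 j).1
    have b5 := Finset.sum_le_sum fun j (_ : j ∈ Finset.univ) => (b3 j).2
    rw [← Finset.mul_sum] at b4 b5
    have b6 := mul_le_mul_of_nonneg_left b4 hN0.le
    have b7 := mul_le_mul_of_nonneg_left b5 hN0.le
    have n1 : 0 ≤ vnorm (errX D t X.toLoadState) ^ 2 + vnorm (errV D t X.toLoadState) ^ 2 := by
      positivity
    have n2 : 0 ≤ PsiR D t X.toLoadState + vnorm (errOm D t X.toLoadState) ^ 2 :=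
      add_nonneg (PsiR_nonneg D t h.R_mem) (sq_nonneg _)
    have n3 : 0 ≤ ∑ j, (Psiq p D t X j + vnorm (z j) ^ 2) :=
      Finset.sum_nonneg fun j _ => h.cableSize_nonneg z j
    have c1 := mul_le_mul_of_nonneg_right ((min_le_left _ _).trans (min_le_left _ _) : l ≤ l1) n1
    have c2 := mul_le_mul_of_nonneg_right ((min_le_left _ _).trans (min_le_right _ _) : l ≤ l2) n2
    have c3 := mul_le_mul_of_nonneg_right (min_le_right _ _ : l ≤ N * l3) n3
    have c4 := mul_le_mul_of_nonneg_right ((le_max_left _ _).trans (le_max_left _ _) : u1 ≤ u) n1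
    have c5 := mul_le_mul_of_nonneg_right ((le_max_right _ _).trans (le_max_left _ _) : u2 ≤ u) n2
    have c6 := mul_le_mul_of_nonneg_right (le_max_right _ _ : N * u3 ≤ u) n3
    have e : errSize p D t X z = (vnorm (errX D t X.toLoadState) ^ 2
        + vnorm (errV D t X.toLoadState) ^ 2) + (PsiR D t X.toLoadState
        + vnorm (errOm D t X.toLoadState) ^ 2) + ∑ j, (Psiq p D t X j + vnorm (z j) ^ 2) := by
      rw [errSize, loadSize]; ring
    rw [e, lyap]
    constructor <;> linarith [b1.1, b1.2, b2.1, b2.2]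
  refine ⟨l, hl, u, hu, a / (2 * u), by positivity, lyap p D ε1 ε2 ε3 N, hsand, ?_⟩
  intro I X om omD h t ht ht0 hI
  have hadm := h.admissible ht
  set z : ℝ → Fin 4 → Vec3 := fun s j => errom ((X s).q j) (om s j) (omD s j) with hz
  obtain ⟨r', hr'le, hr'⟩ := exists_hasDerivWithinAt_errR (D := D) (X := fun s => (X s).toLoadState)
    hadm.R_mem (h.matDeriv_R ht)
  choose e' he'le he' using fun j => h.hasDerivWithinAt_errq ht j
  have hx' := h.hasDerivWithinAt_errX ht
  have hv' := h.errV_deriv t ht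
  have ho' := h.hasDerivWithinAt_errOm hJ ht
  have hτ := h.errOm_deriv t ht
  have hΨ := hasDerivWithinAt_PsiR (D := D) (X := fun s => (X s).toLoadState)
    hadm.R_mem (h.matDeriv_R ht)
  -- Uniqueness of the derivative identifies `J` times the rate of e_Ω with the prescribed rate of
  -- `J` e_Ω.
  have hJo := hI.eq_deriv I (hasDerivWithinAt_const_mulVec p.JL ho') hτ
  have hz' := fun j => h.errom_deriv t ht j
  have hd := (((((hasDerivWithinAt_dot_self hv').const_mul (1 / 2)).add
      ((hasDerivWithinAt_dot_self hx').const_mul (p.kx / 2))).add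
      ((hasDerivWithinAt_dot hx' hv').const_mul ε1)).add
    (((hΨ.const_mul p.kR).add ((hasDerivWithinAt_dot ho' hτ).const_mul (1 / 2))).add
      ((hasDerivWithinAt_dot hr' hτ).const_mul ε2))).add
    ((HasDerivWithinAt.fun_sum (u := Finset.univ) fun j _ =>
      (((h.hasDerivWithinAt_Psiq ht j).const_mul p.kq).add
        ((hasDerivWithinAt_dot_self (hz' j)).const_mul (1 / 2))).add
        ((hasDerivWithinAt_dot (he' j) (hz' j)).const_mul ε3)).const_mul N)
  refine ⟨_, hd, fun hsize => ?_⟩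
  have hup := (hsand t (X t) (z t) hadm).2
  have hdecay : -(2 * (a / (2 * u))) * lyap p D ε1 ε2 ε3 N t (X t) (z t) ≥
      -a * errSize p D t (X t) (z t) := by
    have := mul_le_mul_of_nonneg_left hup (show 0 ≤ a / u by positivity)
    have e1 : a / u * (u * errSize p D t (X t) (z t)) = a * errSize p D t (X t) (z t) := by
      field_simp
    have e2 : 2 * (a / (2 * u)) = a / u := by field_simp
    rw [neg_mul, e2]
    linarith
  refine le_trans ?_ hdecay
  obtain ⟨hst, hμ⟩ := (hreg t ht0).2 (X t).toLoadState hadm.R_mem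
    ((hadm.loadSize_le (z t)).trans hsize)
  have hq1 : ‖(X t).q‖ ≤ max C 1 := (pi_norm_le_iff_of_nonneg (by positivity)).2 fun j =>
    (norm_le_vnorm _).trans (by rw [vnorm, hadm.q_unit j, Real.sqrt_one]; exact le_max_right _ _)
  have hBj := hB (stage D t (X t).toLoadState) (D.refRates t) (X t).q
    (hst.trans (le_max_left _ _)) ((hreg t ht0).1.trans (le_max_left _ _)) hq1
  have homD : ∀ j, vnorm (omD t j) ≤ B := fun j => by
    rw [h.omD_eq hJ ht hI j]; exact (hBj j).2 (hμ j)
  have hcoup : ∀ j, vnorm (coupling p D t (X t) j) ≤ B * vnorm (errq p D t (X t) j) := fun j =>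
    hadm.vnorm_coupling_le (hBj j).1
  set S := ∑ j, vnorm (errq p D t (X t) j) with hS
  have hS0 : 0 ≤ S := Finset.sum_nonneg fun j _ => vnorm_nonneg _
  have hS2 : S ^ 2 ≤ 4 * ∑ j, vnorm (errq p D t (X t) j) ^ 2 := by
    have := sq_sum_le_card_mul_sum_sq (s := Finset.univ) (f := fun j => vnorm (errq p D t (X t) j))
    simpa using this
  have hcS : ∑ j, vnorm (coupling p D t (X t) j) ≤ B * S := by
    rw [hS, Finset.mul_sum]; exact Finset.sum_le_sum fun j _ => hcoup j
  have hdx : vnorm ((1 / p.mL) • ∑ j, coupling p D t (X t) j) ≤ |1 / p.mL| * B * S := by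
    rw [vnorm_smul, mul_assoc]
    exact mul_le_mul_of_nonneg_left ((vnorm_sum_le _ _).trans hcS) (abs_nonneg _)
  have hdR : vnorm (∑ j, (hat (p.r j) * (X t).Rᵀ) *ᵥ coupling p D t (X t) j) ≤ r0 * B * S := by
    refine (vnorm_sum_le _ _).trans ?_
    rw [mul_assoc]
    refine le_trans (Finset.sum_le_sum fun j _ => ?_)
      ((Finset.mul_sum _ _ _).symm.le.trans (mul_le_mul_of_nonneg_left hcS hr0))
    rw [← Matrix.mulVec_mulVec]
    refine (vnorm_hat_mulVec_le _ _).trans ?_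
    rw [vnorm_SO3_mulVec (SO3_transpose_mem hadm.R_mem)]
    exact mul_le_mul_of_nonneg_right (Finset.single_le_sum (f := fun j => vnorm (p.r j))
      (fun j _ => vnorm_nonneg _) (Finset.mem_univ j)) (vnorm_nonneg _)
  have hw : vnorm (OmRel D t (X t).toLoadState) ≤ 2 * max C 1 := by
    rw [vnorm_OmRel D t hadm.R_mem]
    have h1 := norm_Om_le_norm_stage D t (X t).toLoadState
    linarith [vnorm_le_two_mul_norm (D.Om t), le_max_left C 1]
  have hΨ1 := (hadm.PsiR_le (z t)).trans (hsize.trans hρ)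
  have hΨ0 := PsiR_nonneg D t hadm.R_mem
  have hr2 := vnorm_errR_sq D t hadm.R_mem
  have hrle : vnorm (errR D t (X t).toLoadState) ≤ 1 :=
    vnorm_le_of_sq_le zero_le_one (by rw [← vnorm_sq, hr2]; exact mul_two_sub_le_one _)
  -- Dissipation comes in terms of |e_R|² and |e_q|²; since Ψ ≤ 1 in the region, it dominates the
  -- size measured by Ψ.
  have hrge : PsiR D t (X t).toLoadState ≤ vnorm (errR D t (X t).toLoadState) ^ 2 := by
    rw [hr2]; exact le_mul_two_sub hΨ0 hΨ1
  have hqge : ∀ j, Psiq p D t (X t) j ≤ vnorm (errq p D t (X t) j) ^ 2 := fun j => by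
    have := (hadm.Psiq_le (z t) j).trans (hsize.trans hρ)
    rw [hadm.vnorm_errq_sq j]; exact le_mul_two_sub (hadm.Psiq_nonneg j) this
  have d1 := hd1 (errX D t (X t).toLoadState) (errV D t (X t).toLoadState) _ S hS0 hdx
  have d2 := hd2 (errR D t (X t).toLoadState) r' (errOm D t (X t).toLoadState)
    (OmRel D t (X t).toLoadState) _ S hS0 hdR hrle hr'le hw
  have d3 := fun j => hd3 (errq p D t (X t) j) (e' j) (z t j) ((X t).q j)
    (crossProduct (om t j) ((X t).q j) ⬝ᵥ omD t j)
    (by rw [errq, dotProduct_comm, dot_cross_self]) (errom_dot (hadm.q_unit j) (h.om_tangent t ht j))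
    ((he'le j).trans (add_le_add_left
      (mul_le_mul_of_nonneg_right (homD j) (vnorm_nonneg _)) _))
  have hsym : ∀ y o : Vec3, y ⬝ᵥ p.JL *ᵥ o = o ⬝ᵥ p.JL *ᵥ y := fun y o => by
    have hJt : p.JLᵀ = p.JL := by simpa [Matrix.IsSymm] using hJ.isHermitian
    rw [Matrix.dotProduct_mulVec, ← Matrix.mulVec_transpose, hJt, dotProduct_comm]
  -- Symmetry of the inertia makes the two halves of the derivative of e_Ω·Je_Ω equal.
  rw [hsym (loadRate p _ _).2.2.2, hJo]
  have main : ∀ T1 T2 : ℝ, ∀ T3 : Fin 4 → ℝ,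
      T1 ≤ -a1 * (vnorm (errX D t (X t).toLoadState) ^ 2 + vnorm (errV D t (X t).toLoadState) ^ 2)
        + C1 * S ^ 2 →
      T2 ≤ -a2 * (vnorm (errR D t (X t).toLoadState) ^ 2
        + vnorm (errOm D t (X t).toLoadState) ^ 2) + C2 * S ^ 2 →
      (∀ j, T3 j ≤ -a3 * (vnorm (errq p D t (X t) j) ^ 2 + vnorm (z t j) ^ 2)) →
      T1 + T2 + N * ∑ j, T3 j ≤ -a * errSize p D t (X t) (z t) := by
    intro T1 T2 T3 k1 k2 k3
    have k4 := Finset.sum_le_sum fun j (_ : j ∈ Finset.univ) => k3 j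
    rw [← Finset.mul_sum] at k4
    have k5 := mul_le_mul_of_nonneg_left k4 hN0.le
    have hle : ∑ j, vnorm (errq p D t (X t) j) ^ 2 ≤
        ∑ j, (vnorm (errq p D t (X t) j) ^ 2 + vnorm (z t j) ^ 2) :=
      Finset.sum_le_sum fun j _ => le_add_of_nonneg_right (sq_nonneg _)
    have hge : ∑ j, (Psiq p D t (X t) j + vnorm (z t j) ^ 2) ≤
        ∑ j, (vnorm (errq p D t (X t) j) ^ 2 + vnorm (z t j) ^ 2) :=
      Finset.sum_le_sum fun j _ => add_le_add_left (hqge j) _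
    have hNa : N * a3 = 4 * (C1 + C2) + a3 := by rw [hN]; field_simp
    set Q := ∑ j, (vnorm (errq p D t (X t) j) ^ 2 + vnorm (z t j) ^ 2)
    set P := ∑ j, (Psiq p D t (X t) j + vnorm (z t j) ^ 2)
    have k6 : N * (-a3 * Q) = -(4 * (C1 + C2)) * Q - a3 * Q := by linear_combination -Q * hNa
    have k7 := mul_le_mul_of_nonneg_left (hS2.trans
      (mul_le_mul_of_nonneg_left hle (by norm_num))) (add_nonneg hC1 hC2)
    have n1 : 0 ≤ vnorm (errX D t (X t).toLoadState) ^ 2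
        + vnorm (errV D t (X t).toLoadState) ^ 2 := by positivity
    have n2 : 0 ≤ vnorm (errR D t (X t).toLoadState) ^ 2
        + vnorm (errOm D t (X t).toLoadState) ^ 2 := by positivity
    have n3 : 0 ≤ Q := Finset.sum_nonneg fun j _ => by positivity
    have c1 := mul_le_mul_of_nonneg_right ((min_le_left _ _).trans (min_le_left _ _) : a ≤ a1) n1
    have c2 := mul_le_mul_of_nonneg_right ((min_le_left _ _).trans (min_le_right _ _) : a ≤ a2) n2
    have c3 := mul_le_mul_of_nonneg_right (min_le_right _ _ : a ≤ a3) n3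
    have c4 := mul_le_mul_of_nonneg_left hge ha.le
    have c5 := mul_le_mul_of_nonneg_left hrge ha.le
    have e : errSize p D t (X t) (z t) = vnorm (errX D t (X t).toLoadState) ^ 2
        + vnorm (errV D t (X t).toLoadState) ^ 2 + PsiR D t (X t).toLoadState
        + vnorm (errOm D t (X t).toLoadState) ^ 2 + P := by rw [errSize, loadSize]
    rw [e]
    linarith
  refine main _ _ _ (le_trans (le_of_eq ?_) d1) (le_trans (le_of_eq ?_) d2)
    fun j => le_trans (le_of_eq ?_) (d3 j)
  · ring
  · ring
  · simp only [hz]; ring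

/-- Uniform exponential decay of small errors along solutions. -/
theorem exists_decay (hkx : 0 < p.kx) (hkv : 0 < p.kv) (hkR : 0 < p.kR) (hkOm : 0 < p.kOm)
    (hkq : 0 < p.kq) (hkom : 0 < p.kom) (hJ : p.JL.PosDef) {ρ ν C : ℝ} (hρ0 : 0 < ρ) (hρ : ρ ≤ 1)
    (hν : 0 < ν)
    (hreg : ∀ t, 0 ≤ t → ‖D.refRates t‖ ≤ C ∧
      ∀ X : LoadState, X.R ∈ SO3 → loadSize D t X ≤ ρ →
        ‖stage D t X‖ ≤ C ∧ ∀ j, ν ≤ vnorm (muD p D t X j)) :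
    ∃ κ > 0, ∃ K > 0, ∃ lam > 0, ∀ t0 T X om omD, 0 ≤ t0 → t0 < T →
      IsSolution p D (Set.Ico t0 T) X om omD →
      errSize p D t0 (X t0) (fun j => errom ((X t0).q j) (om t0 j) (omD t0 j)) < κ →
      ∀ t ∈ Set.Ico t0 T,
        errSize p D t (X t) (fun j => errom ((X t).q j) (om t j) (omD t j)) ≤
          K * errSize p D t0 (X t0) (fun j => errom ((X t0).q j) (om t0 j) (omD t0 j)) *
            Real.exp (-lam * (t - t0)) := by
  obtain ⟨l, hl, u, hu, lam, hlam, V, hV, hV'⟩ :=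
    exists_lyapunov hkx hkv hkR hkOm hkq hkom hJ hρ hν hreg
  -- An initial size below `l * ρ / u` puts `V` below `l * ρ`, and this sublevel set lies in the
  -- region of size at most `ρ` where the decay inequality holds.
  refine ⟨l * ρ / u, by positivity, u / l, by positivity, lam, hlam, ?_⟩
  intro t0 T X om omD ht0 hT h hsmall
  set z : ℝ → Fin 4 → Vec3 := fun s j => errom ((X s).q j) (om s j) (omD s j)
  have hb := fun t (ht : t ∈ Set.Ico t0 T) => hV t (X t) (z t) (h.admissible ht)
  have hnn : ∀ t ∈ Set.Ico t0 T, 0 ≤ errSize p D t (X t) (z t) := fun t ht =>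
    (h.admissible ht).loadSize_nonneg.trans ((h.admissible ht).loadSize_le _)
  have h00 : t0 ∈ Set.Ico t0 T := ⟨le_rfl, hT⟩
  have hd : ∀ t, ∃ V'', t ∈ Set.Ico t0 T → HasDerivWithinAt (fun s => V s (X s) (z s)) V''
      (Set.Ico t0 T) t ∧ (errSize p D t (X t) (z t) ≤ ρ → V'' ≤ -(2 * lam) * V t (X t) (z t)) := by
    intro t
    by_cases ht : t ∈ Set.Ico t0 T
    · obtain ⟨V'', hV''⟩ := hV' _ X om omD h t ht (ht0.trans ht.1) (uniqueDiffOn_Ico t0 T t ht)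
      exact ⟨V'', fun _ => hV''⟩
    · exact ⟨0, fun ht' => absurd ht' ht⟩
  choose V'' hV'' using hd
  have hdec := le_exp_of_deriv_le (V := fun s => V s (X s) (z s)) (V' := V'') (v := l * ρ) hlam
    ((mul_nonneg hl.le (hnn t0 h00)).trans (hb t0 h00).1)
    ((hb t0 h00).2.trans_lt (by rwa [lt_div_iff₀ hu, mul_comm] at hsmall))
    (fun t ht => (hV'' t ht).1) (fun t ht hlt => (hV'' t ht).2
      (le_of_mul_le_mul_left ((hb t ht).1.trans hlt.le) hl))
  intro t ht
  have h1 := (hb t ht).1.trans (hdec t ht)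
  have h2 := mul_le_mul_of_nonneg_right (hb t0 h00).2 (Real.exp_pos (-lam * (t - t0))).le
  have h3 := h1.trans h2
  rw [div_mul_eq_mul_div, div_mul_eq_mul_div, le_div_iff₀ hl, mul_comm _ l]
  exact h3

end Decay

/-! ### Global solutions of bounded Lipschitz equations -/

-- The uniform bound `L` confines solutions on an interval of radius `n + 1` to a ball of radius `L
-- * (n + 1)`, so Picard–Lindelöf covers the whole interval at once. Uniqueness glues the pieces.
open scoped NNReal in
theorem exists_global_solution {E : Type*} [NormedAddCommGroup E] [NormedSpace ℝ E]
    [CompleteSpace E] {f : ℝ → E → E} {K L : ℝ≥0} (hf : ∀ t, LipschitzWith K (f t))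
    (hc : ∀ y, Continuous fun t => f t y) (hb : ∀ t y, ‖f t y‖ ≤ L) (t0 : ℝ) (y0 : E) :
    ∃ y : ℝ → E, y t0 = y0 ∧ ∀ t, HasDerivAt y (f t (y t)) t := by
  have hloc : ∀ n : ℕ, ∃ y : ℝ → E, y t0 = y0 ∧
      ∀ t ∈ Set.Ioo (t0 - (n + 1)) (t0 + (n + 1)), HasDerivAt y (f t (y t)) t := by
    intro n
    have hmem : t0 ∈ Set.Icc (t0 - (n + 1)) (t0 + (n + 1)) :=
      ⟨by linarith [n.cast_nonneg (α := ℝ)], by linarith [n.cast_nonneg (α := ℝ)]⟩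
    have hpl : IsPicardLindelof f (⟨t0, hmem⟩ : Set.Icc (t0 - (n + 1)) (t0 + (n + 1))) y0
        (L * (n + 1)) 0 L K :=
      { lipschitzOnWith := fun t _ => (hf t).lipschitzOnWith
        continuousOn := fun y _ => (hc y).continuousOn
        norm_le := fun t _ y _ => hb t y
        mul_max_le := by simp }
    obtain ⟨y, hy0, hy⟩ := hpl.exists_eq_forall_mem_Icc_hasDerivWithinAt₀
    exact ⟨y, hy0, fun t ht => (hy t (Set.Ioo_subset_Icc_self ht)).hasDerivAt
      (Icc_mem_nhds ht.1 ht.2)⟩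
  choose y hy0 hy using hloc
  have hagree : ∀ m n : ℕ, m ≤ n → ∀ s ∈ Set.Ioo (t0 - (m + 1)) (t0 + (m + 1)),
      y m s = y n s := by
    intro m n hmn s hs
    have hmn' : (m : ℝ) ≤ n := by exact_mod_cast hmn
    have h0 : t0 ∈ Set.Ioo (t0 - (m + 1)) (t0 + (m + 1)) :=
      ⟨by linarith [m.cast_nonneg (α := ℝ)], by linarith [m.cast_nonneg (α := ℝ)]⟩
    exact ODE_solution_unique_of_mem_Ioo (s := fun _ => Set.univ) (K := K)
      (fun t _ => (hf t).lipschitzOnWith) h0 (fun t ht => ⟨hy m t ht, trivial⟩)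
      (fun t ht => ⟨hy n t ⟨by linarith [ht.1], by linarith [ht.2]⟩, trivial⟩)
      ((hy0 m).trans (hy0 n).symm) hs
  -- The `+ 1` in the radii makes `t` an interior point of the interval with index `⌈|t - t0|⌉₊`.
  refine ⟨fun t => y ⌈|t - t0|⌉₊ t, hy0 _, fun t => ?_⟩
  set n := ⌈|t - t0|⌉₊
  have hmem : ∀ s : ℝ, ∀ k : ℕ, |s - t0| < k + 1 →
      s ∈ Set.Ioo (t0 - (k + 1)) (t0 + (k + 1)) := fun s k h => by
    have := abs_lt.1 h
    exact ⟨by linarith, by linarith⟩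
  have hn : ∀ s : ℝ, |s - t0| < ⌈|s - t0|⌉₊ + 1 := fun s => by linarith [Nat.le_ceil |s - t0|]
  have hev : (fun s => y ⌈|s - t0|⌉₊ s) =ᶠ[nhds t] y n := by
    filter_upwards [Ioo_mem_nhds (hmem t n (hn t)).1 (hmem t n (hn t)).2] with s hs
    rcases le_total ⌈|s - t0|⌉₊ n with h | h
    · exact hagree _ _ h s (hmem s _ (hn s))
    · exact (hagree _ _ h s hs).symm
  exact (hy n t (hmem t n (hn t))).congr_of_eventuallyEq hev

-- The closed support, not merely the support, must lie in `U`: the product with a field smooth only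
-- on `U` is then smooth everywhere. An intermediate compact set provides this.
open scoped Manifold in
theorem exists_cutoff {E : Type*} [NormedAddCommGroup E] [NormedSpace ℝ E] [FiniteDimensional ℝ E]
    {K U : Set E} (hK : IsCompact K) (hU : IsOpen U) (hKU : K ⊆ U) :
    ∃ χ : E → ℝ, ContDiff ℝ ∞ χ ∧ HasCompactSupport χ ∧ tsupport χ ⊆ U ∧ ∀ x ∈ K, χ x = 1 := by
  obtain ⟨L, hL, hKL, hLU⟩ := exists_compact_between hK hU hKU
  obtain ⟨χ, hχ, -, hs, h1⟩ := exists_contMDiff_support_eq_eq_one_iff (n := ⊤) 𝓘(ℝ, E)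
    isOpen_interior hK.isClosed hKL
  have hts : tsupport χ ⊆ L := by
    rw [tsupport, hs]; exact closure_minimal interior_subset hL.isClosed
  exact ⟨χ, contMDiff_iff_contDiff.1 hχ, hL.of_isClosed_subset (isClosed_tsupport χ) hts,
    hts.trans hLU, fun x hx => (h1 x).1 hx⟩

/-! ### The error dynamics as an ordinary differential equation -/

/-- Load errors, directions and angular velocity errors of the cables. -/
abbrev Total := LoadErr × Dirs × Dirs

/-- All the data of the desired motion. -/
abbrev RefAll := RefData × RefRates

section Field

variable (p : Params)

/-- Angular velocity of a cable in terms of the errors. -/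
def fieldOm (w : RefAll × Total) (j : Fin 4) : Vec3 :=
  w.2.2.2 j - (hat (w.2.2.1 j) * hat (w.2.2.1 j)) *ᵥ
    stageOmD p (w.1.1, w.2.1) w.1.2 w.2.2.1 j

/-- The rate of a cable direction. -/
def fieldDir (w : RefAll × Total) (j : Fin 4) : Vec3 :=
  crossProduct (fieldOm p w j) (w.2.2.1 j)

/-- The rate of an angular velocity error; the term with the factor `z ⬝ᵥ q` vanishes for errors
`z` tangent to the sphere. -/
def fieldOmErr (w : RefAll × Total) (j : Fin 4) : Vec3 :=
  (fieldDir p w j ⬝ᵥ stageOmD p (w.1.1, w.2.1) w.1.2 w.2.2.1 j) • w.2.2.1 j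
    - p.kom • w.2.2.2 j + (p.kom * (w.2.2.2 j ⬝ᵥ w.2.2.1 j)) • w.2.2.1 j
    - p.kq • crossProduct (stageDir p (w.1.1, w.2.1) j) (w.2.2.1 j)

/-- The vector field of the error dynamics. -/
def field (w : RefAll × Total) : Total :=
  (loadRate p (w.1.1, w.2.1) w.2.2.1, fieldDir p w, fieldOmErr p w)

/-- The set where the desired cable directions are defined. -/
def regularSet : Set (RefAll × Total) := {w | ∀ j, stageMu p (w.1.1, w.2.1) j ≠ 0}

theorem contDiffAt_field {w : RefAll × Total} (hw : w ∈ regularSet p) :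
    ContDiffAt ℝ ∞ (field p) w := by
  have hid : ContDiffAt ℝ ∞ (fun w : RefAll × Total => w) w := contDiffAt_id
  have hζ : ContDiffAt ℝ ∞ (fun w : RefAll × Total => ((w.1.1, w.2.1) : Stage)) w :=
    hid.fst.fst.prodMk hid.snd.fst
  have hc : ContDiffAt ℝ ∞ (fun w : RefAll × Total => w.1.2) w := hid.fst.snd
  have hq : ContDiffAt ℝ ∞ (fun w : RefAll × Total => w.2.2.1) w := hid.snd.snd.fst
  have hqj := contDiffAt_pi.1 hq
  have hzj := contDiffAt_pi.1 (hid.snd.snd.snd : ContDiffAt ℝ ∞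
    (fun w : RefAll × Total => w.2.2.2) w)
  have hO := fun j => contDiffAt_stageOmD p hζ hc hq j (hw j)
  have hom : ∀ j, ContDiffAt ℝ ∞ (fun w => fieldOm p w j) w := fun j =>
    (hzj j).sub (((matSmooth_hat (hqj j)).mul (matSmooth_hat (hqj j))).mulVec (hO j))
  have hdir : ∀ j, ContDiffAt ℝ ∞ (fun w => fieldDir p w j) w := fun j =>
    contDiffAt_cross (hom j) (hqj j)
  have h1 : ∀ j, ContDiffAt ℝ ∞ (fun w : RefAll × Total => (fieldDir p w j ⬝ᵥ
      stageOmD p (w.1.1, w.2.1) w.1.2 w.2.2.1 j) • w.2.2.1 j) w := fun j =>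
    (contDiffAt_dot (hdir j) (hO j)).smul (hqj j)
  have h2 : ∀ j, ContDiffAt ℝ ∞ (fun w : RefAll × Total =>
      (p.kom * (w.2.2.2 j ⬝ᵥ w.2.2.1 j)) • w.2.2.1 j) w := fun j =>
    (contDiffAt_const.mul (contDiffAt_dot (hzj j) (hqj j))).smul (hqj j)
  have herr : ∀ j, ContDiffAt ℝ ∞ (fun w => fieldOmErr p w j) w := fun j =>
    (((h1 j).sub (contDiffAt_csmul _ (hzj j))).add (h2 j)).sub
      (contDiffAt_csmul _ (contDiffAt_cross (contDiffAt_stageDir p hζ j (hw j)) (hqj j)))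
  exact (contDiffAt_loadRate p hζ hq).prodMk
    ((contDiffAt_pi.2 hdir).prodMk (contDiffAt_pi.2 herr))

theorem isOpen_regularSet : IsOpen (regularSet p) := by
  have h : regularSet p = ⋂ j, {w | stageMu p (w.1.1, w.2.1) j ≠ 0} := by
    ext w; simp [regularSet]
  rw [h]
  refine isOpen_iInter_of_finite fun j => isOpen_ne_fun ?_ continuous_const
  exact (continuous_stageMu p j).comp
    (((continuous_fst.comp continuous_fst).prodMk (continuous_fst.comp continuous_snd)) :
      Continuous fun w : RefAll × Total => ((w.1.1, w.2.1) : Stage))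

/-- A global solution of the error dynamics cut off outside of a compact set. -/
theorem exists_cutoff_solution {θ : ℝ → RefAll} (hθ : Continuous θ) (C ν : ℝ) (hν : 0 < ν)
    (t0 : ℝ) (y0 : Total) :
    ∃ (y : ℝ → Total) (χ : ℝ → ℝ), y t0 = y0 ∧
      (∀ t, HasDerivAt y (χ t • field p (θ t, y t)) t) ∧
      ∀ t, ‖(θ t, y t)‖ ≤ C → (∀ j, ν ≤ vnorm (stageMu p ((θ t).1, (y t).1) j)) → χ t = 1 := by
  set K : Set (RefAll × Total) := Metric.closedBall 0 C ∩
    ⋂ j, {w | ν ≤ vnorm (stageMu p (w.1.1, w.2.1) j)} with hKdef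
  have hK : IsCompact K := by
    refine (isCompact_closedBall _ _).inter_right (isClosed_iInter fun j =>
      isClosed_le continuous_const (continuous_vnorm.comp ?_))
    exact (continuous_stageMu p j).comp
      (((continuous_fst.comp continuous_fst).prodMk (continuous_fst.comp continuous_snd)) :
        Continuous fun w : RefAll × Total => ((w.1.1, w.2.1) : Stage))
  have hKU : K ⊆ regularSet p := by
    intro w hw j h0
    have := Set.mem_iInter.1 hw.2 j
    simp only [Set.mem_ofPred_eq, h0, vnorm_zero] at this
    linarith
  obtain ⟨χ, hχ, hχc, hχs, hχ1⟩ := exists_cutoff hK (isOpen_regularSet p) hKU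
  set H : RefAll × Total → Total := fun w => χ w • field p w with hH
  have hts : tsupport H ⊆ tsupport χ := tsupport_smul_subset_left χ (field p)
  have hHc : HasCompactSupport H := hχc.of_isClosed_subset (isClosed_tsupport H) hts
  have hHs : ContDiff ℝ ∞ H := by
    refine contDiff_iff_contDiffAt.2 fun w => ?_
    by_cases hw : w ∈ tsupport H
    · exact hχ.contDiffAt.smul (contDiffAt_field p (hχs (hts hw)))
    · exact contDiffAt_const.congr_of_eventuallyEq (notMem_tsupport_iff_eventuallyEq.1 hw)
  obtain ⟨A, hA⟩ := hHs.lipschitzWith_of_hasCompactSupport hHc (by simp)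
  obtain ⟨L, hL⟩ := hHc.exists_bound_of_continuous hHs.continuous
  obtain ⟨y, hy0, hy⟩ := exists_global_solution (f := fun t y => H (θ t, y)) (K := A)
    (L := L.toNNReal)
    (fun t => LipschitzWith.of_dist_le_mul fun a b => by
      simpa only [dist_prod_same_left] using hA.dist_le_mul (θ t, a) (θ t, b))
    (fun y => hHs.continuous.comp (hθ.prodMk continuous_const))
    (fun t y => (hL _).trans (Real.le_coe_toNNReal L)) t0 y0
  -- Recording the cutoff as a scalar factor along the trajectory shows that the rate is always a
  -- multiple of the true field.
  refine ⟨y, fun t => χ (θ t, y t), hy0, hy, fun t h1 h2 => hχ1 _ ⟨?_, Set.mem_iInter.2 h2⟩⟩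
  simpa using h1

end Field

/-! ### From the ordinary differential equation to the error dynamics -/

theorem eq_of_hasDerivAt_zero {f : ℝ → ℝ} (h : ∀ t, HasDerivAt f 0 t) (s t : ℝ) : f s = f t :=
  is_const_of_deriv_eq_zero (fun t => (h t).differentiableAt) (fun t => (h t).deriv) s t

/-- The state with given errors. -/
def toState (D : DesiredTrajectory) (t : ℝ) (y : Total) : State where
  x := y.1.1 + D.x t
  v := y.1.2.1 + deriv D.x t
  R := Stage.R (D.refData t, y.1)
  Om := y.1.2.2.2 + Stage.w (D.refData t, y.1)
  q := y.2.1

theorem loadErr_toState (D : DesiredTrajectory) (t : ℝ) (y : Total) :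
    loadErr D t (toState D t y).toLoadState = y.1 := by
  have h1 : errX D t (toState D t y).toLoadState = y.1.1 := add_sub_cancel_right _ _
  have h2 : errV D t (toState D t y).toLoadState = y.1.2.1 := add_sub_cancel_right _ _
  have h3 : errOm D t (toState D t y).toLoadState = y.1.2.2.2 := add_sub_cancel_right _ _
  rw [loadErr, h1, h2, h3]
  rfl

theorem stage_toState (D : DesiredTrajectory) (t : ℝ) (y : Total) :
    stage D t (toState D t y).toLoadState = (D.refData t, y.1) := by
  rw [stage, loadErr_toState]

/-- The desired motion and its derivatives. -/
def DesiredTrajectory.refAll (D : DesiredTrajectory) (t : ℝ) : RefAll := (D.refData t, D.refRates t)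

/-! ### Constraints preserved by the cut-off flow -/

section Invariants

variable {p : Params} {D : DesiredTrajectory} {y : ℝ → Total} {χ : ℝ → ℝ}

theorem hasDerivAt_dir (hy : ∀ t, HasDerivAt y (χ t • field p (D.refAll t, y t)) t) (t : ℝ)
    (j : Fin 4) :
    HasDerivAt (fun s => (y s).2.1 j) (χ t • fieldDir p (D.refAll t, y t) j) t :=
  hasDerivAt_pi.1 (hy t).snd.fst j

theorem hasDerivAt_omErr (hy : ∀ t, HasDerivAt y (χ t • field p (D.refAll t, y t)) t) (t : ℝ)
    (j : Fin 4) :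
    HasDerivAt (fun s => (y s).2.2 j) (χ t • fieldOmErr p (D.refAll t, y t) j) t :=
  hasDerivAt_pi.1 (hy t).snd.snd j

/-- The field is tangent to the constraint, and a scalar factor does not change this, so the
constraint persists even where the cutoff acts. -/
theorem q_unit_of_field (hy : ∀ t, HasDerivAt y (χ t • field p (D.refAll t, y t)) t) {t0 : ℝ}
    (j : Fin 4) (h0 : (y t0).2.1 j ⬝ᵥ (y t0).2.1 j = 1) (t : ℝ) :
    (y t).2.1 j ⬝ᵥ (y t).2.1 j = 1 := by
  rw [← h0]
  refine eq_of_hasDerivAt_zero (f := fun t => (y t).2.1 j ⬝ᵥ (y t).2.1 j) (fun t => ?_) t t0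
  have h := (hasDerivAt_dir hy t j).hasDerivWithinAt (s := Set.univ)
  refine ((hasDerivWithinAt_dot_self h).hasDerivAt Filter.univ_mem).congr_deriv ?_
  rw [dotProduct_smul, fieldDir, dot_cross_self]
  simp

/-- The added multiple of q in `fieldOmErr` cancels the damping in the direction of q. What remains
of (q·z)' is q'·(z + ω̃), and it vanishes because q' = (z + ω̃) × q. -/
theorem omErr_tangent_of_field (hy : ∀ t, HasDerivAt y (χ t • field p (D.refAll t, y t)) t) {t0 : ℝ}
    (j : Fin 4) (hq : ∀ t, (y t).2.1 j ⬝ᵥ (y t).2.1 j = 1)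
    (h0 : (y t0).2.1 j ⬝ᵥ (y t0).2.2 j = 0) (t : ℝ) : (y t).2.1 j ⬝ᵥ (y t).2.2 j = 0 := by
  rw [← h0]
  refine eq_of_hasDerivAt_zero (f := fun t => (y t).2.1 j ⬝ᵥ (y t).2.2 j) (fun t => ?_) t t0
  have h1 := (hasDerivAt_dir hy t j).hasDerivWithinAt (s := Set.univ)
  have h2 := (hasDerivAt_omErr hy t j).hasDerivWithinAt (s := Set.univ)
  refine ((hasDerivWithinAt_dot h1 h2).hasDerivAt Filter.univ_mem).congr_deriv ?_
  have hq := hq t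
  rw [fieldOmErr, fieldDir, fieldOm]
  change _ ⬝ᵥ (y t).2.2 j + (y t).2.1 j ⬝ᵥ _ = 0
  simp only [hat_sq_mulVec]
  set q := (y t).2.1 j
  set z := (y t).2.2 j
  set η := stageOmD p ((D.refAll t).1, (y t).1) (D.refAll t).2 (y t).2.1 j
  set n := stageDir p ((D.refAll t).1, (y t).1) j
  rw [hq, one_smul]
  have e : crossProduct (z - ((q ⬝ᵥ η) • q - η)) q = crossProduct (z + η) q := by
    ext i; fin_cases i <;> simp [cross_apply] <;> ring
  rw [e]
  simp only [dotProduct_smul, smul_dotProduct, dotProduct_add, dotProduct_sub, hq, dot_cross_self,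
    smul_eq_mul, dotProduct_comm z q]
  have e2 : crossProduct (z + η) q ⬝ᵥ z + crossProduct (z + η) q ⬝ᵥ η = 0 := by
    rw [← dotProduct_add, dotProduct_comm, dot_self_cross]
  linear_combination χ t * e2

/-- `R * Rᵀ` is constant since hat matrices are skew; the determinant is then ±1 and continuous, so
it cannot leave 1. -/
theorem R_mem_of_field (hy : ∀ t, HasDerivAt y (χ t • field p (D.refAll t, y t)) t) {t0 : ℝ}
    (h0 : Stage.R (D.refData t0, (y t0).1) ∈ SO3) (t : ℝ) :
    Stage.R (D.refData t, (y t).1) ∈ SO3 := by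
  set R : ℝ → Mat3 := fun s => Stage.R (D.refData s, (y s).1) with hRdef
  have hR : ∀ t, MatDeriv R (χ t • (R t * hat ((y t).1.2.2.2
      + Stage.w (D.refData t, (y t).1)))) Set.univ t := fun t i k =>
    (hasDerivAt_pi.1 (hasDerivAt_pi.1 (hy t).fst.snd.snd.fst i) k).hasDerivWithinAt
  have hRR : ∀ t, R t * (R t)ᵀ = 1 := by
    intro t
    rw [← SO3_mul_transpose_self h0]
    ext i k
    refine eq_of_hasDerivAt_zero (f := fun t => (R t * (R t)ᵀ) i k) (fun t => ?_) t t0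
    refine (((hR t).mul (hR t).transpose i k).hasDerivAt Filter.univ_mem).congr_deriv ?_
    have : χ t • (R t * hat ((y t).1.2.2.2 + Stage.w (D.refData t, (y t).1))) * (R t)ᵀ + R t *
        (χ t • (R t * hat ((y t).1.2.2.2 + Stage.w (D.refData t, (y t).1))))ᵀ = 0 := by
      rw [Matrix.transpose_smul, Matrix.transpose_mul, hat_transpose]
      simp [mul_assoc]
    rw [this, Matrix.zero_apply]
  have hdet : ∀ t, (R t).det * (R t).det = 1 := fun t => by
    have := congrArg Matrix.det (hRR t)
    rwa [Matrix.det_mul, Matrix.det_transpose, Matrix.det_one] at this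
  have hcont : Continuous fun t => (R t).det := by
    have hc : ∀ i k, Continuous fun t => R t i k := fun i k =>
      continuous_iff_continuousAt.2 fun t =>
        ((hR t i k).hasDerivAt Filter.univ_mem).continuousAt
    simp only [Matrix.det_fin_three]
    fun_prop
  refine mem_SO3_of (hRR t) ?_
  by_contra hne
  have hm1 : (R t).det = -1 := (mul_self_eq_one_iff.1 (hdet t)).resolve_left hne
  have h1 : (R t0).det = 1 := (Matrix.mem_specialOrthogonalGroup_iff.1 h0).2
  obtain ⟨s, hs⟩ := mem_range_of_exists_le_of_exists_ge hcont
    ⟨t, by rw [hm1]; norm_num⟩ ⟨t0, by rw [h1]; norm_num⟩ (c := 0)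
  have := hdet s
  simp only at hs
  rw [hs] at this
  norm_num at this

end Invariants

theorem errom_fieldOm (p : Params) (D : DesiredTrajectory) (t : ℝ) (y : Total) (j : Fin 4) :
    errom (y.2.1 j) (fieldOm p (D.refAll t, y) j)
      (stageOmD p (D.refData t, y.1) (D.refRates t) y.2.1 j) = y.2.2 j :=
  sub_add_cancel _ _

/-- Solutions of the ordinary differential equation are solutions of the error dynamics. -/
theorem isSolution_of_field {p : Params} {D : DesiredTrajectory} {y : ℝ → Total} {χ : ℝ → ℝ}
    (hJ : p.JL.PosDef) (hy : ∀ t, HasDerivAt y (χ t • field p (D.refAll t, y t)) t)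
    (hR : ∀ t, Stage.R (D.refData t, (y t).1) ∈ SO3)
    (hq : ∀ t j, (y t).2.1 j ⬝ᵥ (y t).2.1 j = 1)
    (hz : ∀ t j, (y t).2.1 j ⬝ᵥ (y t).2.2 j = 0) {I : Set ℝ} (hχ : ∀ t ∈ I, χ t = 1)
    (hmu : ∀ t ∈ I, ∀ j, stageMu p (D.refData t, (y t).1) j ≠ 0) :
    IsSolution p D I (fun t => toState D t (y t)) (fun t => fieldOm p (D.refAll t, y t))
      (fun t j => stageOmD p (D.refData t, (y t).1) (D.refRates t) (y t).2.1 j) := by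
  have hd : ∀ t ∈ I, HasDerivWithinAt y (field p (D.refAll t, y t)) I t := fun t ht => by
    simpa [hχ t ht] using (hy t).hasDerivWithinAt (s := I)
  have hmu' : ∀ t ∈ I, ∀ j, muD p D t (toState D t (y t)).toLoadState j ≠ 0 := fun t ht j => by
    rw [← stageMu_stage, stage_toState]; exact hmu t ht j
  have hl : ∀ t ∈ I, HasDerivWithinAt (fun s => loadErr D s (toState D s (y s)).toLoadState)
      (loadRate p (stage D t (toState D t (y t)).toLoadState) (y t).2.1) I t := fun t ht => by
    simp only [loadErr_toState, stage_toState]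
    exact (hd t ht).fst
  have hcoup : ∀ t ∈ I, ∀ j, coupling p D t (toState D t (y t)) j =
      stageCoupling p (stage D t (toState D t (y t)).toLoadState) (y t).2.1 j := fun t ht j =>
    coupling_eq (hmu' t ht j)
  have herr := fun t j => errom_fieldOm p D t (y t) j
  refine
    { R_mem := fun t _ => hR t
      q_unit := fun t _ => hq t
      om_tangent := fun t _ j => ?_
      mu_ne := hmu'
      x_deriv := fun t ht => ?_
      R_deriv := fun t ht i k =>
        hasDerivWithinAt_pi.1 (hasDerivWithinAt_pi.1 (hd t ht).fst.snd.snd.fst i) k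
      q_deriv := fun t ht j => hasDerivWithinAt_pi.1 (hd t ht).snd.fst j
      qD_deriv := fun t ht j => ?_
      omD_tangent := fun t ht j => ?_
      errV_deriv := fun t ht => ?_
      errOm_deriv := fun t ht => ?_
      errom_deriv := fun t ht j => ?_ }
  · change (y t).2.1 j ⬝ᵥ ((y t).2.2 j - _ *ᵥ _) = 0
    rw [hat_sq_mulVec, dotProduct_sub, hz, dotProduct_sub, dotProduct_smul, dotProduct_smul]
    change 0 - ((_ ⬝ᵥ _) • ((y t).2.1 j ⬝ᵥ (y t).2.1 j) - ((y t).2.1 j ⬝ᵥ (y t).2.1 j) • _) = 0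
    rw [hq, one_smul, smul_eq_mul, mul_one, sub_self, sub_zero]
  · have h : HasDerivWithinAt (fun s => (y s).1.1) (y t).1.2.1 I t := (hd t ht).fst.fst
    exact h.add ((D.x_smooth.differentiable (by simp)) t).hasDerivAt.hasDerivWithinAt
  · have := hasDerivWithinAt_qD (X := fun s => (toState D s (y s)).toLoadState) (hl t ht)
      (hmu' t ht j)
    simpa only [stage_toState] using this
  · have := qD_dot_stageOmD p D t (toState D t (y t)).toLoadState (D.refRates t) (y t).2.1 j
    simpa only [stage_toState] using this
  · have h : HasDerivWithinAt (fun s => errV D s (toState D s (y s)).toLoadState)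
        (loadRate p (stage D t (toState D t (y t)).toLoadState) (y t).2.1).2.1 I t :=
      (hl t ht).snd.fst
    refine h.congr_deriv ?_
    simp only [hcoup t ht]
    rfl
  · have hu : IsUnit p.JL.det := hJ.det_pos.ne'.isUnit
    have h : HasDerivWithinAt (fun s => errOm D s (toState D s (y s)).toLoadState)
        (loadRate p (stage D t (toState D t (y t)).toLoadState) (y t).2.1).2.2.2 I t :=
      (hl t ht).snd.snd.snd
    refine (hasDerivWithinAt_const_mulVec p.JL h).congr_deriv ?_
    simp only [hcoup t ht, loadRate]
    rw [Matrix.mulVec_mulVec, Matrix.mul_nonsing_inv _ hu, Matrix.one_mulVec]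
    rfl
  · have h : HasDerivWithinAt (fun s => (y s).2.2 j) (fieldOmErr p (D.refAll t, y t) j) I t :=
      hasDerivWithinAt_pi.1 (hd t ht).snd.snd j
    have e1 : errq p D t (toState D t (y t)) j =
        crossProduct (stageDir p (D.refData t, (y t).1) j) ((y t).2.1 j) := by
      rw [errq, ← stageDir_stage, stage_toState]; rfl
    have e2 : (y t).2.2 j ⬝ᵥ (y t).2.1 j = 0 := by rw [dotProduct_comm, hz]
    have e3 : fieldOmErr p (D.refAll t, y t) j =
        (crossProduct (fieldOm p (D.refAll t, y t) j) ((y t).2.1 j) ⬝ᵥ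
          stageOmD p (D.refData t, (y t).1) (D.refRates t) (y t).2.1 j) • (y t).2.1 j
        - p.kom • (y t).2.2 j - p.kq • errq p D t (toState D t (y t)) j := by
      rw [e1, fieldOmErr]
      dsimp only
      rw [e2, mul_zero, zero_smul, add_zero]
      rfl
    rw [e3, ← herr t j] at h
    have e4 : (fun s => (y s).2.2 j) = fun s => errom ((y s).2.1 j)
        (fieldOm p (D.refAll s, y s) j)
        (stageOmD p (D.refData s, (y s).1) (D.refRates s) (y s).2.1 j) :=
      funext fun s => (herr s j).symm
    rw [e4] at h
    exact h

/-! ### Global existence of solutions with small initial errors -/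

theorem toState_errors (D : DesiredTrajectory) (t : ℝ) (X : State) (z : Dirs) :
    toState D t (loadErr D t X.toLoadState, X.q, z) = X := by
  obtain ⟨L, q⟩ := X
  obtain ⟨x, v, R, Om⟩ := L
  have h1 : errX D t ⟨x, v, R, Om⟩ + D.x t = x := sub_add_cancel _ _
  have h2 : errV D t ⟨x, v, R, Om⟩ + deriv D.x t = v := sub_add_cancel _ _
  have h3 : errOm D t ⟨x, v, R, Om⟩ + OmRel D t ⟨x, v, R, Om⟩ = Om := sub_add_cancel _ _
  change (⟨⟨errX D t ⟨x, v, R, Om⟩ + D.x t, errV D t ⟨x, v, R, Om⟩ + deriv D.x t, R,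
    errOm D t ⟨x, v, R, Om⟩ + OmRel D t ⟨x, v, R, Om⟩⟩, q⟩ : State) = _
  rw [h1, h2, h3]

/-! ### Continuity of the error sizes along a trajectory -/

section Continuity

variable {p : Params} {D : DesiredTrajectory} {y : ℝ → Total}

theorem continuous_loadSize_toState (hy : Continuous y) :
    Continuous fun t => loadSize D t (toState D t (y t)).toLoadState := by
  have e : ∀ t, loadSize D t (toState D t (y t)).toLoadState = vnorm (y t).1.1 ^ 2
      + vnorm (y t).1.2.1 ^ 2 + PsiR D t (toState D t (y t)).toLoadState
      + vnorm (y t).1.2.2.2 ^ 2 := fun t => by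
    have h := loadErr_toState D t (y t)
    have h1 := congrArg Prod.fst h
    have h2 := congrArg (fun l => l.2.1) h
    have h3 := congrArg (fun l => l.2.2.2) h
    simp only [loadErr] at h1 h2 h3
    rw [loadSize, h1, h2, h3]
  simp only [e]
  have hRd : Continuous D.R := continuous_matrix fun i k =>
    continuous_iff_continuousAt.2 fun t => (D.R_deriv t i k).continuousAt
  have hR : Continuous fun t => (toState D t (y t)).R := continuous_matrix fun i k =>
    (continuous_apply_apply i k).comp hy.fst.snd.snd.fst
  have hΨ : Continuous fun t => PsiR D t (toState D t (y t)).toLoadState :=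
    continuous_const.mul (continuous_const.sub (hRd.matrix_transpose.matrix_mul hR)).matrix_trace
  exact ((((continuous_vnorm.comp hy.fst.fst).pow 2).add
    ((continuous_vnorm.comp hy.fst.snd.fst).pow 2)).add hΨ).add
    ((continuous_vnorm.comp hy.fst.snd.snd.snd).pow 2)

/-- Unlike the load part, the cable part involves the desired directions and is controlled only
where the forces do not vanish. -/
theorem continuousAt_errSize_toState (hy : Continuous y) {t : ℝ}
    (hmu : ∀ j, stageMu p (D.refData t, (y t).1) j ≠ 0) :
    ContinuousAt (fun t => errSize p D t (toState D t (y t)) (y t).2.2) t := by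
  refine (continuous_loadSize_toState hy).continuousAt.add ?_
  refine tendsto_finsetSum _ fun j _ => ?_
  have hq : ContinuousAt (fun t => (y t).2.1 j) t :=
    ((continuous_apply j).comp hy.snd.fst).continuousAt
  have hz : ContinuousAt (fun t => vnorm ((y t).2.2 j)) t :=
    (continuous_vnorm.comp ((continuous_apply j).comp hy.snd.snd)).continuousAt
  have hn : ContinuousAt (fun s => qD p D s (toState D s (y s)).toLoadState j) t := by
    have h1 : ContinuousAt (fun s => ((D.refData s, (y s).1) : Stage)) t :=
      ((continuous_refData D).prodMk hy.fst).continuousAt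
    have h2 : ContinuousAt (fun ζ => stageDir p ζ j) (D.refData t, (y t).1) :=
      (contDiffAt_stageDir (n := 0) (ζ := fun ζ => ζ) p contDiffAt_id j (hmu j)).continuousAt
    have h3 := ContinuousAt.comp (f := fun s => ((D.refData s, (y s).1) : Stage)) h2 h1
    refine h3.congr (Filter.Eventually.of_forall fun s => ?_)
    change _ = qD p D s (toState D s (y s)).toLoadState j
    rw [← stageDir_stage, stage_toState]
    rfl
  have hdot : ContinuousAt (fun s => qD p D s (toState D s (y s)).toLoadState j
      ⬝ᵥ (y s).2.1 j) t := by
    have h4 : Continuous fun w : Vec3 × Vec3 => w.1 ⬝ᵥ w.2 := by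
      simp only [dot3]; fun_prop
    exact ContinuousAt.comp (f := fun s => (qD p D s (toState D s (y s)).toLoadState j,
      (y s).2.1 j)) h4.continuousAt (hn.prodMk hq)
  exact (continuousAt_const.sub hdot).add (hz.pow 2)

end Continuity

/-- Continuation argument: as long as the errors are below `ρ`, the cutoff equals one and the global
cut-off solution solves the error dynamics; the decay estimate then prevents the errors from ever
reaching `ρ`. -/
theorem exists_solution {p : Params} {D : DesiredTrajectory} (hJ : p.JL.PosDef)
    {ρ ν C κ K lam : ℝ} (hρ : ρ ≤ 1) (hν : 0 < ν) (hK : 0 < K) (hlam : 0 < lam)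
    (hreg : ∀ t, 0 ≤ t → ‖D.refRates t‖ ≤ C ∧
      ∀ X : LoadState, X.R ∈ SO3 → loadSize D t X ≤ ρ →
        ‖stage D t X‖ ≤ C ∧ ∀ j, ν ≤ vnorm (muD p D t X j))
    (hdecay : ∀ t0 T X om omD, 0 ≤ t0 → t0 < T → IsSolution p D (Set.Ico t0 T) X om omD →
      errSize p D t0 (X t0) (fun j => errom ((X t0).q j) (om t0 j) (omD t0 j)) < κ →
      ∀ t ∈ Set.Ico t0 T,
        errSize p D t (X t) (fun j => errom ((X t).q j) (om t j) (omD t j)) ≤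
          K * errSize p D t0 (X t0) (fun j => errom ((X t0).q j) (om t0 j) (omD t0 j)) *
            Real.exp (-lam * (t - t0)))
    {t0 : ℝ} (ht0 : 0 ≤ t0) {X0 : State} {z0 : Dirs} (hX0 : Admissible p D t0 X0)
    (hz0 : ∀ j, X0.q j ⬝ᵥ z0 j = 0) (hs1 : errSize p D t0 X0 z0 < κ)
    (hs2 : K * errSize p D t0 X0 z0 < ρ) (hs3 : errSize p D t0 X0 z0 < ρ) :
    ∃ X om omD, IsSolution p D (Set.Ici t0) X om omD ∧ X t0 = X0 ∧
      ∀ j, errom ((X t0).q j) (om t0 j) (omD t0 j) = z0 j := by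
  obtain ⟨y, χ, hy0, hy, hχ⟩ := exists_cutoff_solution p (θ := D.refAll)
    ((continuous_refData D).prodMk (continuous_refRates D)) (max C 1) ν hν t0
    (loadErr D t0 X0.toLoadState, X0.q, z0)
  have hX0' : toState D t0 (y t0) = X0 := by rw [hy0, toState_errors]
  have hyc : Continuous y := continuous_iff_continuousAt.2 fun t => (hy t).continuousAt
  have hR : ∀ t, Stage.R (D.refData t, (y t).1) ∈ SO3 := R_mem_of_field (t0 := t0) hy (by
    have : (toState D t0 (y t0)).R ∈ SO3 := by rw [hX0']; exact hX0.R_mem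
    exact this)
  have hq : ∀ t j, (y t).2.1 j ⬝ᵥ (y t).2.1 j = 1 := fun t j =>
    q_unit_of_field hy (t0 := t0) j (by rw [hy0]; exact hX0.q_unit j) t
  have hz : ∀ t j, (y t).2.1 j ⬝ᵥ (y t).2.2 j = 0 := fun t j =>
    omErr_tangent_of_field hy (t0 := t0) j (fun t => hq t j) (by rw [hy0]; exact hz0 j) t
  set size : ℝ → ℝ := fun t => errSize p D t (toState D t (y t)) (y t).2.2 with hsize
  set lsize : ℝ → ℝ := fun t => loadSize D t (toState D t (y t)).toLoadState with hlsize
  have hsize0 : size t0 = errSize p D t0 X0 z0 := by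
    simp only [hsize, hy0, toState_errors]
  have hmu : ∀ t, t0 ≤ t → lsize t ≤ ρ → ∀ j, ν ≤ vnorm (stageMu p (D.refData t, (y t).1) j) := by
    intro t ht hl j
    have := ((hreg t (ht0.trans ht)).2 _ (hR t) hl).2 j
    rwa [← stageMu_stage, stage_toState] at this
  have hne : ∀ t, t0 ≤ t → lsize t ≤ ρ → ∀ j, stageMu p (D.refData t, (y t).1) j ≠ 0 := by
    intro t ht hl j h0
    have := hmu t ht hl j
    rw [h0, vnorm_zero] at this
    linarith
  have hadm : ∀ t, t0 ≤ t → lsize t ≤ ρ → Admissible p D t (toState D t (y t)) :=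
    fun t ht hl => ⟨hR t, hq t, fun j => by
      rw [← stageMu_stage, stage_toState]; exact hne t ht hl j⟩
  have hone : ∀ t, t0 ≤ t → lsize t ≤ ρ → size t ≤ ρ → χ t = 1 := by
    intro t ht hl hs
    refine hχ t ?_ (hmu t ht hl)
    obtain ⟨h1, h2⟩ := hreg t (ht0.trans ht)
    have h3 := (h2 _ (hR t) hl).1
    rw [stage_toState] at h3
    have h4 := norm_prod_le_iff.1 h3
    have hC := le_max_left C 1
    have h1C := le_max_right C 1
    refine norm_prod_le_iff.2 ⟨norm_prod_le_iff.2 ⟨h4.1.trans hC, h1.trans hC⟩,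
      norm_prod_le_iff.2 ⟨h4.2.trans hC, norm_prod_le_iff.2
        ⟨(pi_norm_le_iff_of_nonneg (by positivity)).2 fun j => (norm_le_vnorm _).trans ?_,
         (pi_norm_le_iff_of_nonneg (by positivity)).2 fun j => (norm_le_vnorm _).trans ?_⟩⟩⟩
    · rw [vnorm, hq t j, Real.sqrt_one]; exact h1C
    · refine le_trans (vnorm_le_of_sq_le zero_le_one ?_) h1C
      have h5 := (hadm t ht hl).cableSize_le (y t).2.2 j
      have h6 := (hadm t ht hl).Psiq_nonneg j
      rw [← vnorm_sq]
      have : size t ≤ 1 := hs.trans hρ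
      simp only [hsize] at this
      linarith
  have hsol : ∀ I : Set ℝ, (∀ t ∈ I, t0 ≤ t ∧ lsize t < ρ ∧ size t < ρ) →
      IsSolution p D I (fun t => toState D t (y t)) (fun t => fieldOm p (D.refAll t, y t))
        (fun t j => stageOmD p (D.refData t, (y t).1) (D.refRates t) (y t).2.1 j) := fun I hI =>
    isSolution_of_field hJ hy hR hq hz
      (fun t ht => hone t (hI t ht).1 (hI t ht).2.1.le (hI t ht).2.2.le)
      (fun t ht => hne t (hI t ht).1 (hI t ht).2.1.le)
  have herr : ∀ t j, errom ((toState D t (y t)).q j) (fieldOm p (D.refAll t, y t) j)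
      (stageOmD p (D.refData t, (y t).1) (D.refRates t) (y t).2.1 j) = (y t).2.2 j :=
    fun t j => errom_fieldOm p D t (y t) j
  have hlc : Continuous lsize := continuous_loadSize_toState hyc
  have hgood : ∀ t, t0 ≤ t → lsize t < ρ ∧ size t < ρ := by
    by_contra! hbad
    obtain ⟨t1, ht1, hbad1⟩ := hbad
    -- Both sizes are tracked because the total size is known to dominate the load size only where
    -- the desired directions are defined.
    set S : Set ℝ := {t | t0 ≤ t ∧ ¬(lsize t < ρ ∧ size t < ρ)} with hS
    have hSne : S.Nonempty := ⟨t1, ht1, fun h => absurd h.2 (not_lt.2 (hbad1 h.1))⟩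
    have hSb : BddBelow S := ⟨t0, fun t ht => ht.1⟩
    set T := sInf S
    have hT0 : t0 ≤ T := le_csInf hSne fun t ht => ht.1
    have hbefore : ∀ t ∈ Set.Ico t0 T, t0 ≤ t ∧ lsize t < ρ ∧ size t < ρ := fun t ht => by
      refine ⟨ht.1, ?_⟩
      by_contra h
      exact absurd (csInf_le hSb ⟨ht.1, h⟩) (not_le.2 ht.2)
    -- The order matters: the load size is continuous unconditionally, so its bound passes to `T`.
    -- This keeps the forces nonzero at `T`, which makes the total size continuous there, and the
    -- strict bound from the decay estimate follows.
    have hcase : lsize T ≤ ρ ∧ size T < ρ := by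
      rcases hT0.eq_or_lt with h | h
      · rw [← h, hsize0]
        refine ⟨?_, hs3⟩
        simp only [hlsize, hX0']
        exact (hX0.loadSize_le z0).trans hs3.le
      · have hev : ∀ᶠ t in nhdsWithin T (Set.Iio T), t ∈ Set.Ico t0 T := by
          filter_upwards [Ioo_mem_nhdsLT h] with t ht using ⟨ht.1.le, ht.2⟩
        have hlT : lsize T ≤ ρ := le_of_tendsto
          (hlc.continuousAt.tendsto.mono_left nhdsWithin_le_nhds)
          (hev.mono fun t ht => (hbefore t ht).2.1.le)
        refine ⟨hlT, ?_⟩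
        have hd := hdecay t0 T _ _ _ ht0 h (hsol _ hbefore) (by
          simp only [herr]; rw [← hsize0] at hs1; exact hs1)
        simp only [herr] at hd
        have hle : ∀ t ∈ Set.Ico t0 T, size t ≤ K * size t0 := fun t ht => by
          have h0 : 0 ≤ size t0 := by
            rw [hsize0]; exact hX0.loadSize_nonneg.trans (hX0.loadSize_le z0)
          refine (hd t ht).trans ?_
          have : Real.exp (-lam * (t - t0)) ≤ 1 := Real.exp_le_one_iff.2 (by nlinarith [ht.1])
          exact mul_le_of_le_one_right (mul_nonneg hK.le h0) this
        have := le_of_tendsto ((continuousAt_errSize_toState hyc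
          (hne T hT0 hlT)).tendsto.mono_left nhdsWithin_le_nhds) (hev.mono hle)
        rw [hsize0] at this
        exact this.trans_lt hs2
    have hadmT := hadm T hT0 hcase.1
    have hlT : lsize T < ρ := (hadmT.loadSize_le (y T).2.2).trans_lt hcase.2
    have hnear : ∀ᶠ t in nhds T, lsize t < ρ ∧ size t < ρ :=
      (hlc.continuousAt.eventually (gt_mem_nhds hlT)).and
        ((continuousAt_errSize_toState hyc (hne T hT0 hcase.1)).eventually
          (gt_mem_nhds hcase.2))
    obtain ⟨δ, hδ, hball⟩ := Metric.eventually_nhds_iff.1 hnear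
    obtain ⟨s, hsS, hs⟩ := exists_lt_of_csInf_lt hSne (show sInf S < T + δ by linarith)
    refine hsS.2 (hball ?_)
    rw [Real.dist_eq, abs_lt]
    constructor <;> linarith [csInf_le hSb hsS]
  refine ⟨_, _, _, hsol (Set.Ici t0) fun t ht => ⟨ht, hgood t ht⟩, hX0', fun j => ?_⟩
  rw [herr, hy0]

/-! ### Positivity of the gains -/

theorem lamMax_nonneg {J : Mat3} (hJ : J.PosDef) : 0 ≤ lamMax J := by
  refine Real.sSup_nonneg fun x hx => ?_
  rw [hJ.isHermitian.spectrum_real_eq_range_eigenvalues] at hx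
  obtain ⟨i, rfl⟩ := hx
  exact (hJ.eigenvalues_pos i).le

section Gains

variable {p : Params} {d : DomainConsts} {l : LyapConsts}

theorem W_diag_pos (h : MatricesPosDef p d l) (j : Fin 4) (i : Fin 3 × Fin 2) :
    0 < W p d l j i i := by
  have := (h.W_symm j).diag_pos (i := i)
  simp only [Matrix.smul_apply, Matrix.add_apply, Matrix.transpose_apply, smul_eq_mul] at this
  linarith

/-- Diagonal entries of a positive definite matrix are positive. The first diagonal entry of each
load block fixes the sign of its factor 1 - 4α(…), whatever the signs inside; the second then bounds
gain times factor from below by a nonnegative quantity. -/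
theorem gains_pos (hJ : p.JL.PosDef) (h : MatricesPosDef p d l) :
    0 < p.kx ∧ 0 < p.kv ∧ 0 < p.kR ∧ 0 < p.kOm ∧ 0 < p.kq ∧ 0 < p.kom := by
  have hcx := l.cx_pos
  have hcR := l.cR_pos
  have hcq := l.cq_pos
  have hx : 0 < p.kx := by
    have : 0 < (1 / 2 : ℝ) * p.kx := h.Px_lower.diag_pos (i := 0)
    linarith
  have hR : 0 < p.kR := by
    have : 0 < (1 / 2 : ℝ) * (2 * p.kR) := h.PR_lower.diag_pos (i := 0)
    linarith
  have hq : 0 < p.kq := by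
    have : 0 < (1 / 2 : ℝ) * (2 * p.kq) := h.Pq_lower.diag_pos (i := 0)
    linarith
  have w00 : 0 < (1 / 4 : ℝ) * (l.cx * p.kx * (1 - 4 * alpha d 0 * bet p)) :=
    W_diag_pos h 0 (0, 0)
  have w01 : 0 < (1 / 4 : ℝ) * (p.kv * (1 - 4 * alpha d 0 * bet p) - l.cx) :=
    W_diag_pos h 0 (0, 1)
  have w10 : 0 < (1 / 4 : ℝ) * (l.cR * p.kR * (1 - 4 * alpha d 0 * sig p 0)) :=
    W_diag_pos h 0 (1, 0)
  have w11 : 0 < (1 / 4 : ℝ) * (p.kOm * (1 - 4 * alpha d 0 * sig p 0) - 2 * l.cR * lamMax p.JL) :=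
    W_diag_pos h 0 (1, 1)
  have w21 : 0 < p.kom - l.cq := W_diag_pos h 0 (2, 1)
  have hlam := lamMax_nonneg hJ
  have h1 : 0 < 1 - 4 * alpha d 0 * bet p := by
    by_contra! hneg
    nlinarith [mul_pos hcx hx]
  have h2 : 0 < 1 - 4 * alpha d 0 * sig p 0 := by
    by_contra! hneg
    nlinarith [mul_pos hcR hR]
  refine ⟨hx, ?_, hR, ?_, hq, by linarith⟩
  · by_contra! hneg
    nlinarith
  · by_contra! hneg
    nlinarith [mul_nonneg hcR.le hlam]

end Gains

/-! ### Comparison of the error norm with the configuration errors -/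

section Compare

variable {p : Params} {D : DesiredTrajectory} {t : ℝ} {X : State}

theorem errNorm_nonneg (p : Params) (D : DesiredTrajectory) (t : ℝ) (X : State) (z : Dirs) :
    0 ≤ errNorm p D t X z := Real.sqrt_nonneg _

theorem errNorm_sq (p : Params) (D : DesiredTrajectory) (t : ℝ) (X : State) (z : Dirs) :
    errNorm p D t X z ^ 2 = vnorm (errX D t X.toLoadState) ^ 2
      + vnorm (errV D t X.toLoadState) ^ 2 + vnorm (errR D t X.toLoadState) ^ 2
      + vnorm (errOm D t X.toLoadState) ^ 2
      + ∑ j, (vnorm (errq p D t X j) ^ 2 + vnorm (z j) ^ 2) := by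
  have h : 0 ≤ ∑ j, (vnorm (errq p D t X j) ^ 2 + vnorm (z j) ^ 2) :=
    Finset.sum_nonneg fun j _ => by positivity
  exact Real.sq_sqrt (by positivity)

theorem Admissible.errNorm_sq_le (h : Admissible p D t X) (z : Dirs) :
    errNorm p D t X z ^ 2 ≤ 2 * errSize p D t X z := by
  have h1 : ∑ j, (vnorm (errq p D t X j) ^ 2 + vnorm (z j) ^ 2) ≤
      2 * ∑ j, (Psiq p D t X j + vnorm (z j) ^ 2) := by
    rw [Finset.mul_sum]
    refine Finset.sum_le_sum fun j _ => ?_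
    rw [h.vnorm_errq_sq j]
    linarith [mul_two_sub_le (Psiq p D t X j), sq_nonneg (vnorm (z j))]
  have h2 := mul_two_sub_le (PsiR D t X.toLoadState)
  rw [errNorm_sq, errSize, loadSize, vnorm_errR_sq D t h.R_mem]
  linarith [sq_nonneg (vnorm (errX D t X.toLoadState)), sq_nonneg (vnorm (errV D t X.toLoadState)),
    sq_nonneg (vnorm (errOm D t X.toLoadState))]

/-- Stated without admissibility because it serves to prove that the desired forces are nonzero at a
given initial state. -/
theorem loadSize_le_errNorm_sq (hR : X.R ∈ SO3) (h : PsiR D t X.toLoadState ≤ 1) (z : Dirs) :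
    loadSize D t X.toLoadState ≤ errNorm p D t X z ^ 2 := by
  have h1 : 0 ≤ ∑ j, (vnorm (errq p D t X j) ^ 2 + vnorm (z j) ^ 2) :=
    Finset.sum_nonneg fun j _ => by positivity
  rw [errNorm_sq, loadSize, vnorm_errR_sq D t hR]
  linarith [le_mul_two_sub (PsiR_nonneg D t hR) h]

theorem Admissible.errSize_le (h : Admissible p D t X) {d : DomainConsts}
    (hd : InDomain p D d t X) (z : Dirs) : errSize p D t X z ≤ errNorm p D t X z ^ 2 := by
  have h1 : ∑ j, (Psiq p D t X j + vnorm (z j) ^ 2) ≤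
      ∑ j, (vnorm (errq p D t X j) ^ 2 + vnorm (z j) ^ 2) := by
    refine Finset.sum_le_sum fun j _ => ?_
    rw [h.vnorm_errq_sq j]
    linarith [le_mul_two_sub (h.Psiq_nonneg j) ((hd.2.2 j).le.trans (d.psiq_lt j).le)]
  have h2 := le_mul_two_sub (PsiR_nonneg D t h.R_mem) (hd.2.1.le.trans d.psiR_lt.le)
  rw [errNorm_sq, errSize, loadSize, vnorm_errR_sq D t h.R_mem]
  linarith

theorem DomainConsts.exists_inDomain (p : Params) (D : DesiredTrajectory) (d : DomainConsts) :
    ∃ η > 0, ∀ t X z, Admissible p D t X → errSize p D t X z < η → InDomain p D d t X := by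
  obtain ⟨m, hm, hmq⟩ : ∃ m > 0, ∀ j, m ≤ d.psiq j := by
    obtain ⟨j0, -, h0⟩ := Finset.exists_min_image Finset.univ d.psiq Finset.univ_nonempty
    exact ⟨d.psiq j0, d.psiq_pos j0, fun j => h0 j (Finset.mem_univ j)⟩
  refine ⟨min (min (d.exMax ^ 2) d.psiR) m,
    lt_min (lt_min (pow_pos d.exMax_pos 2) d.psiR_pos) hm, fun t X z h hs => ?_⟩
  obtain ⟨hs1, hs2⟩ := lt_min_iff.1 hs
  obtain ⟨hs3, hs4⟩ := lt_min_iff.1 hs1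
  exact ⟨lt_of_pow_lt_pow_left₀ 2 d.exMax_pos.le ((h.vnorm_errX_sq_le z).trans_lt hs3),
    (h.PsiR_le z).trans_lt hs4, fun j => ((h.Psiq_le z j).trans_lt hs2).trans_le (hmq j)⟩

end Compare

/-! ### Stability -/

theorem originIsExponentiallyStable {p : Params} {D : DesiredTrajectory} (d : DomainConsts)
    (hkx : 0 < p.kx) (hkv : 0 < p.kv) (hkR : 0 < p.kR) (hkOm : 0 < p.kOm)
    (hkq : 0 < p.kq) (hkom : 0 < p.kom) (hJ : p.JL.PosDef) (hD : D.IsBounded)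
    (hmu : ∃ ν > 0, ∀ t : ℝ, 0 ≤ t → ∀ j, ν ≤ vnorm (muD p D t (D.load t) j)) :
    OriginIsExponentiallyStable p D d := by
  obtain ⟨ρ, hρ0, ν, hν, C, -, hρ, hreg⟩ := exists_region hD hmu
  obtain ⟨κ, hκ, K, hK, lam, hlam, hdecay⟩ :=
    exists_decay hkx hkv hkR hkOm hkq hkom hJ hρ0 hρ hν hreg
  obtain ⟨η, hη, hdom⟩ := d.exists_inDomain p D
  -- `κ` and `ρ` start the decay estimate; `ρ / K` and `η / K` keep later sizes below `ρ` and inside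
  -- the domain.
  set b := min (min κ ρ) (min (ρ / K) (η / K))
  have hb : 0 < b := lt_min (lt_min hκ hρ0) (lt_min (by positivity) (by positivity))
  have hb1 : b ≤ κ := (min_le_left _ _).trans (min_le_left _ _)
  have hb2 : b ≤ ρ := (min_le_left _ _).trans (min_le_right _ _)
  have hb3 : K * b ≤ ρ := by
    have : b ≤ ρ / K := (min_le_right _ _).trans (min_le_left _ _)
    rwa [le_div_iff₀ hK, mul_comm] at this
  have hb4 : K * b ≤ η := by
    have : b ≤ η / K := (min_le_right _ _).trans (min_le_right _ _)
    rwa [le_div_iff₀ hK, mul_comm] at this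
  have hsq : ∀ {x : ℝ}, 0 ≤ x → x < Real.sqrt b → x ^ 2 < b := fun hx h => by
    have := pow_lt_pow_left₀ h hx two_ne_zero
    rwa [Real.sq_sqrt hb.le] at this
  -- Sizes are quadratic in the error norm, hence the square roots and the halved rate; the 2 comes
  -- from |e|² ≤ 2Ψ.
  refine ⟨Real.sqrt b, Real.sqrt_pos.2 hb, Real.sqrt (2 * K), Real.sqrt_pos.2 (by positivity),
    lam / 2, by positivity, fun t0 ht0 => ⟨?_, ?_⟩⟩
  · intro X0 z0 hR hq hz hin hs
    have hs' := hsq (errNorm_nonneg p D t0 X0 z0) hs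
    have hload := (loadSize_le_errNorm_sq (p := p) hR (hin.2.1.le.trans d.psiR_lt.le) z0).trans
      (hs'.le.trans hb2)
    have hadm : Admissible p D t0 X0 := ⟨hR, hq, fun j h0 => by
      have := ((hreg t0 ht0).2 _ hR hload).2 j
      rw [h0, vnorm_zero] at this
      linarith⟩
    have hsize := (hadm.errSize_le hin z0).trans_lt hs'
    exact exists_solution hJ hρ hν hK hlam hreg hdecay ht0 hadm hz (hsize.trans_le hb1)
      ((mul_lt_mul_of_pos_left hsize hK).trans_le hb3) (hsize.trans_le hb2)
  · intro T X om omD hT h hin hs t ht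
    have h00 : t0 ∈ Set.Ico t0 T := ⟨le_rfl, hT⟩
    have hadm0 := h.admissible h00
    have hadm := h.admissible ht
    have hsize0 := hadm0.errSize_le hin fun j => errom ((X t0).q j) (om t0 j) (omD t0 j)
    have hsmall := hsize0.trans_lt (hsq (errNorm_nonneg _ _ _ _ _) hs)
    have hd := hdecay t0 T X om omD ht0 hT h (hsmall.trans_le hb1) t ht
    have he0 := Real.exp_pos (-lam * (t - t0))
    have he1 : Real.exp (-lam * (t - t0)) ≤ 1 := Real.exp_le_one_iff.2 (by nlinarith [ht.1])
    have hnn : 0 ≤ errSize p D t0 (X t0) fun j => errom ((X t0).q j) (om t0 j) (omD t0 j) :=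
      hadm0.loadSize_nonneg.trans (hadm0.loadSize_le _)
    constructor
    · refine hdom t (X t) _ hadm (hd.trans_lt ?_)
      refine (mul_le_of_le_one_right (mul_nonneg hK.le hnn) he1).trans_lt ?_
      exact (mul_lt_mul_of_pos_left hsmall hK).trans_le hb4
    · have hn := hadm.errNorm_sq_le fun j => errom ((X t).q j) (om t j) (omD t j)
      have h1 : errAlong p D X om omD t ^ 2 ≤
          2 * K * errAlong p D X om omD t0 ^ 2 * Real.exp (-lam * (t - t0)) := by
        have h2 := mul_le_mul_of_nonneg_right (mul_le_mul_of_nonneg_left hsize0 hK.le) he0.le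
        have h3 := hn.trans (mul_le_mul_of_nonneg_left (hd.trans h2) zero_le_two)
        refine h3.trans (le_of_eq ?_)
        rw [errAlong]
        ring
      refine abs_le_of_sq_le_sq' ?_ ?_ |>.2
      · refine h1.trans (le_of_eq ?_)
        rw [mul_pow, mul_pow, Real.sq_sqrt (by positivity), ← Real.exp_nat_mul]
        congr 2
        push_cast
        ring
      · exact mul_nonneg (mul_nonneg (Real.sqrt_nonneg _) (errNorm_nonneg _ _ _ _ _))
          (Real.exp_pos _).le

/-- Starting on the desired motion with the cables in their desired directions and no angular
velocity error, the exponential estimate with zero right-hand side forces the error to vanish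
forever. -/
theorem originIsEquilibrium {p : Params} {D : DesiredTrajectory} {d : DomainConsts}
    (hmu : ∃ ν > 0, ∀ t : ℝ, 0 ≤ t → ∀ j, ν ≤ vnorm (muD p D t (D.load t) j))
    (hst : OriginIsExponentiallyStable p D d) : OriginIsEquilibrium p D d := by
  obtain ⟨ν, hν, hmu⟩ := hmu
  obtain ⟨c, hc, K, hK, lam, hlam, hst⟩ := hst
  intro t0 ht0
  obtain ⟨hex, hest⟩ := hst t0 ht0
  set X0 : State := { D.load t0 with q := qD p D t0 (D.load t0) }
  have hne : ∀ j, muD p D t0 (D.load t0) j ≠ 0 := fun j h0 => by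
    have := hmu t0 ht0 j
    rw [h0, vnorm_zero] at this
    linarith
  have hadm : Admissible p D t0 X0 := ⟨D.R_mem t0, fun j => qD_unit (hne j), hne⟩
  have hl := loadErr_load D t0
  have hx : errX D t0 (D.load t0) = 0 := congrArg Prod.fst hl
  have hv : errV D t0 (D.load t0) = 0 := congrArg (fun l => l.2.1) hl
  have ho : errOm D t0 (D.load t0) = 0 := congrArg (fun l => l.2.2.2) hl
  have hΨ : PsiR D t0 (D.load t0) = 0 := by
    have : (D.R t0)ᵀ * (D.load t0).R = 1 := SO3_transpose_mul_self (D.R_mem t0)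
    rw [PsiR, this, sub_self, Matrix.trace_zero, mul_zero]
  have hΨq : ∀ j, Psiq p D t0 X0 j = 0 := fun j => sub_eq_zero.2 (qD_unit (hne j)).symm
  have hsize : errSize p D t0 X0 0 = 0 := by
    have : loadSize D t0 (D.load t0) = 0 := by rw [loadSize, hx, hv, ho, hΨ]; simp
    change loadSize D t0 (D.load t0) + _ = 0
    rw [this, zero_add]
    refine Finset.sum_eq_zero fun j _ => ?_
    rw [hΨq j, Pi.zero_apply, vnorm_zero]
    norm_num
  have hnorm : errNorm p D t0 X0 0 = 0 := by
    have h1 := hadm.errNorm_sq_le 0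
    rw [hsize, mul_zero] at h1
    exact pow_eq_zero_iff two_ne_zero |>.1 (le_antisymm h1 (sq_nonneg _))
  have hin : InDomain p D d t0 X0 := by
    refine ⟨?_, ?_, fun j => ?_⟩
    · change vnorm (errX D t0 (D.load t0)) < _
      rw [hx, vnorm_zero]; exact d.exMax_pos
    · exact hΨ.trans_lt d.psiR_pos
    · exact (hΨq j).trans_lt (d.psiq_pos j)
  obtain ⟨X, om, omD, hsol, hX0, herr⟩ := hex X0 0 (D.R_mem t0) (fun j => qD_unit (hne j))
    (fun j => dotProduct_zero _) hin (by rw [hnorm]; exact hc)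
  have h0 : errAlong p D X om omD t0 = 0 := by
    have : (fun j => errom ((X t0).q j) (om t0 j) (omD t0 j)) = 0 := funext herr
    rw [errAlong, this, hX0, hnorm]
  refine ⟨X, om, omD, hsol, fun t ht => ?_⟩
  -- The estimate concerns half-open intervals, so one reaching beyond `t` is taken.
  have hsol' : IsSolution p D (Set.Ico t0 (t + 1)) X om omD := hsol.mono Set.Ico_subset_Ici_self
  have := hest (t + 1) X om omD (by linarith) hsol' (by rw [hX0]; exact hin) (by rw [h0]; exact hc)
    t ⟨ht, by linarith⟩
  rw [h0, mul_zero, zero_mul] at this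
  exact ⟨this.1, le_antisymm this.2 (errNorm_nonneg _ _ _ _ _)⟩

end CableLoad

end

theorem lemma1 (p : CableLoad.Params) (D : CableLoad.DesiredTrajectory)
    (d : CableLoad.DomainConsts) (l : CableLoad.LyapConsts)
    (hm : 0 < p.mL) (hJ : p.JL.PosDef) (hP : p.P.rank = 6)
    (hD : D.IsBounded)
    (hmu : ∃ ν > 0, ∀ t : ℝ, 0 ≤ t → ∀ j,
      ν ≤ CableLoad.vnorm (CableLoad.muD p D t (D.load t) j))
    (hpos : CableLoad.MatricesPosDef p d l) :
    CableLoad.OriginIsEquilibrium p D d ∧ CableLoad.OriginIsExponentiallyStable p D d := by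
  obtain ⟨hx, hv, hR, hOm, hq, hom⟩ := CableLoad.gains_pos hJ hpos
  have hst := CableLoad.originIsExponentiallyStable d hx hv hR hOm hq hom hJ hD hmu
  exact ⟨CableLoad.originIsEquilibrium hmu hst, hst⟩
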